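/- Let $\Bbbk$ be an algebraically closed field. A $\Bbbk$-category $\mathcal A$ is called *locally finite dimensional (lofd)* if its morphism spaces are finite dimensional, it is additive with split idempotents, and for each object $x$ only finitely many isomorphism classes of indecomposable objects $y$ satisfy $\mathcal A(x,y)\neq 0$ or $\mathcal A(y,x)\ne 0$. Let $\mathcal A$ be a lofd category whose radical has square zero, and let $Q$ be its quiver: the vertices of $Q$ are representatives of the isomorphism classes of indecomposable objects, and the arrows $x\to y$ are morphisms forming a basis of $\operatorname{rad}(x,y)$ modulo $\operatorname{rad}^2(x,y)$. Let $\mathcal A\text{-mod}$ be the category of $\Bbbk$-linear functors from $\mathcal A$ to finite dimensional vector spaces that are nonzero on only finitely many isomorphism classes of indecomposables, let $\mathcal D^b(\mathcal A)$ be its bounded derived category with shift $[1]$, and put $\mathcal A^x=\mathcal A(x,-)$. Let $Q^\Box$ be the quiver with vertices $(x,n)$, $x\in Q_0$, $n\in\mathbb Z$, and with an arrow $(\alpha,n):(y,n)\to(x,n-1)$ for every arrow $\alpha:x\to y$ of $Q$ and every $n\in\mathbb Z$. For a quiver $\Gamma$ let $\operatorname{rep}(\Bbbk\Gamma)$ be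 the category of its representations by finite dimensional spaces, only finitely many of which are nonzero. For $M\in\operatorname{rep}(\Bbbk Q^\Box)$ let $\mathbf F(M)$ be the complex of projective $\mathcal A$-modules $$P_n=\bigoplus_{x\in Q_0}\mathcal A^x\otimes M(x,n),\qquad d_n:P_n\to P_{n-1},$$ where the component $\mathcal A^y\otimes M(y,n)\to\mathcal A^x\otimes M(x,n-1)$ of $d_n$ is $\sum_{\alpha:x\to y}\mathcal A^\alpha\otimes M(\alpha,n)$. Suppose that $Q$ satisfies the walk condition: every closed walk in $Q$ has as many arrows traversed forwards as arrows traversed backwards. Suppose also that $Q$ contains no infinite oriented path $x_0\to x_1\to x_2\to\cdots$ (this holds automatically if $Q$ has finitely many vertices, or if $\mathcal A$ has finite global dimension). Fix one vertex in each connected component of $Q$, and let $Q[0]$ be the union of those connected components of $Q^\Box$ that contain $(a,0)$ for a fixed vertex $a$ (a single component if $Q$ is connected and nonempty). By the walk condition, $(x,n)\mapsto x$ identifies $Q[0]$ with $Q^{\mathrm{op}}$. For $M\in\operatorname{rep}(\Bbbk Q^{\mathrm{op}})$ let $\imath(M)\in\operatorname{rep}(\Bbbk Q^\Box)$ be the representation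 $M$ carried over to $Q[0]$ and extended by zero. Then the complexes $\mathbf F(\imath(M))[i]$, where $M$ runs over representatives of the isomorphism classes of indecomposable objects of $\operatorname{rep}(\Bbbk Q^{\mathrm{op}})$ and $i$ over $\mathbb Z$, form a complete list of pairwise non-isomorphic indecomposable objects of $\mathcal D^b(\mathcal A)$. That is: 1. every such $\mathbf F(\imath(M))[i]$ is an indecomposable object of $\mathcal D^b(\mathcal A)$; 2. every indecomposable object of $\mathcal D^b(\mathcal A)$ is isomorphic to some $\mathbf F(\imath(M))[i]$ with $M$ indecomposable; 3. for indecomposable $M,N$ and $i,j\in\mathbb Z$, $\mathbf F(\imath(M))[i]\cong\mathbf F(\imath(N))[j]$ if and only if $i=j$ and $M\cong N$. -/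

import Mathlib

open CategoryTheory CategoryTheory.Limits
open scoped TensorProduct

universe v u w t s

noncomputable section

namespace RadSqZero

/-- Finite biproducts are in particular binary biproducts. -/
instance hasBinaryBiproducts_of_finite {C : Type*} [Category* C] [HasZeroMorphisms C]
    [HasFiniteBiproducts C] : HasBinaryBiproducts C :=
  hasBinaryBiproducts_of_finite_biproducts C

/-! ### Locally finite dimensional categories, their radical and their quiver -/

section Lofd

variable (A : Type u) [Category.{v} A] [Preadditive A]

/-- Isomorphism classes of objects of `A`. -/
abbrev IsoClass : Type u := Quotient (isIsomorphicSetoid A)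

/-- A fully additive `k`-category (finite biproducts exist and idempotents split) is locally finite
dimensional if its morphism spaces are finite dimensional and if, for every object `X`, only
finitely many isomorphism classes of indecomposable objects `Y` satisfy `A(X, Y) ≠ 0` or
`A(Y, X) ≠ 0`. -/
class IsLofd (k : Type v) [Field k] [Linear k A] : Prop extends
    HasFiniteBiproducts A, IsIdempotentComplete A where
  finite_hom : ∀ X Y : A, FiniteDimensional k (X ⟶ Y)
  finite_neighbours : ∀ X : A,
    {c : IsoClass A | ∃ Y : A, c = Quotient.mk _ Y ∧ Indecomposable Y ∧
      ((∃ f : X ⟶ Y, f ≠ 0) ∨ (∃ f : Y ⟶ X, f ≠ 0))}.Finite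

variable {A}

/-- The (Jacobson) radical of the category: `f : X ⟶ Y` is radical if and only if `1 - gf` is
invertible for all `g : Y ⟶ X`. -/
def rad (X Y : A) : Set (X ⟶ Y) :=
  {f | ∀ g : Y ⟶ X, IsIso (𝟙 X - f ≫ g)}

/-- The square of the radical: the subspace spanned by products of two radical morphisms. -/
def radSq (k : Type v) [Field k] [Linear k A] (X Z : A) : Submodule k (X ⟶ Z) :=
  Submodule.span k {h | ∃ (Y : A) (f : X ⟶ Y) (g : Y ⟶ Z), f ∈ rad X Y ∧ g ∈ rad Y Z ∧ h = f ≫ g}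

variable (A) in
/-- The radical has square zero. -/
def RadicalSquareZero : Prop :=
  ∀ ⦃X Y Z : A⦄ (f : X ⟶ Y) (g : Y ⟶ Z), f ∈ rad X Y → g ∈ rad Y Z → f ≫ g = 0

/-- An identification of the quiver `Q` with the quiver of `A`: the vertices are representatives
of the isomorphism classes of indecomposable objects, and the arrows from `x` to `y` are
morphisms in `rad(x, y)` that form a basis of `rad(x, y)` modulo `rad²(x, y)`. -/
structure QuiverOf (k : Type v) [Field k] (A : Type u) [Category.{v} A] [Preadditive A]
    [Linear k A] [IsLofd A k] (Q : Type w) [Quiver.{t} Q] where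
  /-- the indecomposable object at a vertex -/
  obj : Q → A
  indecomposable : ∀ x, Indecomposable (obj x)
  existsUnique : ∀ X : A, Indecomposable X → ∃! x, Nonempty (X ≅ obj x)
  /-- the morphism at an arrow -/
  arr : ∀ {x y : Q}, (x ⟶ y) → (obj x ⟶ obj y)
  arr_mem : ∀ {x y : Q} (α : x ⟶ y), arr α ∈ rad (obj x) (obj y)
  linearIndependent : ∀ x y : Q,
    LinearIndependent k fun α : x ⟶ y ↦ (radSq k (obj x) (obj y)).mkQ (arr α)
  span : ∀ x y : Q, ∀ f ∈ rad (obj x) (obj y),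
    f ∈ Submodule.span k (Set.range fun α : x ⟶ y ↦ arr α) ⊔ radSq k (obj x) (obj y)

end Lofd

/-! ### Finite dimensional modules over a lofd category -/

section Modules

variable (k : Type v) [Field k] (A : Type u) [Category.{v} A] [Preadditive A] [Linear k A]
  [IsLofd A k]

/-- Finite dimensional `A`-modules: `k`-linear functors `M` from `A` to finite dimensional vector
spaces such that `M X ≠ 0` for only finitely many isomorphism classes of indecomposable `X`. -/
structure IsFDModule (M : A ⥤ ModuleCat.{v} k) : Prop where
  additive : M.Additive
  linear : M.Linear k
  finite : ∀ X, FiniteDimensional k (M.obj X)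
  support : {c : IsoClass A | ∃ X : A, c = Quotient.mk _ X ∧ Indecomposable X ∧
    Nontrivial (M.obj X)}.Finite

/-- The property of functors of being a finite dimensional module. -/
def fdModule : ObjectProperty (A ⥤ ModuleCat.{v} k) := fun M ↦ IsFDModule k A M

/-- The category `A`-mod of finite dimensional `A`-modules. -/
abbrev FDMod := (fdModule k A).FullSubcategory

variable {k A}

lemma IsFDModule.of_mono {M N : A ⥤ ModuleCat.{v} k} (i : M ⟶ N) [Mono i]
    (h : IsFDModule k A N) : IsFDModule k A M := by
  have hi (X) : Function.Injective (i.app X) := (ModuleCat.mono_iff_injective _).1 inferInstance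
  have := h.additive
  have := h.linear
  refine ⟨⟨fun {X Y f g} ↦ ?_⟩, ⟨fun {X Y} f r ↦ ?_⟩, fun X ↦ ?_, ?_⟩
  · rw [← cancel_mono (i.app Y)]
    simp [N.map_add]
  · rw [← cancel_mono (i.app Y)]
    simp
  · have := h.finite X
    exact Module.Finite.of_injective (i.app X).hom (hi X)
  · refine h.support.subset ?_
    rintro c ⟨X, rfl, hX, hn⟩
    exact ⟨X, rfl, hX, (hi X).nontrivial⟩

lemma IsFDModule.of_epi {M N : A ⥤ ModuleCat.{v} k} (p : M ⟶ N) [Epi p]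
    (h : IsFDModule k A M) : IsFDModule k A N := by
  have hp (X) : Function.Surjective (p.app X) := (ModuleCat.epi_iff_surjective _).1 inferInstance
  have := h.additive
  have := h.linear
  refine ⟨⟨fun {X Y f g} ↦ ?_⟩, ⟨fun {X Y} f r ↦ ?_⟩, fun X ↦ ?_, ?_⟩
  · rw [← cancel_epi (p.app X)]
    simp only [← p.naturality, M.map_add, Preadditive.comp_add, Preadditive.add_comp]
  · rw [← cancel_epi (p.app X)]
    simp only [← p.naturality, Functor.map_smul, Linear.comp_smul, Linear.smul_comp]
  · have := h.finite X
    exact Module.Finite.of_surjective (p.app X).hom (hp X)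
  · refine h.support.subset ?_
    rintro c ⟨X, rfl, hX, hn⟩
    exact ⟨X, rfl, hX, (hp X).nontrivial⟩

/-- A retract-type criterion used for binary products. -/
lemma IsFDModule.of_sum {L M N : A ⥤ ModuleCat.{v} k} (p : L ⟶ M) (q : L ⟶ N) (i : M ⟶ L)
    (j : N ⟶ L) (e : p ≫ i + q ≫ j = 𝟙 L) (hM : IsFDModule k A M) (hN : IsFDModule k A N) :
    IsFDModule k A L := by
  have e' (X) : p.app X ≫ i.app X + q.app X ≫ j.app X = 𝟙 (L.obj X) := by
    rw [← NatTrans.id_app, ← e]; rfl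
  have e'' (X) (x : L.obj X) : i.app X (p.app X x) + j.app X (q.app X x) = x := by
    simpa using ConcreteCategory.congr_hom (e' X) x
  have := hM.additive
  have := hM.linear
  have := hN.additive
  have := hN.linear
  have key {X Y : A} (f : X ⟶ Y) :
      L.map f = p.app X ≫ M.map f ≫ i.app Y + q.app X ≫ N.map f ≫ j.app Y := by
    rw [← Category.comp_id (L.map f), ← e']
    simp
  refine ⟨⟨fun {X Y f g} ↦ ?_⟩, ⟨fun {X Y} f r ↦ ?_⟩, fun X ↦ ?_, ?_⟩
  · rw [key, key f, key g, M.map_add, N.map_add]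
    simp only [Preadditive.add_comp, Preadditive.comp_add]
    abel
  · rw [key, key f]
    simp
  · have := hM.finite X
    have := hN.finite X
    refine Module.Finite.of_surjective ((i.app X).hom.coprod (j.app X).hom) fun x ↦ ?_
    exact ⟨(p.app X x, q.app X x), by simpa using e'' X x⟩
  · refine (hM.support.union hN.support).subset ?_
    rintro c ⟨X, rfl, hX, hn⟩
    obtain ⟨x, hx⟩ := exists_ne (0 : L.obj X)
    by_cases hp : p.app X x = 0
    · by_cases hq : q.app X x = 0
      · refine absurd (e'' X x) ?_
        rw [hp, hq, map_zero, map_zero, add_zero]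
        exact hx.symm
      · exact Or.inr ⟨X, rfl, hX, ⟨_, _, hq⟩⟩
    · exact Or.inl ⟨X, rfl, hX, ⟨_, _, hp⟩⟩

lemma isFDModule_zero {M : A ⥤ ModuleCat.{v} k} (h : IsZero M) : IsFDModule k A M := by
  have hs (X) : IsZero (M.obj X) := h.obj X
  have hs' (X) : Subsingleton (M.obj X) := ModuleCat.isZero_iff_subsingleton.1 (hs X)
  refine ⟨⟨fun {X Y f g} ↦ (hs X).eq_of_src _ _⟩, ⟨fun {X Y} f r ↦ (hs X).eq_of_src _ _⟩,
    fun X ↦ inferInstance, ?_⟩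
  convert Set.finite_empty
  ext c
  simp only [Set.mem_ofPred_eq, Set.mem_empty_iff_false, iff_false]
  rintro ⟨X, -, -, hn⟩
  exact not_subsingleton _ (hs' X)

instance : (fdModule k A).IsClosedUnderSubobjects where
  prop_of_mono f _ h := IsFDModule.of_mono f h

instance : (fdModule k A).IsClosedUnderQuotients where
  prop_of_epi f _ h := IsFDModule.of_epi f h

instance : (fdModule k A).ContainsZero where
  exists_zero := ⟨_, isZero_zero _, isFDModule_zero (isZero_zero _)⟩

/-- A binary product `L` of `M` and `N` in a preadditive category is a sum of images of `M` and
`N`. -/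
lemma exists_decomp_of_isLimit {C : Type*} [Category* C] [Preadditive C]
    {D : Discrete WalkingPair ⥤ C} (c : Cone D) (hc : IsLimit c) :
    ∃ (p : c.pt ⟶ D.obj ⟨.left⟩) (q : c.pt ⟶ D.obj ⟨.right⟩) (i : D.obj ⟨.left⟩ ⟶ c.pt)
      (j : D.obj ⟨.right⟩ ⟶ c.pt), p ≫ i + q ≫ j = 𝟙 c.pt := by
  let cl : Cone D := ⟨D.obj ⟨.left⟩, Discrete.natTrans fun ⟨x⟩ ↦
    match x with
    | .left => 𝟙 _
    | .right => 0⟩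
  let cr : Cone D := ⟨D.obj ⟨.right⟩, Discrete.natTrans fun ⟨x⟩ ↦
    match x with
    | .left => 0
    | .right => 𝟙 _⟩
  refine ⟨c.π.app ⟨.left⟩, c.π.app ⟨.right⟩, hc.lift cl, hc.lift cr, hc.hom_ext ?_⟩
  rintro ⟨_ | _⟩ <;> simp [cl, cr]

instance : (fdModule k A).IsClosedUnderBinaryProducts where
  limitsOfShape_le := by
    rintro L ⟨P⟩
    obtain ⟨p, q, i, j, e⟩ := exists_decomp_of_isLimit _ P.isLimit
    exact IsFDModule.of_sum p q i j e (P.prop_diag_obj ⟨.left⟩) (P.prop_diag_obj ⟨.right⟩)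

instance : (fdModule k A).IsClosedUnderFiniteProducts :=
  ObjectProperty.IsClosedUnderFiniteProducts.mk'

instance : HasZeroMorphisms (FDMod k A) := Preadditive.preadditiveHasZeroMorphisms

instance : HasFiniteBiproducts (FDMod k A) := HasFiniteBiproducts.of_hasFiniteProducts

variable (k A) in
/-- The functor `A(X, -) ⊗ V`. -/
@[simps]
def projFunctor (X : A) (V : ModuleCat.{v} k) : A ⥤ ModuleCat.{v} k where
  obj Z := ModuleCat.of k ((X ⟶ Z) ⊗[k] V)
  map g := ModuleCat.ofHom (TensorProduct.map (Linear.rightComp k X g) LinearMap.id)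
  map_id Z := by
    ext : 1
    refine TensorProduct.ext' fun h v ↦ ?_
    simp
  map_comp g g' := by
    ext : 1
    refine TensorProduct.ext' fun h v ↦ ?_
    simp

lemma isFDModule_projFunctor (X : A) (V : ModuleCat.{v} k) (hV : FiniteDimensional k V) :
    IsFDModule k A (projFunctor k A X V) := by
  have h := IsLofd.finite_hom (k := k) (A := A)
  refine ⟨⟨fun {Y Z f g} ↦ ?_⟩, ⟨fun {Y Z} f r ↦ ?_⟩, fun Y ↦ ?_, ?_⟩
  · ext : 1
    refine TensorProduct.ext' fun h v ↦ ?_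
    change (h ≫ (f + g)) ⊗ₜ[k] v = (h ≫ f) ⊗ₜ[k] v + (h ≫ g) ⊗ₜ[k] v
    rw [Preadditive.comp_add, TensorProduct.add_tmul]
  · ext : 1
    refine TensorProduct.ext' fun h v ↦ ?_
    change (h ≫ (r • f)) ⊗ₜ[k] v = r • ((h ≫ f) ⊗ₜ[k] v)
    rw [Linear.comp_smul, TensorProduct.smul_tmul']
  · have := h X Y
    exact inferInstanceAs (FiniteDimensional k ((X ⟶ Y) ⊗[k] V))
  · refine (IsLofd.finite_neighbours (k := k) X).subset ?_
    rintro c ⟨Y, rfl, hY, hn⟩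
    refine ⟨Y, rfl, hY, Or.inl ?_⟩
    by_contra! hf
    have : Subsingleton (X ⟶ Y) := ⟨fun f g ↦ by rw [hf f, hf g]⟩
    have h' : Subsingleton ((X ⟶ Y) ⊗[k] V) := inferInstance
    exact not_subsingleton_iff_nontrivial.2 hn h'

variable (k A) in
/-- The projective module `A^X ⊗ V`, where `A^X = A(X, -)` and `V` is a finite dimensional vector
space. -/
def proj (X : A) (V : ModuleCat.{v} k) (hV : FiniteDimensional k V) : FDMod k A :=
  ⟨projFunctor k A X V, isFDModule_projFunctor X V hV⟩

/-- The morphism `A^f ⊗ φ : A^Y ⊗ V ⟶ A^X ⊗ W` given by `f : X ⟶ Y` and `φ : V ⟶ W`. It maps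
`g ⊗ v` to `(f ≫ g) ⊗ φ v`. -/
def projMap {X Y : A} (f : X ⟶ Y) {V W : ModuleCat.{v} k} {hV : FiniteDimensional k V}
    {hW : FiniteDimensional k W} (φ : V ⟶ W) : proj k A Y V hV ⟶ proj k A X W hW :=
  ObjectProperty.homMk
    { app Z := ModuleCat.ofHom (TensorProduct.map (Linear.leftComp k Z f) φ.hom)
      naturality Z Z' g := by
        ext : 1
        refine TensorProduct.ext' fun h v ↦ ?_
        change (f ≫ h ≫ g) ⊗ₜ[k] φ v = ((f ≫ h) ≫ g) ⊗ₜ[k] φ v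
        rw [Category.assoc] }

lemma projMap_comp_eq_zero {X Y Z : A} (f : X ⟶ Y) (g : Y ⟶ Z) (h : f ≫ g = 0)
    {U V W : ModuleCat.{v} k} {hU : FiniteDimensional k U} {hV : FiniteDimensional k V}
    {hW : FiniteDimensional k W} (φ : U ⟶ V) (ψ : V ⟶ W) :
    projMap (hV := hU) (hW := hV) g φ ≫ projMap (hW := hW) f ψ = 0 := by
  apply ObjectProperty.hom_ext
  ext T : 3
  refine TensorProduct.ext' fun l v ↦ ?_
  change (f ≫ g ≫ l) ⊗ₜ[k] ψ (φ v) = 0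
  rw [reassoc_of% h, zero_comp, TensorProduct.zero_tmul]

end Modules

/-! ### Finite dimensional representations of quivers -/

section Representations

variable (k : Type v) [Field k] (V : Type w) [Quiver.{t} V]

/-- A representation of the quiver `V` over `k` (equivalently, a functor on the free category of
paths) that consists of finite dimensional spaces, only finitely many of which are nonzero. -/
structure IsFinRep (M : Paths V ⥤ ModuleCat.{v} k) : Prop where
  finite : ∀ x : V, FiniteDimensional k (M.obj ((Paths.of V).obj x))
  support : {x : V | Nontrivial (M.obj ((Paths.of V).obj x))}.Finite

/-- The property of representations of being finite dimensional with finite support. -/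
def finRep : ObjectProperty (Paths V ⥤ ModuleCat.{v} k) := fun M ↦ IsFinRep k V M

/-- The category `rep(k V)` of representations of the quiver `V` in finite dimensional vector spaces
with finite support. -/
abbrev FinRep := (finRep k V).FullSubcategory

variable {k V}

lemma IsFinRep.of_sum {L M N : Paths V ⥤ ModuleCat.{v} k} (p : L ⟶ M) (q : L ⟶ N) (i : M ⟶ L)
    (j : N ⟶ L) (e : p ≫ i + q ≫ j = 𝟙 L) (hM : IsFinRep k V M) (hN : IsFinRep k V N) :
    IsFinRep k V L := by
  have e' (X) : p.app X ≫ i.app X + q.app X ≫ j.app X = 𝟙 (L.obj X) := by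
    rw [← NatTrans.id_app, ← e]; rfl
  have e'' (X) (x : L.obj X) : i.app X (p.app X x) + j.app X (q.app X x) = x := by
    simpa using ConcreteCategory.congr_hom (e' X) x
  refine ⟨fun X ↦ ?_, ?_⟩
  · have := hM.finite X
    have := hN.finite X
    refine Module.Finite.of_surjective ((i.app _).hom.coprod (j.app _).hom) fun x ↦ ?_
    exact ⟨(p.app _ x, q.app _ x), by simpa using e'' _ x⟩
  · refine (hM.support.union hN.support).subset ?_
    intro X hn
    obtain ⟨x, hx⟩ := @exists_ne _ hn 0
    by_cases hp : p.app _ x = 0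
    · by_cases hq : q.app _ x = 0
      · refine absurd (e'' _ x) ?_
        rw [hp, hq, map_zero, map_zero, add_zero]
        exact hx.symm
      · exact Or.inr ⟨_, _, hq⟩
    · exact Or.inl ⟨_, _, hp⟩

lemma isFinRep_zero {M : Paths V ⥤ ModuleCat.{v} k} (h : IsZero M) : IsFinRep k V M := by
  have hs' (X) : Subsingleton (M.obj X) := ModuleCat.isZero_iff_subsingleton.1 (h.obj X)
  refine ⟨fun X ↦ inferInstance, ?_⟩
  convert Set.finite_empty
  ext X
  simp only [Set.mem_ofPred_eq, Set.mem_empty_iff_false, iff_false]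
  exact fun hn ↦ not_subsingleton_iff_nontrivial.2 hn (hs' _)

instance : (finRep k V).ContainsZero where
  exists_zero := ⟨_, isZero_zero _, isFinRep_zero (isZero_zero _)⟩

instance : (finRep k V).IsClosedUnderBinaryProducts where
  limitsOfShape_le := by
    rintro L ⟨P⟩
    obtain ⟨p, q, i, j, e⟩ := exists_decomp_of_isLimit _ P.isLimit
    exact IsFinRep.of_sum p q i j e (P.prop_diag_obj ⟨.left⟩) (P.prop_diag_obj ⟨.right⟩)

instance : (finRep k V).IsClosedUnderIsomorphisms where
  of_iso {M N} e h := IsFinRep.of_sum e.inv e.inv e.hom 0 (by simp) h h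

instance : (finRep k V).IsClosedUnderFiniteProducts :=
  ObjectProperty.IsClosedUnderFiniteProducts.mk'

instance : HasZeroMorphisms (FinRep k V) := Preadditive.preadditiveHasZeroMorphisms

instance : HasFiniteBiproducts (FinRep k V) := HasFiniteBiproducts.of_hasFiniteProducts

end Representations

/-! ### Walks and the quiver `Q^□` -/

section Walks

variable (Q : Type w) [Quiver.{t} Q]

variable {Q} in
/-- The number of arrows that a walk traverses forwards. A walk in `Q` is a path in the quiver
obtained from `Q` by adding a formal inverse of each arrow. -/
def forward {a : Quiver.Symmetrify Q} : ∀ {b : Quiver.Symmetrify Q}, Quiver.Path a b → ℕ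
  | _, .nil => 0
  | _, .cons p (.inl _) => forward p + 1
  | _, .cons p (.inr _) => forward p

variable {Q} in
/-- The number of arrows that a walk traverses backwards. -/
def backward {a : Quiver.Symmetrify Q} : ∀ {b : Quiver.Symmetrify Q}, Quiver.Path a b → ℕ
  | _, .nil => 0
  | _, .cons p (.inl _) => backward p
  | _, .cons p (.inr _) => backward p + 1

/-- The walk condition: each closed walk has as many forward as backward arrows. -/
def WalkCondition : Prop :=
  ∀ (a : Quiver.Symmetrify Q) (p : Quiver.Path a a), forward p = backward p

/-- The vertices of `Q^□`: pairs of a vertex of `Q` and an integer. -/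
structure Box where
  /-- the vertex of `Q` -/
  pt : Q
  /-- the integer -/
  deg : ℤ

variable {Q}

/-- The arrows of `Q^□`: an arrow `α : a ⟶ b` of `Q` and an integer `i` give an arrow
`(b, i) ⟶ (a, i - 1)`. -/
instance : Quiver.{t} (Box Q) where
  Hom v w := { _α : w.pt ⟶ v.pt // w.deg = v.deg - 1 }

/-- For a choice of one base vertex in each connected component of `Q`, the vertices of `Q[0]`: those
of the connected components of `Q^□` that contain `(a, 0)` for a base vertex `a`. (For connected `Q`
there is exactly one base vertex, and `Q[0]` is a single component.) -/
def zeroPart (base : Quiver.WeaklyConnectedComponent Q → Q) : Set (Box Q) :=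
  {v | ∃ c, Quiver.WeaklyConnectedComponent.mk v = Quiver.WeaklyConnectedComponent.mk ⟨base c, 0⟩}

lemma mk_eq_of_hom {V : Type*} [Quiver V] {v w : V} (f : v ⟶ w) :
    Quiver.WeaklyConnectedComponent.mk v = Quiver.WeaklyConnectedComponent.mk w :=
  (Quiver.WeaklyConnectedComponent.eq v w).2 ⟨Quiver.Path.nil.cons (.inl f)⟩

lemma mem_zeroPart_of_hom {base : Quiver.WeaklyConnectedComponent Q → Q} {v w : Box Q} (f : v ⟶ w)
    (h : w ∈ zeroPart base) : v ∈ zeroPart base := by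
  obtain ⟨c, hc⟩ := h
  exact ⟨c, (mk_eq_of_hom f).trans hc⟩

/-- A walk in `Q^□` lies over a walk in `Q`, and the difference of the degrees is determined by it. -/
lemma exists_walk {v : Quiver.Symmetrify (Box Q)} :
    ∀ {w : Quiver.Symmetrify (Box Q)}, Quiver.Path v w →
      ∃ p : @Quiver.Path (Quiver.Symmetrify Q) _ (Box.pt v) (Box.pt w),
        Box.deg w = Box.deg v + forward p - backward p
  | _, .nil => ⟨.nil, by simp [forward, backward]⟩
  | _, .cons p (.inl f) => by
      obtain ⟨q, hq⟩ := exists_walk p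
      refine ⟨q.cons (.inr f.1), ?_⟩
      have := f.2
      simp only [forward, backward]
      push_cast
      omega
  | _, .cons p (.inr f) => by
      obtain ⟨q, hq⟩ := exists_walk p
      refine ⟨q.cons (.inl f.1), ?_⟩
      have := f.2
      simp only [forward, backward]
      push_cast
      omega


lemma deg_eq_of_mem_zeroPart (hQ : WalkCondition Q) {base : Quiver.WeaklyConnectedComponent Q → Q}
    (hbase : ∀ c, Quiver.WeaklyConnectedComponent.mk (base c) = c) {v w : Box Q}
    (hv : v ∈ zeroPart base) (hw : w ∈ zeroPart base) (h : v.pt = w.pt) : v.deg = w.deg := by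
  obtain ⟨c, hc⟩ := hv
  obtain ⟨d, hd⟩ := hw
  obtain ⟨p⟩ := (Quiver.WeaklyConnectedComponent.eq _ _).1 hc
  obtain ⟨q⟩ := (Quiver.WeaklyConnectedComponent.eq _ _).1 hd
  obtain ⟨p', hp'⟩ := exists_walk p
  obtain ⟨q', hq'⟩ := exists_walk q
  have hcd : c = d := by
    rw [← hbase c, ← hbase d]
    have e₁ := (Quiver.WeaklyConnectedComponent.eq (V := Q) _ _).2 ⟨p'⟩
    have e₂ := (Quiver.WeaklyConnectedComponent.eq (V := Q) _ _).2 ⟨q'⟩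
    exact e₁.symm.trans ((congrArg _ h).trans e₂)
  subst hcd
  obtain ⟨r⟩ := (Quiver.WeaklyConnectedComponent.eq _ _).1 (hc.trans hd.symm)
  obtain ⟨r', hr'⟩ := exists_walk r
  obtain ⟨x, i⟩ := v
  obtain ⟨y, j⟩ := w
  obtain rfl : x = y := h
  have := hQ _ r'
  change j = i + _ - _ at hr'
  change i = j
  omega

end Walks

/-! ### The extension functor `ı` on objects -/

section Extension

variable {k : Type v} [Field k] {Q : Type w} [Quiver.{t} Q]

/-- The underlying representation of `ı M`: its value at a vertex `(b, n)` is `M b` if `(b, n)`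
belongs to `Q[0]` and `0` otherwise (it consists of the functions from the proofs of
`(b, n) ∈ Q[0]` to `M b`); the arrow `(b, n) ⟶ (a, n - 1)` of `Q[0]` given by `α : a ⟶ b` acts as
the opposite arrow of `α` does on `M`. -/
def extendFunctor (base : Quiver.WeaklyConnectedComponent Q → Q)
    (M : Paths Qᵒᵖ ⥤ ModuleCat.{v} k) : Paths (Box Q) ⥤ ModuleCat.{v} k :=
  Paths.lift
    { obj v := ModuleCat.of k (PLift (v ∈ zeroPart base) → M.obj ((Paths.of Qᵒᵖ).obj (.op v.pt)))
      map f := ModuleCat.ofHom (LinearMap.pi fun h ↦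
        (M.map ((Paths.of Qᵒᵖ).map f.1.op)).hom ∘ₗ
          LinearMap.proj (PLift.up (mem_zeroPart_of_hom f h.down))) }

/-- For a quiver `Q` with the walk condition, `Q[0]` contains exactly one vertex over each vertex of
`Q`, so that `Q[0]` is isomorphic to `Q^op`; `ı M` is the representation `M` of `Q^op`, carried over
to `Q[0]` and extended by zero to `Q^□`. -/
def extend (hQ : WalkCondition Q) (base : Quiver.WeaklyConnectedComponent Q → Q)
    (hbase : ∀ c, Quiver.WeaklyConnectedComponent.mk (base c) = c) (M : FinRep k Qᵒᵖ) :
    FinRep k (Box Q) :=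
  ⟨extendFunctor base M.obj, by
    refine ⟨fun v ↦ ?_, ?_⟩
    · have := M.property.finite (.op v.pt)
      exact inferInstanceAs (FiniteDimensional k
        (PLift (v ∈ zeroPart base) → M.obj.obj ((Paths.of Qᵒᵖ).obj (.op v.pt))))
    · have key (v : Box Q) (hv : Nontrivial ((extendFunctor base M.obj).obj
          ((Paths.of (Box Q)).obj v))) : v ∈ zeroPart base ∧
            Nontrivial (M.obj.obj ((Paths.of Qᵒᵖ).obj (.op v.pt))) := by
        obtain ⟨f, g, hfg⟩ := hv
        change PLift (v ∈ zeroPart base) → M.obj.obj ((Paths.of Qᵒᵖ).obj (.op v.pt)) at f g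
        obtain ⟨⟨h⟩, hne⟩ := Function.ne_iff.1 hfg
        exact ⟨h, ⟨_, _, hne⟩⟩
      refine Set.Finite.of_finite_image (f := fun v : Box Q ↦ Opposite.op v.pt)
        (M.property.support.subset ?_) ?_
      · rintro _ ⟨v, hv, rfl⟩
        exact (key v hv).2
      · intro v hv w hw h
        have hpt : v.pt = w.pt := Opposite.op_injective h
        have hdeg := deg_eq_of_mem_zeroPart hQ hbase (key v hv).1 (key w hw).1 hpt
        cases v
        cases w
        simp_all⟩

end Extension

/-! ### The complex `F(M)` -/

section Complex

variable {k : Type v} [Field k] {A : Type u} [Category.{v} A] [Preadditive A] [Linear k A]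
  [IsLofd A k] {Q : Type w} [Quiver.{t} Q]

lemma QuiverOf.finite_hom (q : QuiverOf k A Q) (x y : Q) : Finite (x ⟶ y) := by
  have := IsLofd.finite_hom (k := k) (q.obj x) (q.obj y)
  exact (q.linearIndependent x y).finite

/-- The vertices `x` with `M(x, n) ≠ 0`. -/
abbrev SuppAt (M : FinRep k (Box Q)) (n : ℤ) : Type w :=
  {x : Q // Nontrivial (M.obj.obj ((Paths.of (Box Q)).obj ⟨x, n⟩))}

instance (M : FinRep k (Box Q)) (n : ℤ) : Finite (SuppAt M n) := by
  refine Set.Finite.to_subtype (s := {x : Q | _}) ?_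
  exact M.property.support.preimage (f := fun x : Q ↦ Box.mk x n) (fun x _ y _ h ↦ by simpa using h)

/-- The summand `A^x ⊗ M(x, n)` of `P_n`. -/
abbrev summand (q : QuiverOf k A Q) (M : FinRep k (Box Q)) (n : ℤ) (x : Q) : FDMod k A :=
  proj k A (q.obj x) (M.obj.obj ((Paths.of (Box Q)).obj ⟨x, n⟩)) (M.property.finite ⟨x, n⟩)

/-- The projective module `P_n`, the direct sum of all `A^x ⊗ M(x, n)`; only finitely many of them
are nonzero. -/
abbrev term (q : QuiverOf k A Q) (M : FinRep k (Box Q)) (n : ℤ) : FDMod k A :=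
  ⨁ fun x : SuppAt M n ↦ summand q M n x

/-- The component `A^y ⊗ M(y, n) ⟶ A^x ⊗ M(x, n - 1)` of the differential: the sum of all
`A^α ⊗ M(α, n)`, where `α` runs over the arrows from `x` to `y`. -/
def component (q : QuiverOf k A Q) (M : FinRep k (Box Q)) (n n' : ℤ) (h : n' = n - 1) (y x : Q) :
    summand q M n y ⟶ summand q M n' x :=
  letI := q.finite_hom x y
  letI := Fintype.ofFinite (x ⟶ y)
  ∑ α : x ⟶ y, projMap (q.arr α) (M.obj.map ((Paths.of (Box Q)).map
    (⟨α, h⟩ : (⟨y, n⟩ : Box Q) ⟶ ⟨x, n'⟩)))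

/-- The differential `P_n ⟶ P_{n - 1}`. -/
def diff (q : QuiverOf k A Q) (M : FinRep k (Box Q)) (n n' : ℤ) (h : n' = n - 1) :
    term q M n ⟶ term q M n' :=
  biproduct.desc fun y ↦ biproduct.lift fun x ↦ component q M n n' h y x

lemma component_comp (hA : RadicalSquareZero A) (q : QuiverOf k A Q) (M : FinRep k (Box Q))
    (n n' n'' : ℤ) (h : n' = n - 1) (h' : n'' = n' - 1) (z y x : Q) :
    component q M n n' h z y ≫ component q M n' n'' h' y x = 0 := by
  unfold component
  rw [Preadditive.sum_comp]
  simp only [Preadditive.comp_sum]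
  refine Finset.sum_eq_zero fun β _ ↦ Finset.sum_eq_zero fun α _ ↦ ?_
  exact projMap_comp_eq_zero _ _ (hA _ _ (q.arr_mem _) (q.arr_mem _)) _ _

lemma lift_desc_eq_sum {C : Type*} [Category* C] [Preadditive C] {J : Type*} [Fintype J] {f : J → C}
    [HasBiproduct f] {T U : C} (g : ∀ j, T ⟶ f j) (h : ∀ j, f j ⟶ U) :
    biproduct.lift g ≫ biproduct.desc h = ∑ j, g j ≫ h j := by
  have e := IsBilimit.total (biproduct.isBilimit f)
  rw [← Category.id_comp (biproduct.desc h), ← e, Preadditive.sum_comp, Preadditive.comp_sum]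
  refine Finset.sum_congr rfl fun j _ ↦ ?_
  simp

lemma diff_comp (hA : RadicalSquareZero A) (q : QuiverOf k A Q) (M : FinRep k (Box Q))
    (n n' n'' : ℤ) (h : n' = n - 1) (h' : n'' = n' - 1) :
    diff q M n n' h ≫ diff q M n' n'' h' = 0 := by
  have := Fintype.ofFinite (SuppAt M n')
  unfold diff
  refine biproduct.hom_ext' _ _ fun z ↦ biproduct.hom_ext _ _ fun x ↦ ?_
  rw [biproduct.ι_desc_assoc, lift_desc_eq_sum, Preadditive.sum_comp, comp_zero, zero_comp]
  refine Finset.sum_eq_zero fun y _ ↦ ?_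
  rw [Category.assoc, biproduct.lift_π, component_comp hA]

/-- The complex `F(M)`, written cohomologically: its term in degree `m` is `P_{-m}`. -/
def complexF (hA : RadicalSquareZero A) (q : QuiverOf k A Q) (M : FinRep k (Box Q)) :
    CochainComplex (FDMod k A) ℤ where
  X m := term q M (-m)
  d m m' := if h : m + 1 = m' then diff q M (-m) (-m') (by omega) else 0
  shape m m' h := dif_neg h
  d_comp_d' m m' m'' h h' := by
    have h₁ : m + 1 = m' := h
    have h₂ : m' + 1 = m'' := h'
    rw [dif_pos h₁, dif_pos h₂, diff_comp hA]

lemma exists_bound (M : FinRep k (Box Q)) : ∃ N : ℤ, ∀ n, IsEmpty (SuppAt M n) ∨ |n| ≤ N := by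
  obtain ⟨N, hN⟩ := (M.property.support.image fun v ↦ |v.deg|).bddAbove
  refine ⟨N, fun n ↦ ?_⟩
  by_cases h : IsEmpty (SuppAt M n)
  · exact .inl h
  · obtain ⟨x⟩ := not_isEmpty_iff.1 h
    exact .inr (hN ⟨⟨x.1, n⟩, x.2, rfl⟩)

lemma isZero_term (q : QuiverOf k A Q) (M : FinRep k (Box Q)) (n : ℤ) (h : IsEmpty (SuppAt M n)) :
    IsZero (term q M n) := by
  rw [IsZero.iff_id_eq_zero]
  exact biproduct.hom_ext' _ _ fun z ↦ h.elim z

lemma bounded_complexF [HasDerivedCategory.{s} (FDMod k A)] (hA : RadicalSquareZero A)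
    (q : QuiverOf k A Q) (M : FinRep k (Box Q)) :
    (DerivedCategory.TStructure.t (C := FDMod k A)).bounded (DerivedCategory.Q.obj (complexF hA q M)) := by
  obtain ⟨N, hN⟩ := exists_bound M
  have hz (m : ℤ) (hm : N < |m|) : IsZero ((complexF hA q M).X m) := by
    refine isZero_term q M (-m) ((hN (-m)).resolve_right ?_)
    rw [abs_neg]
    exact not_le.2 hm
  have h₁ : (complexF hA q M).IsStrictlyGE (-N) :=
    (CochainComplex.isStrictlyGE_iff _ _).2 fun m hm ↦ hz m (lt_abs.2 (.inr (by omega)))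
  have h₂ : (complexF hA q M).IsStrictlyLE N :=
    (CochainComplex.isStrictlyLE_iff _ _).2 fun m hm ↦ hz m (lt_abs.2 (.inl hm))
  exact ⟨⟨-N, (DerivedCategory.isGE_Q_obj_iff _ _).2 inferInstance⟩,
    ⟨N, (DerivedCategory.isLE_Q_obj_iff _ _).2 inferInstance⟩⟩

end Complex

section Object

variable {k : Type v} [Field k] {A : Type u} [Category.{v} A] [Preadditive A] [Linear k A]
  [IsLofd A k] {Q : Type w} [Quiver.{t} Q] [HasDerivedCategory.{s} (FDMod k A)]

/-- The complex `F(M)` as an object of the bounded derived category of `A`-mod. -/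
def objF (hA : RadicalSquareZero A) (q : QuiverOf k A Q) (M : FinRep k (Box Q)) :
    DerivedCategory.Bounded (FDMod k A) :=
  ⟨DerivedCategory.Q.obj (complexF hA q M), bounded_complexF hA q M⟩

end Object
end RadSqZero

end

/-!
Let `A` be a lofd category whose radical has square zero. A complex of projective `A`-modules with
radical differentials is the same thing as a graded representation of `Q` (that is, a representation
of `Q^□`): the `m`-th term is the direct sum of modules `A^x ⊗ W x m`, and the differential, which
takes the generators `W x m` to linear combinations of arrows with coefficients in the `W y (m + 1)`,
is given by arbitrary linear maps, because a product of two arrows is zero. The structure `Model`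
records such an identification, and `modelF` says that `F(M)` belongs to `M`.

Morphisms of complexes induce morphisms of graded representations, modulo the radicals
(`Model.exists_grHom`), and each morphism of graded representations lifts to the complexes
(`Model.exists_hom`). Homotopic morphisms agree modulo the radicals
(`Model.sub_mem_of_homotopy`), and an endomorphism that vanishes modulo the radicals has square zero
(`Model.comp_self_eq_zero`). As morphisms in the derived category between bounded complexes of
projectives are homotopy classes, such complexes are isomorphic in the derived category if and only
if their graded representations are isomorphic (`Model.nonempty_grIso`, `Model.nonempty_iso`), and
idempotents on both sides correspond (`Model.eq_zero_or_id`, `Model.eq_id_of_indecomposable`).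

If `Q` has no infinite path, then by König's lemma the paths that start at a given vertex have bounded
length (`exists_shortPaths`). The kernel of a projective cover lives in the radical, at proper
successors, so that all modules have bounded projective resolutions (`hasBddRes_single`). Hence all
objects of the bounded derived category are given by bounded complexes of projectives
(`HasBddRes.of_bounded`), and contractible summands can be split off until the differentials are
radical (`exists_radical`).

By the walk condition each vertex `x` has a height such that `(x, -m)` belongs to `Q[0]` exactly for
`m = height x`. So the graded representation of `F(ı M)[i]` is concentrated at the places
`(x, height x - i)` (`grRepEquiv`), the functor from representations of `Q^op` to graded
representations is full and faithful (`grRepFunctor`), and for each `i` the values at these places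
form a direct summand of an arbitrary graded representation, which is in the image of the functor
(`exists_retract`). The classification follows.
-/

noncomputable section

namespace RadSqZero

/-! ### Idempotents and indecomposable objects -/

section Idempotents

variable {C : Type*} [Category* C] [Preadditive C]

/-- The biproduct decomposition given by two complementary retracts. -/
def biprodIsoOfRetracts [HasBinaryBiproducts C] {X Y Z : C} (i : Y ⟶ X) (p : X ⟶ Y) (j : Z ⟶ X)
    (r : X ⟶ Z) (hi : i ≫ p = 𝟙 Y) (hj : j ≫ r = 𝟙 Z) (h : p ≫ i + r ≫ j = 𝟙 X) : X ≅ Y ⊞ Z :=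
  have hij : i ≫ r = 0 := by
    have h₁ : i ≫ (p ≫ i + r ≫ j) ≫ r = i ≫ r := by rw [h, Category.id_comp]
    simp only [Preadditive.add_comp, Preadditive.comp_add, Category.assoc, hj,
      reassoc_of% hi, Category.comp_id] at h₁
    exact left_eq_add.1 h₁.symm
  have hji : j ≫ p = 0 := by
    have h₁ : j ≫ (p ≫ i + r ≫ j) ≫ p = j ≫ p := by rw [h, Category.id_comp]
    simp only [Preadditive.add_comp, Preadditive.comp_add, Category.assoc, hi,
      reassoc_of% hj, Category.comp_id] at h₁
    exact left_eq_add.1 h₁.symm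
  { hom := biprod.lift p r
    inv := biprod.desc i j
    hom_inv_id := by simp [h]
    inv_hom_id := by
      ext <;> simp [hi, hj, hij, hji] }

lemma isZero_of_retract {X Y : C} (i : Y ⟶ X) (p : X ⟶ Y) (hi : i ≫ p = 𝟙 Y) (h : IsZero X) :
    IsZero Y := by
  rw [IsZero.iff_id_eq_zero, ← hi, h.eq_of_tgt i 0, zero_comp]

/-- Idempotents split, so that an idempotent `e` decomposes the object into the images of `e` and
`1 - e`. -/
lemma eq_zero_or_id_of_indecomposable [HasBinaryBiproducts C] [IsIdempotentComplete C] {X : C}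
    (hX : Indecomposable X) (e : X ⟶ X) (he : e ≫ e = e) : e = 0 ∨ e = 𝟙 X := by
  obtain ⟨Y, i, p, hi, hp⟩ := IsIdempotentComplete.idempotents_split X e he
  obtain ⟨Z, j, r, hj, hr⟩ := IsIdempotentComplete.idempotents_split X (𝟙 X - e)
    (by simp [Preadditive.comp_sub, Preadditive.sub_comp, he])
  rcases hX.2 Y Z (biprodIsoOfRetracts i p j r hi hj (by rw [hp, hr]; abel)) with h | h
  · left
    rw [← hp, h.eq_of_src i 0, comp_zero]
  · right
    have : r ≫ j = 0 := by rw [h.eq_of_src j 0, comp_zero]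
    exact (sub_eq_zero.1 (hr.symm.trans this)).symm

/-- An object whose only idempotent endomorphisms are `0` and `1` is indecomposable. -/
lemma indecomposable_of_idempotents [HasBinaryBiproducts C] {X : C} (h0 : ¬ IsZero X)
    (h : ∀ e : X ⟶ X, e ≫ e = e → e = 0 ∨ e = 𝟙 X) : Indecomposable X := by
  refine ⟨h0, fun Y Z e ↦ ?_⟩
  rcases h (e.hom ≫ biprod.fst ≫ biprod.inl ≫ e.inv) (by simp) with h' | h'
  · left
    rw [IsZero.iff_id_eq_zero]
    have : (biprod.inl ≫ e.inv) ≫ (e.hom ≫ biprod.fst ≫ biprod.inl ≫ e.inv) ≫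
        e.hom ≫ biprod.fst = 𝟙 Y := by simp
    rw [← this, h']
    simp
  · right
    rw [IsZero.iff_id_eq_zero]
    have : (biprod.inr ≫ e.inv) ≫ 𝟙 X ≫ e.hom ≫ biprod.snd = 𝟙 Z := by simp
    rw [← this, ← h']
    simp

lemma id_ne_zero_of_indecomposable [HasBinaryBiproducts C] {X : C} (hX : Indecomposable X) :
    𝟙 X ≠ 0 :=
  fun h ↦ hX.1 ((IsZero.iff_id_eq_zero X).2 h)

end Idempotents

/-- An element of a finite dimensional algebra without nontrivial idempotents is nilpotent or
invertible: if the minimal polynomial of `a` is `X ^ n * q` with `q` prime to `X`, a Bézout relation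
`u * X ^ n + v * q = 1` yields the idempotent `u(a) * a ^ n`. -/
lemma isNilpotent_or_isUnit (k : Type*) [Field k] {E : Type*} [Ring E] [Algebra k E]
    [FiniteDimensional k E] (hE : ∀ e : E, e * e = e → e = 0 ∨ e = 1) (a : E) :
    IsNilpotent a ∨ IsUnit a := by
  open Polynomial in
  obtain ⟨q, hq, hdvd⟩ := Polynomial.exists_eq_pow_rootMultiplicity_mul_and_not_dvd
    (minpoly k a) (minpoly.ne_zero (Algebra.IsIntegral.isIntegral a)) 0
  rw [map_zero, sub_zero] at hq hdvd
  set n := rootMultiplicity 0 (minpoly k a)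
  have hcop : IsCoprime (X ^ n : k[X]) q :=
    (Polynomial.irreducible_X.coprime_iff_not_dvd.2 hdvd).pow_left
  obtain ⟨u, v, huv⟩ := hcop
  have h₀ : a ^ n * aeval a q = 0 := by
    have := minpoly.aeval k a
    rwa [hq, map_mul, map_pow, aeval_X] at this
  have h₁ : aeval a u * a ^ n + aeval a v * aeval a q = 1 := by
    simpa using congrArg (aeval a) huv
  have hc (r : k[X]) : Commute a (aeval a r) := by
    have h := congrArg (aeval a) (mul_comm X r)
    rwa [map_mul, map_mul, aeval_X] at h
  have hcn (r : k[X]) : Commute (a ^ n) (aeval a r) := (hc r).pow_left n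
  have hee : (aeval a u * a ^ n) * (aeval a v * aeval a q) = 0 := by
    rw [mul_assoc, ← mul_assoc (a ^ n), (hcn v).eq, mul_assoc (aeval a v), h₀, mul_zero, mul_zero]
  rcases hE (aeval a u * a ^ n) (by
    conv_rhs => rw [← mul_one (aeval a u * a ^ n), ← h₁, mul_add, hee, add_zero]) with h | h
  · left
    refine ⟨n, ?_⟩
    rw [← mul_one (a ^ n), ← h₁, h, zero_add, ← mul_assoc, (hcn v).eq, mul_assoc, h₀, mul_zero]
  · right
    rcases Nat.eq_zero_or_pos n with hn | hn
    · rw [hn, pow_zero, one_mul] at h₀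
      have h0 : q.eval 0 ≠ 0 := by
        rwa [Ne, ← Polynomial.coeff_zero_eq_eval_zero, ← Polynomial.X_dvd_iff]
      have hdiv := Polynomial.divX_mul_X_add q
      rw [← hdiv, Polynomial.coeff_zero_eq_eval_zero] at h₀
      simp only [map_add, map_mul, aeval_X, aeval_C] at h₀
      have h2 : aeval a q.divX * a = - algebraMap k E (q.eval 0) := eq_neg_of_add_eq_zero_left h₀
      have h3 : (algebraMap k E (-(q.eval 0)⁻¹) * aeval a q.divX) * a = 1 := by
        rw [mul_assoc, h2, map_neg, neg_mul_neg, ← map_mul, inv_mul_cancel₀ h0, map_one]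
      have : IsArtinianRing E := IsArtinianRing.of_finite k E
      exact IsUnit.of_mul_eq_one_right _ h3
    · obtain ⟨m, hm⟩ : ∃ m, n = m + 1 := ⟨n - 1, by omega⟩
      have : IsArtinianRing E := IsArtinianRing.of_finite k E
      rw [hm, pow_succ, ← mul_assoc] at h
      exact IsUnit.of_mul_eq_one_right _ h

/-! ### Morphisms between indecomposable objects -/

section Hom

variable {k : Type v} [Field k] {A : Type u} [Category.{v} A] [Preadditive A] [Linear k A]
  [IsLofd A k]

lemma isNilpotent_or_isIso (k : Type v) [Field k] {A : Type u} [Category.{v} A] [Preadditive A]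
    [Linear k A] [IsLofd A k] {X : A} (hX : Indecomposable X) (f : End X) :
    IsNilpotent f ∨ IsIso (f : X ⟶ X) := by
  have := IsLofd.finite_hom (k := k) X X
  have : FiniteDimensional k (End X) := this
  rcases isNilpotent_or_isUnit k (E := End X) (fun e he ↦
    eq_zero_or_id_of_indecomposable hX e he) f with h | h
  · exact .inl h
  · exact .inr ((isUnit_iff_isIso f).1 h)

/-- Non-invertible morphisms between indecomposable objects are radical. -/
lemma mem_rad_of_not_isIso (k : Type v) [Field k] {A : Type u} [Category.{v} A] [Preadditive A]
    [Linear k A] [IsLofd A k] {X Y : A} (hX : Indecomposable X) (hY : Indecomposable Y) (f : X ⟶ Y)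
    (hf : ¬ IsIso f) : f ∈ rad X Y := by
  intro g
  rcases isNilpotent_or_isIso k hX (f ≫ g : End X) with h | h
  · exact (isUnit_iff_isIso (X := X) _).1 h.isUnit_one_sub
  · refine absurd ?_ hf
    -- `f` is a split monomorphism, and the resulting idempotent of `Y` is nonzero
    have h1 : f ≫ g ≫ inv (f ≫ g) = 𝟙 X := by rw [← Category.assoc, IsIso.hom_inv_id]
    rcases eq_zero_or_id_of_indecomposable hY ((g ≫ inv (f ≫ g)) ≫ f) (by
      simp only [Category.assoc]
      rw [reassoc_of% h1]) with h2 | h2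
    · refine absurd ?_ (id_ne_zero_of_indecomposable hX)
      have : (f ≫ g ≫ inv (f ≫ g)) ≫ f ≫ g ≫ inv (f ≫ g) = 0 := by
        have := f ≫= h2 =≫ (g ≫ inv (f ≫ g))
        simpa only [Category.assoc, comp_zero, zero_comp] using this
      rwa [h1, Category.id_comp] at this
    · exact ⟨g ≫ inv (f ≫ g), h1, h2⟩

/-- Since `k` is algebraically closed, an endomorphism of an indecomposable object is a scalar modulo
the radical. -/
lemma exists_sub_smul_id_mem_rad [IsAlgClosed k] {X : A} (hX : Indecomposable X) (f : X ⟶ X) :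
    ∃ c : k, f - c • 𝟙 X ∈ rad X X := by
  have := IsLofd.finite_hom (k := k) X X
  have : FiniteDimensional k (End X) := this
  have : Nontrivial (End X) := ⟨_, _, id_ne_zero_of_indecomposable hX⟩
  obtain ⟨c, hc⟩ := spectrum.nonempty_of_isAlgClosed_of_finiteDimensional k (A := End X) f
  refine ⟨c, mem_rad_of_not_isIso k hX hX _ fun h ↦ hc ?_⟩
  rw [spectrum.mem_resolventSet_iff, ← IsUnit.neg_iff, neg_sub, Algebra.algebraMap_eq_smul_one]
  exact (isUnit_iff_isIso (X := X) (f - c • 𝟙 X)).2 h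

variable {Q : Type w} [Quiver.{t} Q] (q : QuiverOf k A Q)

/-- The space spanned by the arrows from `x` to `y`. -/
def arrSpan (x y : Q) : Submodule k (q.obj x ⟶ q.obj y) :=
  Submodule.span k (Set.range fun α : x ⟶ y ↦ q.arr α)

omit [IsLofd A k] in
lemma radSq_eq_bot (hrad : RadicalSquareZero A) (X Y : A) : radSq k X Y = ⊥ := by
  refine Submodule.span_eq_bot.2 ?_
  rintro _ ⟨Z, f, g, hf, hg, rfl⟩
  exact hrad f g hf hg

variable {q}

lemma arr_comp_arr (hrad : RadicalSquareZero A) {x y z : Q} (α : x ⟶ y) (β : y ⟶ z) :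
    q.arr α ≫ q.arr β = 0 :=
  hrad _ _ (q.arr_mem α) (q.arr_mem β)

lemma comp_eq_zero_of_mem_arrSpan (hrad : RadicalSquareZero A) {x y z : Q}
    {f : q.obj x ⟶ q.obj y} {g : q.obj y ⟶ q.obj z} (hf : f ∈ arrSpan q x y)
    (hg : g ∈ arrSpan q y z) : f ≫ g = 0 := by
  induction hf using Submodule.span_induction with
  | mem f hf =>
    obtain ⟨α, rfl⟩ := hf
    induction hg using Submodule.span_induction with
    | mem g hg =>
      obtain ⟨β, rfl⟩ := hg
      exact arr_comp_arr hrad α β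
    | zero => simp
    | add a b _ _ ha hb => simp [ha, hb]
    | smul c a _ ha => simp [ha]
  | zero => simp
  | add a b _ _ ha hb => simp [ha, hb]
  | smul c a _ ha => simp [ha]

lemma linearIndependent_arr (x y : Q) :
    LinearIndependent k fun α : x ⟶ y ↦ q.arr α :=
  LinearIndependent.of_comp (radSq k (q.obj x) (q.obj y)).mkQ (q.linearIndependent x y)

lemma mem_arrSpan_of_mem_rad (hrad : RadicalSquareZero A) {x y : Q} {f : q.obj x ⟶ q.obj y}
    (hf : f ∈ rad (q.obj x) (q.obj y)) : f ∈ arrSpan q x y := by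
  have := q.span x y f hf
  rwa [radSq_eq_bot hrad, sup_bot_eq] at this

open Classical in
/-- The coordinate function of an arrow. -/
lemma exists_dual_arr {x y : Q} (α : x ⟶ y) :
    ∃ φ : (q.obj x ⟶ q.obj y) →ₗ[k] k, ∀ β : x ⟶ y, φ (q.arr β) = if β = α then 1 else 0 := by
  have h := linearIndependent_arr (q := q) x y
  obtain ⟨φ, hφ⟩ := (Finsupp.lapply α ∘ₗ h.repr).exists_extend
  refine ⟨φ, fun β ↦ ?_⟩
  have h1 := LinearMap.congr_fun hφ ⟨q.arr β, Submodule.subset_span ⟨β, rfl⟩⟩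
  have h2 : h.repr ⟨q.arr β, Submodule.subset_span ⟨β, rfl⟩⟩ = Finsupp.single β 1 :=
    h.repr_eq_single β _ rfl
  refine h1.trans ?_
  rw [LinearMap.comp_apply, h2]
  exact Finsupp.single_apply

lemma vertex_ext (q : QuiverOf k A Q) {x y : Q} (h : Nonempty (q.obj x ≅ q.obj y)) : x = y := by
  obtain ⟨z, hz, hu⟩ := q.existsUnique (q.obj x) (q.indecomposable x)
  exact (hu x ⟨Iso.refl _⟩).trans (hu y h).symm

lemma mem_arrSpan_of_ne (hrad : RadicalSquareZero A) {x y : Q} (h : x ≠ y)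
    (f : q.obj x ⟶ q.obj y) : f ∈ arrSpan q x y := by
  refine mem_arrSpan_of_mem_rad hrad
    (mem_rad_of_not_isIso k (q.indecomposable x) (q.indecomposable y) f fun hf ↦ h ?_)
  exact vertex_ext q ⟨asIso f⟩

lemma exists_sub_mem_arrSpan [IsAlgClosed k] (hrad : RadicalSquareZero A) {x : Q}
    (f : q.obj x ⟶ q.obj x) : ∃ c : k, f - c • 𝟙 _ ∈ arrSpan q x x := by
  obtain ⟨c, hc⟩ := exists_sub_smul_id_mem_rad (k := k) (q.indecomposable x) f
  exact ⟨c, mem_arrSpan_of_mem_rad hrad hc⟩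

lemma id_notMem_arrSpan (hrad : RadicalSquareZero A) (x : Q) :
    𝟙 (q.obj x) ∉ arrSpan q x x := by
  intro h
  refine id_ne_zero_of_indecomposable (q.indecomposable x) ?_
  rw [← Category.comp_id (𝟙 (q.obj x)), comp_eq_zero_of_mem_arrSpan hrad h h]

/-- The span of the arrows is closed under composition with arbitrary morphisms. -/
lemma comp_arr_mem_arrSpan [IsAlgClosed k] (hrad : RadicalSquareZero A) {x y z : Q}
    (f : q.obj x ⟶ q.obj y) (β : y ⟶ z) : f ≫ q.arr β ∈ arrSpan q x z := by
  have hβ : q.arr β ∈ arrSpan q y z := Submodule.subset_span ⟨β, rfl⟩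
  by_cases h : x = y
  · subst h
    obtain ⟨c, hc⟩ := exists_sub_mem_arrSpan hrad f
    have : f ≫ q.arr β = c • q.arr β := by
      have := comp_eq_zero_of_mem_arrSpan hrad hc hβ
      rw [Preadditive.sub_comp, Linear.smul_comp, Category.id_comp] at this
      exact sub_eq_zero.1 this
    rw [this]
    exact Submodule.smul_mem _ _ hβ
  · rw [comp_eq_zero_of_mem_arrSpan hrad (mem_arrSpan_of_ne hrad h f) hβ]
    exact zero_mem _

/-- Each object of `A` is a direct summand of a direct sum of objects `q.obj x`, by induction on the
dimension of its endomorphism algebra. -/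
lemma id_mem_span (q : QuiverOf k A Q) (X : A) :
    𝟙 X ∈ Submodule.span k
      {h : X ⟶ X | ∃ (x : Q) (p : X ⟶ q.obj x) (i : q.obj x ⟶ X), h = p ≫ i} := by
  have hfin (X Y : A) := IsLofd.finite_hom (k := k) X Y
  induction hn : Module.finrank k (X ⟶ X) using Nat.strong_induction_on generalizing X with
  | _ n ih =>
    by_cases h0 : IsZero X
    · rw [h0.eq_of_src (𝟙 X) 0]
      exact zero_mem _
    by_cases hX : Indecomposable X
    · obtain ⟨x, ⟨e⟩, -⟩ := q.existsUnique X hX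
      exact Submodule.subset_span ⟨x, e.hom, e.inv, e.hom_inv_id.symm⟩
    obtain ⟨Y, Z, e, hY, hZ⟩ : ∃ Y Z : A, ∃ _ : X ≅ Y ⊞ Z, ¬ IsZero Y ∧ ¬ IsZero Z := by
      simp only [Indecomposable, h0, not_false_eq_true, true_and] at hX
      push Not at hX
      obtain ⟨Y, Z, e, h⟩ := hX
      exact ⟨Y, Z, e, h⟩
    -- a proper direct summand `W` of `X` has a smaller endomorphism algebra than `X`
    have key (W V : A) (i : W ⟶ X) (p : X ⟶ W) (j : V ⟶ X) (r : X ⟶ V) (hip : i ≫ p = 𝟙 W)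
        (hjr : j ≫ r = 𝟙 V) (hjp : j ≫ p = 0) (hV : ¬ IsZero V) :
        p ≫ i ∈ Submodule.span k
          {h : X ⟶ X | ∃ (x : Q) (p : X ⟶ q.obj x) (i : q.obj x ⟶ X), h = p ≫ i} := by
      let L : (W ⟶ W) →ₗ[k] (X ⟶ X) := Linear.rightComp k X i ∘ₗ Linear.leftComp k W p
      have hL (f : W ⟶ W) : L f = (p ≫ f) ≫ i := rfl
      have hinj : Function.Injective L := by
        intro f g hfg
        have := i ≫= hfg =≫ p
        simpa only [hL, Category.assoc, reassoc_of% hip, hip, Category.comp_id] using this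
      have hlt : Module.finrank k (W ⟶ W) < n := by
        rw [← hn, ← LinearMap.finrank_range_of_inj hinj]
        refine Submodule.finrank_lt fun htop ↦ hV ?_
        obtain ⟨f, hf⟩ : 𝟙 X ∈ LinearMap.range L := htop ▸ Submodule.mem_top
        rw [IsZero.iff_id_eq_zero, ← hjr, ← Category.id_comp r, ← hf, hL]
        simp only [Category.assoc, reassoc_of% hjp, zero_comp]
      have := Submodule.mem_map_of_mem (f := L) (ih _ hlt W rfl)
      rw [hL, Category.comp_id] at this
      refine Submodule.map_le_iff_le_comap.2 (Submodule.span_le.2 ?_) this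
      rintro _ ⟨x, p', i', rfl⟩
      refine Submodule.subset_span ⟨x, p ≫ p', i' ≫ i, ?_⟩
      simp [hL]
    have htot : 𝟙 X = (e.hom ≫ biprod.fst) ≫ (biprod.inl ≫ e.inv) +
        (e.hom ≫ biprod.snd) ≫ (biprod.inr ≫ e.inv) := by
      have := e.hom ≫= biprod.total (X := Y) (Y := Z) =≫ e.inv
      simpa only [Preadditive.add_comp, Preadditive.comp_add, Category.assoc, Category.id_comp,
        e.hom_inv_id] using this.symm
    rw [htot]
    refine add_mem (key Y Z _ _ (biprod.inr ≫ e.inv) (e.hom ≫ biprod.snd) (by simp) (by simp)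
      (by simp) hZ) (key Z Y _ _ (biprod.inl ≫ e.inv) (e.hom ≫ biprod.fst) (by simp) (by simp)
      (by simp) hY)

/-- Only finitely many arrows end at a given vertex. -/
lemma finite_into (q : QuiverOf k A Q) (y : Q) :
    Finite (Σ x : Q, x ⟶ y) := by
  have (x : Q) := q.finite_hom x y
  have hc : Finite {x : Q // Nonempty (x ⟶ y)} := by
    refine Set.Finite.to_subtype (s := {x : Q | Nonempty (x ⟶ y)}) ?_
    refine Set.Finite.of_finite_image (f := fun x ↦ (Quotient.mk _ (q.obj x) : IsoClass A))
      ((IsLofd.finite_neighbours (k := k) (q.obj y)).subset ?_) ?_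
    · rintro _ ⟨x, ⟨α⟩, rfl⟩
      exact ⟨_, rfl, q.indecomposable x, .inr ⟨_, (linearIndependent_arr x y).ne_zero α⟩⟩
    · intro x _ x' _ h
      exact vertex_ext q (Quotient.exact h)
  let F : (Σ x : Q, x ⟶ y) → Σ x : {x : Q // Nonempty (x ⟶ y)}, x.1 ⟶ y :=
    fun p ↦ ⟨⟨p.1, ⟨p.2⟩⟩, p.2⟩
  refine Finite.of_injective F ?_
  rintro ⟨x, α⟩ ⟨x', α'⟩ h
  simp only [F, Sigma.mk.injEq, Subtype.mk.injEq] at h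
  obtain ⟨rfl, h⟩ := h
  simpa using h

/-- Only finitely many arrows start at a given vertex. -/
lemma finite_out_of (q : QuiverOf k A Q) (x : Q) :
    {y : Q | Nonempty (x ⟶ y)}.Finite := by
  refine Set.Finite.of_finite_image (f := fun y ↦ (Quotient.mk _ (q.obj y) : IsoClass A))
    ((IsLofd.finite_neighbours (k := k) (q.obj x)).subset ?_) ?_
  · rintro _ ⟨y, ⟨α⟩, rfl⟩
    exact ⟨_, rfl, q.indecomposable y, .inl ⟨_, (linearIndependent_arr x y).ne_zero α⟩⟩
  · intro x _ x' _ h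
    exact vertex_ext q (Quotient.exact h)

end Hom

/-! ### Modules as representations: values at vertices, action of arrows, radical -/

section Vertices

variable {k : Type v} [Field k] {A : Type u} [Category.{v} A] [Preadditive A] [Linear k A]
  [IsLofd A k] {Q : Type w} [Quiver.{t} Q] (q : QuiverOf k A Q)

/-- The value of a module at a vertex. -/
abbrev ev (M : FDMod k A) (x : Q) : ModuleCat.{v} k := M.obj.obj (q.obj x)

/-- The component of a morphism of modules at a vertex. -/
def evMap {M N : FDMod k A} (f : M ⟶ N) (x : Q) : ev q M x →ₗ[k] ev q N x :=
  (f.hom.app (q.obj x)).hom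

/-- The action of an arrow on a module. -/
def arrMap (M : FDMod k A) {x y : Q} (α : x ⟶ y) : ev q M x →ₗ[k] ev q M y :=
  (M.obj.map (q.arr α)).hom

@[simp] lemma evMap_id (M : FDMod k A) (x : Q) : evMap q (𝟙 M) x = LinearMap.id := rfl

@[simp] lemma evMap_comp {L M N : FDMod k A} (f : L ⟶ M) (g : M ⟶ N) (x : Q) :
    evMap q (f ≫ g) x = evMap q g x ∘ₗ evMap q f x := rfl

@[simp] lemma evMap_zero (M N : FDMod k A) (x : Q) : evMap q (0 : M ⟶ N) x = 0 := rfl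

@[simp] lemma evMap_add {M N : FDMod k A} (f g : M ⟶ N) (x : Q) :
    evMap q (f + g) x = evMap q f x + evMap q g x := rfl

@[simp] lemma evMap_sub {M N : FDMod k A} (f g : M ⟶ N) (x : Q) :
    evMap q (f - g) x = evMap q f x - evMap q g x := by
  rw [eq_sub_iff_add_eq, ← evMap_add, sub_add_cancel]

@[simp] lemma evMap_neg {M N : FDMod k A} (f : M ⟶ N) (x : Q) :
    evMap q (-f) x = - evMap q f x := by
  rw [← zero_sub, evMap_sub, evMap_zero, zero_sub]

lemma evMap_sum {M N : FDMod k A} {ι : Type*} (S : Finset ι) (f : ι → (M ⟶ N)) (x : Q) :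
    evMap q (∑ i ∈ S, f i) x = ∑ i ∈ S, evMap q (f i) x := by
  classical
  induction S using Finset.induction_on with
  | empty => rfl
  | insert a S ha ih => rw [Finset.sum_insert ha, Finset.sum_insert ha, evMap_add, ih]

lemma evMap_arrMap {M N : FDMod k A} (f : M ⟶ N) {x y : Q} (α : x ⟶ y) (m : ev q M x) :
    evMap q f y (arrMap q M α m) = arrMap q N α (evMap q f x m) :=
  ConcreteCategory.congr_hom (f.hom.naturality (q.arr α)) m

variable {q}

/-- A morphism of modules is determined by its components at the vertices: the identity of each object
is a sum of morphisms that factor through indecomposable objects. -/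
lemma hom_ext_of_evMap {M N : FDMod k A} {f g : M ⟶ N}
    (h : ∀ x, evMap q f x = evMap q g x) : f = g := by
  apply ObjectProperty.hom_ext
  ext X m
  have := M.property.additive
  have := M.property.linear
  let L : (X ⟶ X) →ₗ[k] N.obj.obj X :=
    { toFun e := f.hom.app X (M.obj.map e m) - g.hom.app X (M.obj.map e m)
      map_add' a b := by
        simp only [Functor.map_add, ModuleCat.hom_add, LinearMap.add_apply, map_add]
        abel
      map_smul' c a := by
        simp only [Functor.map_smul, ModuleCat.hom_smul, LinearMap.smul_apply, map_smul,
          RingHom.id_apply, smul_sub] }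
  have hL : L (𝟙 X) = 0 := by
    refine LinearMap.mem_ker.1 (Submodule.span_le.2 ?_ (id_mem_span q X))
    rintro _ ⟨x, p, i, rfl⟩
    have h1 : ∀ (f : M ⟶ N), f.hom.app X (M.obj.map (p ≫ i) m) =
        N.obj.map i (evMap q f x (M.obj.map p m)) := fun f ↦ by
      rw [Functor.map_comp]
      exact ConcreteCategory.congr_hom (f.hom.naturality i) _
    change f.hom.app X (M.obj.map (p ≫ i) m) - g.hom.app X (M.obj.map (p ≫ i) m) = 0
    rw [h1, h1, h, sub_self]
  have h2 : L (𝟙 X) = f.hom.app X m - g.hom.app X m := by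
    change f.hom.app X (M.obj.map (𝟙 X) m) - g.hom.app X (M.obj.map (𝟙 X) m) = _
    simp
  exact sub_eq_zero.1 (h2.symm.trans hL)

lemma mono_of_evMap {M N : FDMod k A} (f : M ⟶ N)
    (h : ∀ x, Function.Injective (evMap q f x)) : Mono f := by
  refine ⟨fun g g' hg ↦ hom_ext_of_evMap (q := q) fun x ↦ LinearMap.ext fun m ↦ h x ?_⟩
  have := congrArg (fun f ↦ evMap q f x m) hg
  simpa using this

lemma epi_of_evMap {M N : FDMod k A} (f : M ⟶ N)
    (h : ∀ x, Function.Surjective (evMap q f x)) : Epi f := by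
  refine ⟨fun g g' hg ↦ hom_ext_of_evMap (q := q) fun x ↦ LinearMap.ext fun m ↦ ?_⟩
  obtain ⟨m, rfl⟩ := h x m
  have := congrArg (fun f ↦ evMap q f x m) hg
  simpa using this

lemma isIso_of_evMap {M N : FDMod k A} (f : M ⟶ N)
    (h : ∀ x, Function.Bijective (evMap q f x)) : IsIso f := by
  have := mono_of_evMap f fun x ↦ (h x).1
  have := epi_of_evMap f fun x ↦ (h x).2
  exact isIso_of_mono_of_epi f

lemma isZero_of_evMap {M : FDMod k A} (h : ∀ x, Subsingleton (ev q M x)) : IsZero M := by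
  rw [IsZero.iff_id_eq_zero]
  exact hom_ext_of_evMap (q := q) fun x ↦ LinearMap.ext fun m ↦ Subsingleton.elim _ _

variable (q)

lemma evMap_surjective {M N : FDMod k A} (f : M ⟶ N) [Epi f] (x : Q) :
    Function.Surjective (evMap q f x) := by
  have := (fdModule k A).preservesEpimorphisms_ι_of_isNormalMonoCategory
  have : Epi f.hom := inferInstanceAs (Epi ((fdModule k A).ι.map f))
  exact (ModuleCat.epi_iff_surjective _).1 inferInstance

lemma evMap_injective {M N : FDMod k A} (f : M ⟶ N) [Mono f] (x : Q) :
    Function.Injective (evMap q f x) := by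
  have := (fdModule k A).preservesMonomorphisms_ι_of_isNormalEpiCategory
  have : Mono f.hom := inferInstanceAs (Mono ((fdModule k A).ι.map f))
  exact (ModuleCat.mono_iff_injective _).1 inferInstance

lemma finite_support (M : FDMod k A) : {x : Q | Nontrivial (ev q M x)}.Finite := by
  refine Set.Finite.of_finite_image (f := fun y ↦ (Quotient.mk _ (q.obj y) : IsoClass A))
    (M.property.support.subset ?_) ?_
  · rintro _ ⟨y, hy, rfl⟩
    exact ⟨_, rfl, q.indecomposable y, hy⟩
  · intro x _ x' _ h
    exact vertex_ext q (Quotient.exact h)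

instance finiteDimensional_ev (M : FDMod k A) (x : Q) : FiniteDimensional k (ev q M x) :=
  M.property.finite _

/-- The sum of the actions of all arrows that end at `y`. -/
def asm (M : FDMod k A) (y : Q) : (∀ p : Σ x : Q, x ⟶ y, ev q M p.1) →ₗ[k] ev q M y :=
  letI := finite_into q y
  letI := Fintype.ofFinite (Σ x : Q, x ⟶ y)
  ∑ p : Σ x : Q, x ⟶ y, arrMap q M p.2 ∘ₗ LinearMap.proj p

/-- The value of the radical of a module at a vertex. -/
def modRad (M : FDMod k A) (x : Q) : Submodule k (ev q M x) := LinearMap.range (asm q M x)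

variable {q}

lemma map_asm {M : FDMod k A} {y : Q} (u : ∀ p : Σ x : Q, x ⟶ y, ev q M p.1) {W : Type*}
    [AddCommGroup W] [Module k W] (f : ev q M y →ₗ[k] W) [Fintype (Σ x : Q, x ⟶ y)] :
    f (asm q M y u) = ∑ p, f (arrMap q M p.2 (u p)) := by
  rw [asm, LinearMap.sum_apply, map_sum]
  refine Finset.sum_congr ?_ fun _ _ ↦ rfl
  ext
  simp

lemma evMap_asm {M N : FDMod k A} (f : M ⟶ N) {y : Q} (u : ∀ p : Σ x : Q, x ⟶ y, ev q M p.1) :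
    evMap q f y (asm q M y u) = asm q N y fun p ↦ evMap q f p.1 (u p) := by
  have := finite_into q y
  have := Fintype.ofFinite (Σ x : Q, x ⟶ y)
  rw [map_asm, ← LinearMap.id_apply (R := k) (asm q N y _), map_asm]
  simp only [evMap_arrMap, LinearMap.id_apply]

lemma arrMap_mem_modRad (M : FDMod k A) {x y : Q} (α : x ⟶ y) (m : ev q M x) :
    arrMap q M α m ∈ modRad q M y := by
  classical
  have := finite_into q y
  have := Fintype.ofFinite (Σ x : Q, x ⟶ y)
  refine ⟨Pi.single (⟨x, α⟩ : Σ x : Q, x ⟶ y) m, ?_⟩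
  rw [← LinearMap.id_apply (R := k) (asm q M y _), map_asm, Finset.sum_eq_single ⟨x, α⟩]
  · simp
  · intro p _ hp
    simp [Pi.single_eq_of_ne hp]
  · simp

lemma evMap_mem_modRad {M N : FDMod k A} (f : M ⟶ N) {x : Q} {m : ev q M x}
    (hm : m ∈ modRad q M x) : evMap q f x m ∈ modRad q N x := by
  obtain ⟨u, rfl⟩ := hm
  rw [evMap_asm]
  exact ⟨_, rfl⟩

/-- Since the radical of the category has square zero, arrows annihilate the radical of a module. -/
lemma arrMap_eq_zero (hrad : RadicalSquareZero A) {M : FDMod k A} {x y : Q} (α : x ⟶ y)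
    {m : ev q M x} (hm : m ∈ modRad q M x) : arrMap q M α m = 0 := by
  have := M.property.additive
  have := finite_into q x
  have := Fintype.ofFinite (Σ z : Q, z ⟶ x)
  obtain ⟨u, rfl⟩ := hm
  rw [map_asm]
  refine Finset.sum_eq_zero fun p _ ↦ ?_
  change (M.obj.map (q.arr p.2) ≫ M.obj.map (q.arr α)).hom (u p) = 0
  rw [← Functor.map_comp, arr_comp_arr hrad, Functor.map_zero]
  rfl

lemma asm_eq_zero (hrad : RadicalSquareZero A) {M : FDMod k A} {y : Q}
    {u : ∀ p : Σ x : Q, x ⟶ y, ev q M p.1} (hu : ∀ p, u p ∈ modRad q M p.1) :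
    asm q M y u = 0 := by
  have := finite_into q y
  have := Fintype.ofFinite (Σ z : Q, z ⟶ y)
  rw [← LinearMap.id_apply (R := k) (asm q M y _), map_asm]
  exact Finset.sum_eq_zero fun p _ ↦ arrMap_eq_zero hrad p.2 (hu p)

lemma asm_congr (hrad : RadicalSquareZero A) {M : FDMod k A} {y : Q}
    {u u' : ∀ p : Σ x : Q, x ⟶ y, ev q M p.1} (hu : ∀ p, u p - u' p ∈ modRad q M p.1) :
    asm q M y u = asm q M y u' := by
  rw [← sub_eq_zero, ← map_sub]
  exact asm_eq_zero hrad hu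

/-- Nakayama's lemma: a morphism that is surjective modulo radicals is surjective. -/
lemma surjective_of_modRad (hrad : RadicalSquareZero A) {M N : FDMod k A} (f : M ⟶ N)
    (h : ∀ (x : Q) (n : ev q N x), ∃ m, n - evMap q f x m ∈ modRad q N x) (x : Q) :
    Function.Surjective (evMap q f x) := by
  intro n
  obtain ⟨m, u, hu⟩ := h x n
  choose m' hm' using fun p : Σ y : Q, y ⟶ x ↦ h p.1 (u p)
  refine ⟨m + asm q M x m', ?_⟩
  rw [map_add, evMap_asm, ← asm_congr hrad hm', hu]
  abel

end Vertices

/-! ### Free modules -/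

section Free

variable {k : Type v} [Field k] {A : Type u} [Category.{v} A] [Preadditive A] [Linear k A]
  [IsLofd A k] {Q : Type w} [Quiver.{t} Q] (q : QuiverOf k A Q)

/-- `P` is free on the family of vector spaces `V`: it is a direct sum of modules `A^x ⊗ V x`, with
`v : V x` corresponding to `s x v`. Since the radical of the category has square zero, this means
that the generators `s x v` can be mapped anywhere, span the module modulo its radical, are linearly
independent modulo the radical, and that the arrows act on them without relations. -/
structure FreeOn (P : FDMod k A) (V : Q → ModuleCat.{v} k) (s : ∀ x, V x →ₗ[k] ev q P x) :
    Prop where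
  exists_hom : ∀ (N : FDMod k A) (ψ : ∀ x, V x →ₗ[k] ev q N x),
    ∃ f : P ⟶ N, ∀ x v, evMap q f x (s x v) = ψ x v
  exists_sub_mem : ∀ x p, ∃ v, p - s x v ∈ modRad q P x
  eq_zero_of_mem : ∀ x v, s x v ∈ modRad q P x → v = 0
  eq_zero_of_asm : ∀ (y : Q) (u : ∀ p : Σ x : Q, x ⟶ y, V p.1),
    asm q P y (fun p ↦ s p.1 (u p)) = 0 → u = 0

variable {q}

namespace FreeOn

variable {P : FDMod k A} {V : Q → ModuleCat.{v} k} {s : ∀ x, V x →ₗ[k] ev q P x}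

lemma hom_ext (hrad : RadicalSquareZero A) (h : FreeOn q P V s) {N : FDMod k A} {f g : P ⟶ N}
    (hfg : ∀ x v, evMap q f x (s x v) = evMap q g x (s x v)) : f = g := by
  have key : ∀ (x : Q) (p : ev q P x), p ∈ modRad q P x → evMap q f x p = evMap q g x p := by
    rintro x _ ⟨u, rfl⟩
    choose v hv using fun p : Σ y : Q, y ⟶ x ↦ h.exists_sub_mem p.1 (u p)
    rw [asm_congr hrad hv, evMap_asm, evMap_asm]
    simp only [hfg]
  refine hom_ext_of_evMap (q := q) fun x ↦ LinearMap.ext fun p ↦ ?_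
  obtain ⟨v, hv⟩ := h.exists_sub_mem x p
  have := key x _ hv
  rwa [map_sub, map_sub, hfg, sub_left_inj] at this

lemma projective (hrad : RadicalSquareZero A) (h : FreeOn q P V s) : Projective P where
  factors {E X} f e _ := by
    choose r hr using fun x ↦ (evMap q e x).exists_rightInverse_of_surjective
      (LinearMap.range_eq_top.2 (evMap_surjective q e x))
    obtain ⟨g, hg⟩ := h.exists_hom E fun x ↦ r x ∘ₗ evMap q f x ∘ₗ s x
    refine ⟨g, h.hom_ext hrad fun x v ↦ ?_⟩
    rw [evMap_comp, LinearMap.comp_apply, hg]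
    exact LinearMap.congr_fun (hr x) _

lemma of_iso (h : FreeOn q P V s) {P' : FDMod k A} (e : P ≅ P') :
    FreeOn q P' V fun x ↦ evMap q e.hom x ∘ₗ s x := by
  have h1 (x p) : evMap q e.inv x (evMap q e.hom x p) = p := by
    rw [← LinearMap.comp_apply, ← evMap_comp, e.hom_inv_id]
    rfl
  have h2 (x p) : evMap q e.hom x (evMap q e.inv x p) = p := by
    rw [← LinearMap.comp_apply, ← evMap_comp, e.inv_hom_id]
    rfl
  refine ⟨fun N ψ ↦ ?_, fun x p ↦ ?_, fun x v hv ↦ ?_, fun y u hu ↦ ?_⟩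
  · obtain ⟨f, hf⟩ := h.exists_hom N ψ
    refine ⟨e.inv ≫ f, fun x v ↦ ?_⟩
    rw [evMap_comp, LinearMap.comp_apply, LinearMap.comp_apply, h1, hf]
  · obtain ⟨v, hv⟩ := h.exists_sub_mem x (evMap q e.inv x p)
    refine ⟨v, ?_⟩
    have := evMap_mem_modRad e.hom hv
    rwa [map_sub, h2] at this
  · refine h.eq_zero_of_mem x v ?_
    have := evMap_mem_modRad e.inv hv
    rwa [LinearMap.comp_apply, h1] at this
  · refine h.eq_zero_of_asm y u ?_
    have := congrArg (evMap q e.inv y) hu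
    simpa only [LinearMap.comp_apply, evMap_asm, h1, map_zero] using this

end FreeOn

/-- The morphism `A^X ⊗ V ⟶ N` that corresponds to a linear map `V ⟶ N X` (Yoneda's lemma). -/
def projDesc (X : A) (V : ModuleCat.{v} k) (hV : FiniteDimensional k V) (N : FDMod k A)
    (ψ : V →ₗ[k] N.obj.obj X) : proj k A X V hV ⟶ N :=
  haveI := N.property.additive
  haveI := N.property.linear
  ObjectProperty.homMk
    { app Z := ModuleCat.ofHom (TensorProduct.lift
        { toFun h := (N.obj.map h).hom ∘ₗ ψ
          map_add' a b := by rw [Functor.map_add, ModuleCat.hom_add, LinearMap.add_comp]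
          map_smul' c a := by
            rw [Functor.map_smul, ModuleCat.hom_smul, LinearMap.smul_comp, RingHom.id_apply] })
      naturality Z Z' g := by
        ext : 1
        refine TensorProduct.ext' fun h v ↦ ?_
        change N.obj.map (h ≫ g) (ψ v) = N.obj.map g (N.obj.map h (ψ v))
        rw [Functor.map_comp]
        rfl }

section

variable (q) (V : Q → ModuleCat.{v} k) (hV : ∀ x, FiniteDimensional k (V x))
  [Finite {x // Nontrivial (V x)}]

/-- The direct sum of all `A^x ⊗ V x`. -/
abbrev free : FDMod k A :=
  ⨁ fun x : {x // Nontrivial (V x)} ↦ proj k A (q.obj x) (V x) (hV x)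

/-- The inclusion of the summand `A^x ⊗ V x`. -/
abbrev freeι (x : {x // Nontrivial (V x)}) : proj k A (q.obj x) (V x) (hV x) ⟶ free q V hV :=
  biproduct.ι (fun x : {x // Nontrivial (V x)} ↦ proj k A (q.obj x) (V x) (hV x)) x

/-- The projection to the summand `A^x ⊗ V x`. -/
abbrev freeπ (x : {x // Nontrivial (V x)}) : free q V hV ⟶ proj k A (q.obj x) (V x) (hV x) :=
  biproduct.π (fun x : {x // Nontrivial (V x)} ↦ proj k A (q.obj x) (V x) (hV x)) x

/-- The element `h ⊗ v` of `A^x ⊗ V x`. -/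
def tens (x y : Q) : (q.obj x ⟶ q.obj y) →ₗ[k] V x →ₗ[k]
    ev q (proj k A (q.obj x) (V x) (hV x)) y :=
  TensorProduct.mk k (q.obj x ⟶ q.obj y) (V x)

omit [Finite {x // Nontrivial (V x)}] in
lemma tens_induction {x y : Q} {p : ev q (proj k A (q.obj x) (V x) (hV x)) y → Prop}
    (h0 : p 0) (hadd : ∀ a b, p a → p b → p (a + b)) (h : ∀ h v, p (tens q V hV x y h v))
    (e : ev q (proj k A (q.obj x) (V x) (hV x)) y) : p e :=
  TensorProduct.induction_on (motive := p) e h0 h hadd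

/-- The linear map `h ⊗ v ↦ φ h • v`. -/
def tensDual (x y : Q) (φ : (q.obj x ⟶ q.obj y) →ₗ[k] k) :
    ev q (proj k A (q.obj x) (V x) (hV x)) y →ₗ[k] V x :=
  (TensorProduct.lid k (V x)).toLinearMap ∘ₗ TensorProduct.map φ LinearMap.id

omit [Finite {x // Nontrivial (V x)}] in
lemma tensDual_tens {x y : Q} (φ : (q.obj x ⟶ q.obj y) →ₗ[k] k) (h : q.obj x ⟶ q.obj y)
    (v : V x) : tensDual q V hV x y φ (tens q V hV x y h v) = φ h • v := rfl

open Classical in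
/-- The generators of the direct sum of all `A^x ⊗ V x`. -/
def freeGen (x : Q) : V x →ₗ[k] ev q (free q V hV) x :=
  if h : Nontrivial (V x) then
    evMap q (freeι q V hV ⟨x, h⟩) x ∘ₗ tens q V hV x x (𝟙 _)
  else 0

variable {V hV}

lemma freeGen_of_nontrivial {x : Q} (h : Nontrivial (V x)) (v : V x) :
    freeGen q V hV x v =
      evMap q (freeι q V hV ⟨x, h⟩) x (tens q V hV x x (𝟙 _) v) := by
  rw [freeGen, dif_pos h]
  rfl

omit [Finite {x // Nontrivial (V x)}] in
lemma arrMap_tens (x y z : Q) (h : q.obj x ⟶ q.obj y) (v : V x) (β : y ⟶ z) :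
    arrMap q (proj k A (q.obj x) (V x) (hV x)) β (tens q V hV x y h v) =
      tens q V hV x z (h ≫ q.arr β) v := rfl

/-- The direct sum of all `A^x ⊗ V x` is free: `A(x, y)` is spanned by the arrows `x ⟶ y` and, if
`x = y`, the identity. -/
lemma freeOn_free [IsAlgClosed k] (hrad : RadicalSquareZero A) :
    FreeOn q (free q V hV) V (freeGen q V hV) := by
  classical
  have := Fintype.ofFinite {x // Nontrivial (V x)}
  refine ⟨fun N ψ ↦ ?_, fun x p ↦ ?_, fun x v hv ↦ ?_, fun y u hu ↦ ?_⟩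
  · refine ⟨biproduct.desc fun x ↦ projDesc _ _ _ N (ψ x), fun x v ↦ ?_⟩
    by_cases h : Nontrivial (V x)
    · rw [freeGen_of_nontrivial q h, ← LinearMap.comp_apply, ← evMap_comp, biproduct.ι_desc]
      change N.obj.map (𝟙 _) (ψ x v) = ψ x v
      simp
    · have := not_nontrivial_iff_subsingleton.1 h
      rw [Subsingleton.elim v 0, map_zero, map_zero, map_zero]
  · suffices p ∈ LinearMap.range (freeGen q V hV x) ⊔ modRad q _ x by
      obtain ⟨_, ⟨v, rfl⟩, r, hr, rfl⟩ := Submodule.mem_sup.1 this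
      exact ⟨v, by simpa using hr⟩
    have htot : p = ∑ j, evMap q (freeι q V hV j) x (evMap q (freeπ q V hV j) x p) := by
      have h1 := congrArg (fun f ↦ evMap q f x p) (IsBilimit.total (biproduct.isBilimit
        (fun x : {x // Nontrivial (V x)} ↦ proj k A (q.obj x) (V x) (hV x))))
      simp only [evMap_sum, evMap_comp, LinearMap.sum_apply, LinearMap.comp_apply] at h1
      exact h1.symm
    rw [htot]
    refine Submodule.sum_mem _ fun j _ ↦ ?_
    refine tens_induction q V hV (p := fun e ↦ evMap q (freeι q V hV j) x e ∈
      LinearMap.range (freeGen q V hV x) ⊔ modRad q _ x) ?_ (fun a b ha hb ↦ ?_) (fun h v ↦ ?_) _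
    · simp only [map_zero]
      exact zero_mem _
    · simp only [map_add]
      exact add_mem ha hb
    · have hspan : ∀ h ∈ arrSpan q j x, evMap q (freeι q V hV j) x
            (tens q V hV j x h v) ∈ modRad q (free q V hV) x := by
        intro h hh
        have hle : arrSpan q j x ≤ (modRad q (free q V hV) x).comap (evMap q (freeι q V hV j) x ∘ₗ
            (tens q V hV j x).flip v) := by
          refine Submodule.span_le.2 ?_
          rintro _ ⟨α, rfl⟩
          have h1 : tens q V hV j x (q.arr α) v = arrMap q _ α (tens q V hV j j (𝟙 _) v) := by
            rw [arrMap_tens, Category.id_comp]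
          change evMap q (freeι q V hV j) x (tens q V hV j x (q.arr α) v) ∈ modRad q _ x
          rw [h1, evMap_arrMap]
          exact arrMap_mem_modRad _ _ _
        exact hle hh
      obtain ⟨j, hj⟩ := j
      by_cases hjx : j = x
      · subst hjx
        obtain ⟨c, hc⟩ := exists_sub_mem_arrSpan hrad h
        rw [← sub_add_cancel h (c • 𝟙 _), map_add, LinearMap.add_apply, map_add, map_smul,
          LinearMap.smul_apply, map_smul]
        refine add_mem (Submodule.mem_sup_right (hspan _ hc)) (Submodule.mem_sup_left
          (Submodule.smul_mem _ _ ⟨v, ?_⟩))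
        rw [freeGen_of_nontrivial q hj]
      · exact Submodule.mem_sup_right (hspan _ (mem_arrSpan_of_ne hrad hjx h))
  · by_cases h : Nontrivial (V x)
    swap
    · have := not_nontrivial_iff_subsingleton.1 h
      exact Subsingleton.elim _ _
    have h1 := evMap_mem_modRad (freeπ q V hV ⟨x, h⟩) hv
    rw [freeGen_of_nontrivial q h, ← LinearMap.comp_apply, ← evMap_comp, biproduct.ι_π_self] at h1
    change tens q V hV x x (𝟙 _) v ∈ _ at h1
    -- a linear form that vanishes on the arrows, but not on the identity, detects `v`
    obtain ⟨φ, hφ0, hφ⟩ := Submodule.exists_le_ker_of_notMem (id_notMem_arrSpan (q := q) hrad x)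
    obtain ⟨u, hu⟩ := h1
    have h2 : tensDual q V hV x x φ (asm q (proj k A (q.obj x) (V x) (hV x)) x u) = 0 := by
      have := finite_into q x
      have := Fintype.ofFinite (Σ z : Q, z ⟶ x)
      rw [map_asm]
      refine Finset.sum_eq_zero fun p _ ↦ ?_
      refine tens_induction q V hV (p := fun e ↦ tensDual q V hV x x φ (arrMap q _ p.2 e) = 0)
        ?_ (fun a b ha hb ↦ ?_) (fun h v ↦ ?_) _
      · simp only [map_zero]
      · simp only [map_add, ha, hb, add_zero]
      · rw [arrMap_tens, tensDual_tens, hφ (comp_arr_mem_arrSpan hrad h p.2), zero_smul]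
    rw [hu, tensDual_tens] at h2
    exact (smul_eq_zero.1 h2).resolve_left hφ0
  · funext p
    obtain ⟨x, α⟩ := p
    by_cases h : Nontrivial (V x)
    swap
    · have := not_nontrivial_iff_subsingleton.1 h
      exact Subsingleton.elim _ _
    have := finite_into q y
    have := Fintype.ofFinite (Σ z : Q, z ⟶ y)
    -- the linear form that takes the coordinate of `α` detects the entry of `u` at `α`
    obtain ⟨φ, hφ⟩ := exists_dual_arr (q := q) α
    have hπ (z : Q) (β : z ⟶ y) (w : V z) : tensDual q V hV x y φ (arrMap q _ β
        (evMap q (freeπ q V hV ⟨x, h⟩) z (freeGen q V hV z w))) =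
          if hz : z = x then φ (eqToHom (by rw [hz]) ≫ q.arr β) • (hz ▸ w : V x) else 0 := by
      by_cases hz : Nontrivial (V z)
      · rw [freeGen_of_nontrivial q hz, ← LinearMap.comp_apply (evMap q _ _), ← evMap_comp]
        split_ifs with hzx
        · subst hzx
          rw [biproduct.ι_π_self]
          rfl
        · rw [biproduct.ι_π_ne _ (fun h ↦ hzx (congrArg Subtype.val h)), evMap_zero,
            LinearMap.zero_apply, map_zero, map_zero]
      · have := not_nontrivial_iff_subsingleton.1 hz
        rw [Subsingleton.elim w 0, map_zero, map_zero, map_zero, map_zero]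
        split_ifs with hzx
        · subst hzx
          exact (smul_zero _).symm
        · rfl
    have h1 := congrArg (evMap q (freeπ q V hV ⟨x, h⟩) y) hu
    rw [map_zero, evMap_asm] at h1
    have h2 := congrArg (tensDual q V hV x y φ) h1
    rw [map_zero, map_asm, Finset.sum_eq_single ⟨x, α⟩] at h2
    · rw [hπ, dif_pos rfl, eqToHom_refl, Category.id_comp, hφ α, if_pos rfl, one_smul] at h2
      exact h2
    · rintro ⟨z, β⟩ - hne
      rw [hπ]
      split_ifs with hzx
      · obtain rfl : z = x := hzx
        rw [eqToHom_refl, Category.id_comp, hφ β, if_neg (fun h ↦ hne (by rw [h])), zero_smul]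
      · rfl
    · simp

end

end Free

/-! ### Projective covers -/

section Cover

variable {k : Type v} [Field k] {A : Type u} [Category.{v} A] [Preadditive A] [Linear k A]
  [IsLofd A k] {Q : Type w} [Quiver.{t} Q] (q : QuiverOf k A Q)

/-- The top of a module at a vertex: its value modulo the radical. -/
def top (M : FDMod k A) (x : Q) : ModuleCat.{v} k :=
  ModuleCat.of k (ev q M x ⧸ modRad q M x)

/-- The projection to the top. -/
def topMk (M : FDMod k A) (x : Q) : ev q M x →ₗ[k] top q M x := (modRad q M x).mkQ

lemma topMk_surjective (M : FDMod k A) (x : Q) : Function.Surjective (topMk q M x) :=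
  Submodule.mkQ_surjective _

lemma topMk_eq_zero {M : FDMod k A} {x : Q} {m : ev q M x} :
    topMk q M x m = 0 ↔ m ∈ modRad q M x :=
  Submodule.Quotient.mk_eq_zero _

lemma exists_topSec (M : FDMod k A) (x : Q) :
    ∃ s : top q M x →ₗ[k] ev q M x, topMk q M x ∘ₗ s = LinearMap.id :=
  (topMk q M x).exists_rightInverse_of_surjective
    (LinearMap.range_eq_top.2 (topMk_surjective q M x))

/-- A linear section of the projection to the top. -/
def topSec (M : FDMod k A) (x : Q) : top q M x →ₗ[k] ev q M x := (exists_topSec q M x).choose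

@[simp] lemma topMk_topSec (M : FDMod k A) (x : Q) (v : top q M x) :
    topMk q M x (topSec q M x v) = v :=
  LinearMap.congr_fun (exists_topSec q M x).choose_spec v

instance (M : FDMod k A) (x : Q) : FiniteDimensional k (top q M x) :=
  Module.Finite.of_surjective _ (topMk_surjective q M x)

instance (M : FDMod k A) : Finite {x // Nontrivial (top q M x)} :=
  ((finite_support q M).subset fun x (_ : Nontrivial (top q M x)) ↦
    (topMk_surjective q M x).nontrivial).to_subtype

variable {q}

/-- The projective cover of a module. Its kernel is contained in the radical. -/
lemma exists_cover [IsAlgClosed k] (hrad : RadicalSquareZero A) (q : QuiverOf k A Q)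
    (M : FDMod k A) :
    ∃ (P : FDMod k A) (s : ∀ x, top q M x →ₗ[k] ev q P x) (c : P ⟶ M), FreeOn q P (top q M) s ∧
      (∀ x v, evMap q c x (s x v) = topSec q M x v) ∧
      (∀ x, Function.Surjective (evMap q c x)) ∧
      ∀ x p, evMap q c x p = 0 → p ∈ modRad q P x := by
  have h := freeOn_free q (V := top q M) (hV := fun x ↦ inferInstance) hrad
  obtain ⟨c, hc⟩ := h.exists_hom M (topSec q M)
  refine ⟨_, _, c, h, hc, surjective_of_modRad hrad c fun x m ↦ ?_, fun x p hp ↦ ?_⟩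
  · refine ⟨freeGen q _ _ x (topMk q M x m), ?_⟩
    rw [hc, ← topMk_eq_zero, map_sub, topMk_topSec, sub_self]
  · obtain ⟨v, hv⟩ := h.exists_sub_mem x p
    have h1 := topMk_eq_zero q |>.2 (evMap_mem_modRad c hv)
    rw [map_sub, hp, hc, zero_sub, map_neg, topMk_topSec, neg_eq_zero] at h1
    rwa [h1, map_zero, sub_zero] at hv

/-- A projective module is free on its top. -/
lemma freeOn_top [IsAlgClosed k] (hrad : RadicalSquareZero A) (q : QuiverOf k A Q)
    (P : FDMod k A) [Projective P] : FreeOn q P (top q P) (topSec q P) := by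
  -- a section of the projective cover is surjective by Nakayama's lemma
  obtain ⟨F, s, c, hF, hc, hs, hk⟩ := exists_cover hrad q P
  have : Epi c := epi_of_evMap c hs
  let τ : P ⟶ F := Projective.factorThru (𝟙 P) c
  have hτ : τ ≫ c = 𝟙 P := Projective.factorThru_comp _ _
  have hτ' (x p) : evMap q c x (evMap q τ x p) = p := by
    rw [← LinearMap.comp_apply, ← evMap_comp, hτ]
    rfl
  have hsurj : ∀ x, Function.Surjective (evMap q τ x) := by
    refine surjective_of_modRad hrad τ fun x n ↦ ⟨evMap q c x n, hk _ _ ?_⟩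
    rw [map_sub, hτ', sub_self]
  have : IsIso τ := isIso_of_evMap τ fun x ↦
    ⟨Function.LeftInverse.injective (hτ' x), hsurj x⟩
  have hci : IsIso c := by
    have : c = inv τ := by rw [← cancel_epi τ, hτ, IsIso.hom_inv_id]
    rw [this]
    infer_instance
  convert hF.of_iso (asIso c) using 1
  funext x
  ext v
  exact (hc x v).symm

namespace FreeOn

variable {P : FDMod k A} {V : Q → ModuleCat.{v} k} {s : ∀ x, V x →ₗ[k] ev q P x}

lemma eq_of_sub_mem (h : FreeOn q P V s) {x : Q} {a b : V x}
    (hab : s x a - s x b ∈ modRad q P x) : a = b := by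
  rw [← sub_eq_zero]
  exact h.eq_zero_of_mem x _ (by rwa [map_sub])

lemma injective (h : FreeOn q P V s) (x : Q) : Function.Injective (s x) := fun a b hab ↦
  h.eq_of_sub_mem (by rw [hab, sub_self]; exact zero_mem _)

/-- The coordinates of an element of a free module, modulo the radical. -/
lemma exists_coord (h : FreeOn q P V s) (x : Q) :
    ∃ c : ev q P x →ₗ[k] V x, ∀ p, p - s x (c p) ∈ modRad q P x := by
  choose c hc using h.exists_sub_mem x
  refine ⟨{ toFun := c, map_add' := fun a b ↦ ?_, map_smul' := fun r a ↦ ?_ }, hc⟩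
  · refine h.eq_of_sub_mem ?_
    have := sub_mem (add_mem (hc a) (hc b)) (hc (a + b))
    rw [map_add]
    convert this using 1
    abel
  · refine h.eq_of_sub_mem ?_
    have := sub_mem (Submodule.smul_mem _ r (hc a)) (hc (r • a))
    rw [RingHom.id_apply, map_smul]
    convert this using 1
    rw [smul_sub]
    abel

lemma exists_asm (hrad : RadicalSquareZero A) (h : FreeOn q P V s) {y : Q} {p : ev q P y}
    (hp : p ∈ modRad q P y) : ∃ u : ∀ p : Σ x : Q, x ⟶ y, V p.1,
      p = asm q P y fun p ↦ s p.1 (u p) := by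
  obtain ⟨u, rfl⟩ := hp
  choose v hv using fun p : Σ x : Q, x ⟶ y ↦ h.exists_sub_mem p.1 (u p)
  exact ⟨v, asm_congr hrad hv⟩

lemma asm_injective (h : FreeOn q P V s) {y : Q} {u u' : ∀ p : Σ x : Q, x ⟶ y, V p.1}
    (hu : asm q P y (fun p ↦ s p.1 (u p)) = asm q P y fun p ↦ s p.1 (u' p)) : u = u' := by
  rw [← sub_eq_zero]
  refine h.eq_zero_of_asm y _ ?_
  rw [← sub_eq_zero, ← map_sub] at hu
  convert hu using 2
  funext p
  simp

end FreeOn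

end Cover

/-! ### Graded representations and minimal complexes of projectives -/

section Model

/-- A representation of `Q^□`, with cohomological indexing: `obj x m` is the value at the vertex
`(x, -m)`. -/
structure GrRep (k : Type v) [Field k] (Q : Type w) [Quiver.{t} Q] where
  /-- the vector space at a vertex -/
  obj : Q → ℤ → ModuleCat.{v} k
  /-- the linear map of an arrow -/
  map {x y : Q} (α : x ⟶ y) (m m' : ℤ) (h : m + 1 = m') : obj y m →ₗ[k] obj x m'

/-- A morphism of graded representations. -/
@[ext]
structure GrRep.Hom {k : Type v} [Field k] {Q : Type w} [Quiver.{t} Q] (W W' : GrRep k Q) where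
  /-- the components -/
  app (x : Q) (m : ℤ) : W.obj x m →ₗ[k] W'.obj x m
  comm {x y : Q} (α : x ⟶ y) (m m' : ℤ) (h : m + 1 = m') (v : W.obj y m) :
    app x m' (W.map α m m' h v) = W'.map α m m' h (app y m v)

variable {k : Type v} [Field k] {A : Type u} [Category.{v} A] [Preadditive A] [Linear k A]
  [IsLofd A k] {Q : Type w} [Quiver.{t} Q] (q : QuiverOf k A Q)

/-- An identification of `K` with the complex of projectives that belongs to the graded representation
`W`: the term `K.X m` is free on the spaces `W.obj x m`, with generators `s x m v`, and the
differential takes a generator to the sum of its images under all arrows, which is an element of the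
radical. -/
structure Model (K : CochainComplex (FDMod k A) ℤ) (W : GrRep k Q) where
  /-- the generators -/
  s (x : Q) (m : ℤ) : W.obj x m →ₗ[k] ev q (K.X m) x
  free (m : ℤ) : FreeOn q (K.X m) (fun x ↦ W.obj x m) fun x ↦ s x m
  d_s (y : Q) (m m' : ℤ) (h : m + 1 = m') (v : W.obj y m) :
    evMap q (K.d m m') y (s y m v) =
      asm q (K.X m') y fun p ↦ s p.1 m' (W.map p.2 m m' h v)

namespace Model

variable {q} {K K' : CochainComplex (FDMod k A) ℤ} {W W' : GrRep k Q}

lemma d_modRad (hrad : RadicalSquareZero A) (S : Model q K W) (m m' : ℤ) {x : Q}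
    {p : ev q (K.X m) x} (hp : p ∈ modRad q (K.X m) x) : evMap q (K.d m m') x p = 0 := by
  by_cases h : m + 1 = m'
  · obtain ⟨u, rfl⟩ := (S.free m).exists_asm hrad hp
    rw [evMap_asm]
    refine asm_eq_zero hrad fun p ↦ ?_
    rw [S.d_s _ _ _ h]
    exact ⟨_, rfl⟩
  · rw [K.shape m m' h]
    rfl

lemma d_mem (hrad : RadicalSquareZero A) (S : Model q K W) (m m' : ℤ) (x : Q)
    (p : ev q (K.X m) x) : evMap q (K.d m m') x p ∈ modRad q (K.X m') x := by
  by_cases h : m + 1 = m'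
  · obtain ⟨v, hv⟩ := (S.free m).exists_sub_mem x p
    have := S.d_modRad hrad m m' hv
    rw [map_sub, sub_eq_zero] at this
    rw [this, S.d_s _ _ _ h]
    exact ⟨_, rfl⟩
  · rw [K.shape m m' h]
    exact zero_mem _

lemma hom_ext (hrad : RadicalSquareZero A) (S : Model q K W) {f g : K ⟶ K'}
    (h : ∀ x m v, evMap q (f.f m) x (S.s x m v) = evMap q (g.f m) x (S.s x m v)) : f = g := by
  ext m : 1
  exact (S.free m).hom_ext hrad fun x v ↦ h x m v

/-- A morphism of graded representations induces a morphism of complexes. -/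
lemma exists_hom (hrad : RadicalSquareZero A) (S : Model q K W) (S' : Model q K' W')
    (φ : W.Hom W') :
    ∃ f : K ⟶ K', ∀ x m v, evMap q (f.f m) x (S.s x m v) = S'.s x m (φ.app x m v) := by
  choose f hf using fun m ↦ (S.free m).exists_hom (K'.X m) fun x ↦ S'.s x m ∘ₗ φ.app x m
  refine ⟨{ f := f, comm' := fun m m' h ↦ (S.free m).hom_ext hrad fun x v ↦ ?_ },
    fun x m v ↦ hf m x v⟩
  have h : m + 1 = m' := h
  simp only [LinearMap.comp_apply] at hf
  rw [evMap_comp, evMap_comp, LinearMap.comp_apply, LinearMap.comp_apply, hf, S.d_s _ _ _ h,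
    S'.d_s _ _ _ h, evMap_asm]
  simp only [hf, φ.comm]

/-- A morphism of complexes induces a morphism of graded representations, by its effect on the
generators modulo the radicals. It commutes with the action of the arrows because the differentials
annihilate radicals. -/
lemma exists_grHom (hrad : RadicalSquareZero A) (S : Model q K W) (S' : Model q K' W')
    (f : K ⟶ K') : ∃ φ : W.Hom W', ∀ x m v,
      evMap q (f.f m) x (S.s x m v) - S'.s x m (φ.app x m v) ∈ modRad q (K'.X m) x := by
  choose c hc using fun x m ↦ (S'.free m).exists_coord x
  have hf (m m' : ℤ) (x) (p) : evMap q (f.f m') x (evMap q (K.d m m') x p) =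
      evMap q (K'.d m m') x (evMap q (f.f m) x p) := by
    rw [← LinearMap.comp_apply, ← LinearMap.comp_apply, ← evMap_comp, ← evMap_comp, f.comm]
  refine ⟨⟨fun x m ↦ c x m ∘ₗ evMap q (f.f m) x ∘ₗ S.s x m, fun {x y} α m m' h v ↦ ?_⟩,
    fun x m v ↦ hc x m _⟩
  have h1 := hf m m' y (S.s y m v)
  rw [S.d_s _ _ _ h, evMap_asm, asm_congr hrad fun p ↦ hc p.1 m' _] at h1
  have h2 := S'.d_modRad hrad m m' (hc y m (evMap q (f.f m) y (S.s y m v)))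
  rw [map_sub, sub_eq_zero] at h2
  rw [h2, S'.d_s _ _ _ h] at h1
  exact congrFun ((S'.free m').asm_injective h1) ⟨x, α⟩

/-- Homotopic morphisms between complexes with models agree modulo radicals, because the
differentials map to the radicals. -/
lemma sub_mem_of_homotopy (hrad : RadicalSquareZero A) (S : Model q K W) (S' : Model q K' W')
    {f g : K ⟶ K'} (h : Homotopy f g) (x : Q) (m : ℤ) (p : ev q (K.X m) x) :
    evMap q (f.f m) x p - evMap q (g.f m) x p ∈ modRad q (K'.X m) x := by
  have := congrArg (fun e ↦ evMap q e x p) (h.comm m)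
  simp only [evMap_add, LinearMap.add_apply] at this
  rw [this, add_sub_cancel_right]
  refine add_mem ?_ ?_
  · rw [dNext_eq (i := m) (i' := m + 1) _ rfl, evMap_comp, LinearMap.comp_apply]
    exact evMap_mem_modRad _ (S.d_mem hrad _ _ _ _)
  · rw [prevD_eq (j := m) (j' := m - 1) _ (by simp), evMap_comp, LinearMap.comp_apply]
    exact S'.d_mem hrad _ _ _ _

lemma projective (hrad : RadicalSquareZero A) (S : Model q K W) (m : ℤ) : Projective (K.X m) :=
  (S.free m).projective hrad

/-- A complex of projectives with radical differentials has a model. -/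
lemma exists_of_radical [IsAlgClosed k] (hrad : RadicalSquareZero A)
    (P : CochainComplex (FDMod k A) ℤ) (hP : ∀ m, Projective (P.X m))
    (hd : ∀ m m' x p, evMap q (P.d m m') x p ∈ modRad q (P.X m') x) :
    ∃ W : GrRep k Q, Nonempty (Model q P W) := by
  have hF (m : ℤ) : FreeOn q (P.X m) (top q (P.X m)) (topSec q (P.X m)) :=
    have := hP m
    freeOn_top hrad q (P.X m)
  -- `L m y` is an isomorphism from the sum of the tops at the sources of the arrows to the radical
  let L (m : ℤ) (y : Q) : (∀ p : Σ x : Q, x ⟶ y, top q (P.X m) p.1) →ₗ[k] ev q (P.X m) y :=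
    asm q (P.X m) y ∘ₗ LinearMap.pi fun p ↦ topSec q (P.X m) p.1 ∘ₗ LinearMap.proj p
  have hL (m : ℤ) (y : Q) (u) :
      L m y u = asm q (P.X m) y fun p ↦ topSec q (P.X m) p.1 (u p) := rfl
  choose L' hL' using fun m y ↦ (L m y).exists_leftInverse_of_injective
    (LinearMap.ker_eq_bot.2 fun u u' h ↦ (hF m).asm_injective h)
  have hL'' (m y u) : L' m y (L m y u) = u := LinearMap.congr_fun (hL' m y) u
  refine ⟨⟨fun x m ↦ top q (P.X m) x, fun {x y} α m m' _ ↦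
    LinearMap.proj (⟨x, α⟩ : Σ x : Q, x ⟶ y) ∘ₗ L' m' y ∘ₗ evMap q (P.d m m') y ∘ₗ
      topSec q (P.X m) y⟩, ⟨⟨fun x m ↦ topSec q (P.X m) x, hF, fun y m m' h v ↦ ?_⟩⟩⟩
  obtain ⟨u, hu⟩ := (hF m').exists_asm hrad (hd m m' y (topSec q (P.X m) y v))
  rw [← hL] at hu
  change _ = L m' y fun p ↦ L' m' y (evMap q (P.d m m') y (topSec q (P.X m) y v)) p
  rw [hu]
  exact congrArg _ (hL'' m' y u).symm

end Model

/-- The shift of a graded representation. -/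
def GrRep.shift (W : GrRep k Q) (n : ℤ) : GrRep k Q where
  obj x m := W.obj x (m + n)
  map α m m' h := W.map α (m + n) (m' + n) (by omega)

lemma FreeOn.smul {P : FDMod k A} {V : Q → ModuleCat.{v} k} {s : ∀ x, V x →ₗ[k] ev q P x}
    (h : FreeOn q P V s) {c : k} (hc : c ≠ 0) : FreeOn q P V fun x ↦ c • s x := by
  refine ⟨fun N ψ ↦ ?_, fun x p ↦ ?_, fun x v hv ↦ ?_, fun y u hu ↦ ?_⟩
  · obtain ⟨f, hf⟩ := h.exists_hom N fun x ↦ c⁻¹ • ψ x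
    refine ⟨f, fun x v ↦ ?_⟩
    rw [LinearMap.smul_apply, map_smul, hf, LinearMap.smul_apply, smul_inv_smul₀ hc]
  · obtain ⟨v, hv⟩ := h.exists_sub_mem x p
    refine ⟨c⁻¹ • v, ?_⟩
    rwa [LinearMap.smul_apply, map_smul, smul_inv_smul₀ hc]
  · exact h.eq_zero_of_mem x v ((Submodule.smul_mem_iff _ hc).1 hv)
  · refine h.eq_zero_of_asm y u ((smul_eq_zero.1 ?_).resolve_left hc)
    rw [← map_smul]
    exact hu

lemma evMap_units_smul {M N : FDMod k A} (e : ℤˣ) (f : M ⟶ N) (x : Q) :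
    evMap q (e • f) x = ((e : ℤ) : k) • evMap q f x := by
  rcases Int.units_eq_one_or e with rfl | rfl
  · simp
  · have : (-1 : ℤˣ) • f = -f := by rw [Units.smul_def]; simp
    rw [this, evMap_neg]
    simp

variable {q} in
/-- A model of a shifted complex. The signs of the generators compensate for the sign of the
shifted differential. -/
def Model.shift {K : CochainComplex (FDMod k A) ℤ} {W : GrRep k Q} (S : Model q K W) (n : ℤ) :
    Model q (K⟦n⟧) (W.shift n) where
  s x m := ((((n * m).negOnePow : ℤˣ) : ℤ) : k) • S.s x (m + n)
  free m := by
    refine (S.free (m + n)).smul q ?_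
    rcases Int.units_eq_one_or (n * m).negOnePow with h | h <;> simp [h]
  d_s y m m' h v := by
    have h1 := S.d_s y (m + n) (m' + n) (by omega) v
    have h2 : evMap q ((K⟦n⟧).d m m') y =
        (((n.negOnePow : ℤˣ) : ℤ) : k) • evMap q (K.d (m + n) (m' + n)) y :=
      evMap_units_smul q n.negOnePow (K.d (m + n) (m' + n)) y
    rw [h2]
    refine (map_smul ((((n.negOnePow : ℤˣ) : ℤ) : k) • evMap q (K.d (m + n) (m' + n)) y)
      _ _).trans ?_
    rw [LinearMap.smul_apply, h1, smul_smul]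
    refine Eq.trans ?_ (map_smul (asm q (K.X (m' + n)) y) _ _).symm
    congr 1
    rw [← h, mul_add, mul_one, Int.negOnePow_add]
    push_cast
    rfl

/-- The vector spaces `M(x, n)` for fixed `n`. -/
abbrev boxObj (M : FinRep k (Box Q)) (n : ℤ) (x : Q) : ModuleCat.{v} k :=
  M.obj.obj ((Paths.of (Box Q)).obj ⟨x, n⟩)

/-- The linear map `M(α, n)`. -/
def boxMap (M : FinRep k (Box Q)) {x y : Q} (α : x ⟶ y) (n n' : ℤ) (h : n' = n - 1) :
    boxObj M n y →ₗ[k] boxObj M n' x :=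
  (M.obj.map ((Paths.of (Box Q)).map (⟨α, h⟩ : (⟨y, n⟩ : Box Q) ⟶ ⟨x, n'⟩))).hom

/-- The graded representation that corresponds to a representation of `Q^□`. -/
def GrRep.ofBox (M : FinRep k (Box Q)) : GrRep k Q where
  obj x m := boxObj M (-m) x
  map α m m' h := boxMap M α (-m) (-m') (by omega)

lemma free_ext {V : Q → ModuleCat.{v} k} {hV : ∀ x, FiniteDimensional k (V x)}
    [Finite {x // Nontrivial (V x)}] {y : Q} {p p' : ev q (free q V hV) y}
    (h : ∀ j, evMap q (freeπ q V hV j) y p = evMap q (freeπ q V hV j) y p') : p = p' := by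
  have := Fintype.ofFinite {x // Nontrivial (V x)}
  have htot (p) : p = ∑ j, evMap q (freeι q V hV j) y (evMap q (freeπ q V hV j) y p) := by
    have h1 := congrArg (fun f ↦ evMap q f y p) (IsBilimit.total (biproduct.isBilimit
      (fun x : {x // Nontrivial (V x)} ↦ proj k A (q.obj x) (V x) (hV x))))
    simp only [evMap_sum, evMap_comp, LinearMap.sum_apply, LinearMap.comp_apply] at h1
    exact h1.symm
  rw [htot p, htot p']
  simp only [h]

instance (M : FinRep k (Box Q)) (n : ℤ) (x : Q) : FiniteDimensional k (boxObj M n x) :=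
  M.property.finite ⟨x, n⟩

instance (M : FinRep k (Box Q)) (n : ℤ) : Finite {x // Nontrivial (boxObj M n x)} :=
  inferInstanceAs (Finite (SuppAt M n))

open Classical in
/-- The differential of `F(M)` on the generators. -/
lemma diff_freeGen (M : FinRep k (Box Q)) (n n' : ℤ) (h : n' = n - 1) (y : Q)
    (v : boxObj M n y) :
    evMap q (diff q M n n' h) y (freeGen q (boxObj M n) (fun _ ↦ inferInstance) y v) =
      asm q (term q M n') y fun p ↦
        freeGen q (boxObj M n') (fun _ ↦ inferInstance) p.1 (boxMap M p.2 n n' h v) := by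
  by_cases hy : Nontrivial (boxObj M n y)
  swap
  · have := not_nontrivial_iff_subsingleton.1 hy
    rw [Subsingleton.elim v 0, map_zero, map_zero]
    simp only [map_zero]
    exact (map_zero (asm q (term q M n') y)).symm
  refine free_ext q (V := boxObj M n') (hV := fun _ ↦ inferInstance) fun j ↦ ?_
  have := finite_into q y
  have := Fintype.ofFinite (Σ z : Q, z ⟶ y)
  have := q.finite_hom j y
  let _ := Fintype.ofFinite (j.1 ⟶ y)
  have h1 : evMap q (freeπ q (boxObj M n') (fun _ ↦ inferInstance) j) y
      (evMap q (diff q M n n' h) y (freeGen q (boxObj M n) (fun _ ↦ inferInstance) y v)) =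
        ∑ α : j.1 ⟶ y, tens q (boxObj M n') (fun _ ↦ inferInstance) j y (q.arr α)
          (boxMap M α n n' h v) := by
    rw [freeGen_of_nontrivial q hy, ← LinearMap.comp_apply, ← LinearMap.comp_apply,
      ← evMap_comp, ← evMap_comp]
    have h2 : freeι q (boxObj M n) (fun _ ↦ inferInstance) ⟨y, hy⟩ ≫ diff q M n n' h ≫
        freeπ q (boxObj M n') (fun _ ↦ inferInstance) j = component q M n n' h y j := by
      unfold diff
      rw [biproduct.ι_desc_assoc, biproduct.lift_π]
    rw [h2, component, evMap_sum, LinearMap.sum_apply]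
    refine Finset.sum_congr rfl fun α _ ↦ ?_
    change tens q (boxObj M n') (fun _ ↦ inferInstance) j y (q.arr α ≫ 𝟙 _)
      (boxMap M α n n' h v) = _
    rw [Category.comp_id]
  have h3 (p : Σ z : Q, z ⟶ y) : evMap q (freeπ q (boxObj M n') (fun _ ↦ inferInstance) j) y
      (arrMap q _ p.2 (freeGen q (boxObj M n') (fun _ ↦ inferInstance) p.1
        (boxMap M p.2 n n' h v))) =
      if hp : p.1 = j.1 then tens q (boxObj M n') (fun _ ↦ inferInstance) j y
        (q.arr (hp ▸ p.2)) (boxMap M (hp ▸ p.2) n n' h v) else 0 := by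
    rw [evMap_arrMap]
    obtain ⟨z, β⟩ := p
    obtain ⟨j, hj⟩ := j
    by_cases hz : Nontrivial (boxObj M n' z)
    · rw [freeGen_of_nontrivial q hz, ← LinearMap.comp_apply (evMap q _ _), ← evMap_comp]
      split_ifs with hzx
      · obtain rfl : z = j := hzx
        rw [biproduct.ι_π_self]
        change tens q (boxObj M n') (fun _ ↦ inferInstance) z y (𝟙 _ ≫ q.arr β) _ = _
        rw [Category.id_comp]
        rfl
      · rw [biproduct.ι_π_ne _ (fun h ↦ hzx (congrArg Subtype.val h)), evMap_zero,
          LinearMap.zero_apply, map_zero]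
    · rw [dif_neg fun h : z = j ↦ hz (h ▸ hj)]
      have := not_nontrivial_iff_subsingleton.1 hz
      rw [Subsingleton.elim (boxMap M β n n' h v) 0, map_zero, map_zero, map_zero]
  have h4 : (∑ α : j.1 ⟶ y, tens q (boxObj M n') (fun _ ↦ inferInstance) j y (q.arr α)
      (boxMap M α n n' h v)) = ∑ p : Σ z : Q, z ⟶ y, if hp : p.1 = j.1 then
        tens q (boxObj M n') (fun _ ↦ inferInstance) j y
        (q.arr (hp ▸ p.2)) (boxMap M (hp ▸ p.2) n n' h v) else 0 := by
    refine Finset.sum_of_injOn (fun α ↦ (⟨j.1, α⟩ : Σ z : Q, z ⟶ y)) ?_ ?_ ?_ ?_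
    · intro α _ β _ hαβ
      simpa using hαβ
    · simp
    · rintro ⟨z, β⟩ - hz
      refine dif_neg fun hzj ↦ hz ?_
      obtain rfl : z = j.1 := hzj
      exact ⟨β, by simp, rfl⟩
    · intro α _
      rw [dif_pos rfl]
  rw [h1, map_asm, h4]
  exact Finset.sum_congr rfl fun p _ ↦ (h3 p).symm

/-- The complex `F(M)` has the graded representation of `M` as a model. -/
def modelF [IsAlgClosed k] (hrad : RadicalSquareZero A) (M : FinRep k (Box Q)) :
    Model q (complexF hrad q M) (GrRep.ofBox M) where
  s x m := freeGen q (boxObj M (-m)) (fun _ ↦ inferInstance) x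
  free m := freeOn_free q hrad
  d_s y m m' h v := by
    have hd : (complexF hrad q M).d m m' = diff q M (-m) (-m') (by omega) := dif_pos h
    rw [hd]
    exact diff_freeGen q M (-m) (-m') (by omega) y v

end Model

/-! ### Bounded complexes of projectives in the derived category -/

section Derived

variable {C : Type*} [Category* C] [Abelian C]

/-- A bounded complex of projective objects. -/
structure IsBddProj (K : CochainComplex C ℤ) : Prop where
  projective (m : ℤ) : Projective (K.X m)
  isStrictlyGE : ∃ a, K.IsStrictlyGE a
  isStrictlyLE : ∃ b, K.IsStrictlyLE b

lemma IsBddProj.isKProjective {K : CochainComplex C ℤ} (h : IsBddProj K) : K.IsKProjective := by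
  obtain ⟨b, hb⟩ := h.isStrictlyLE
  have := h.projective
  exact CochainComplex.isKProjective_of_projective K b

variable [HasDerivedCategory C]

open DerivedCategory ZeroObject

/-- Morphisms in the derived category from a bounded complex of projectives come from morphisms of
complexes. -/
lemma IsBddProj.exists_map {K : CochainComplex C ℤ} (h : IsBddProj K) {L : CochainComplex C ℤ}
    (g : Q.obj K ⟶ Q.obj L) : ∃ f : K ⟶ L, Q.map f = g := by
  have := h.isKProjective
  obtain ⟨f', hf'⟩ := (CochainComplex.IsKProjective.Qh_map_bijective K _).surjective
    ((quotientCompQhIso C).hom.app K ≫ g ≫ (quotientCompQhIso C).inv.app L)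
  obtain ⟨f, rfl⟩ := (HomotopyCategory.quotient _ _).map_surjective f'
  refine ⟨f, ?_⟩
  rw [← cancel_epi ((quotientCompQhIso C).hom.app K), ← quotientCompQhIso_hom_naturality, hf']
  simp

/-- Morphisms from a bounded complex of projectives that agree in the derived category are
homotopic. -/
lemma IsBddProj.homotopy {K : CochainComplex C ℤ} (h : IsBddProj K) {L : CochainComplex C ℤ}
    {f g : K ⟶ L} (hfg : Q.map f = Q.map g) : Nonempty (Homotopy f g) := by
  have := h.isKProjective
  refine ⟨HomotopyCategory.homotopyOfEq _ _
    ((CochainComplex.IsKProjective.Qh_map_bijective K _).injective ?_)⟩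
  rw [← cancel_mono ((quotientCompQhIso C).hom.app L), quotientCompQhIso_hom_naturality, hfg,
    ← quotientCompQhIso_hom_naturality]

omit [HasDerivedCategory C] in
lemma IsBddProj.shift {K : CochainComplex C ℤ} (h : IsBddProj K) (n : ℤ) : IsBddProj (K⟦n⟧) := by
  obtain ⟨a, ha⟩ := h.isStrictlyGE
  obtain ⟨b, hb⟩ := h.isStrictlyLE
  exact ⟨fun m ↦ h.projective (m + n), ⟨a - n, K.isStrictlyGE_shift a n _ (by omega)⟩,
    ⟨b - n, K.isStrictlyLE_shift b n _ (by omega)⟩⟩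

omit [HasDerivedCategory C] in
lemma IsBddProj.mappingCone {K L : CochainComplex C ℤ} (hK : IsBddProj K) (hL : IsBddProj L)
    (f : K ⟶ L) : IsBddProj (CochainComplex.mappingCone f) := by
  have e (m : ℤ) : (CochainComplex.mappingCone f).X m ≅ K.X (m + 1) ⊞ L.X m :=
    HomologicalComplex.homotopyCofiber.XIsoBiprod f m (m + 1) rfl
  obtain ⟨a, ha⟩ := hK.isStrictlyGE
  obtain ⟨b, hb⟩ := hK.isStrictlyLE
  obtain ⟨a', ha'⟩ := hL.isStrictlyGE
  obtain ⟨b', hb'⟩ := hL.isStrictlyLE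
  refine ⟨fun m ↦ ?_, ⟨min a a' - 1, ?_⟩, ⟨max b b', ?_⟩⟩
  · have := hK.projective (m + 1)
    have := hL.projective m
    exact Projective.of_iso (e m).symm inferInstance
  · rw [CochainComplex.isStrictlyGE_iff]
    intro i hi
    refine IsZero.of_iso ?_ (e i)
    exact (biprod_isZero_iff _ _).2 ⟨K.isZero_of_isStrictlyGE a _ (by omega),
      L.isZero_of_isStrictlyGE a' _ (by omega)⟩
  · rw [CochainComplex.isStrictlyLE_iff]
    intro i hi
    refine IsZero.of_iso ?_ (e i)
    exact (biprod_isZero_iff _ _).2 ⟨K.isZero_of_isStrictlyLE b _ (by omega),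
      L.isZero_of_isStrictlyLE b' _ (by omega)⟩

/-- The objects of the derived category that are isomorphic to a bounded complex of projectives. -/
def HasBddRes (X : DerivedCategory C) : Prop :=
  ∃ K : CochainComplex C ℤ, IsBddProj K ∧ Nonempty (X ≅ Q.obj K)

namespace HasBddRes

lemma of_iso {X Y : DerivedCategory C} (h : HasBddRes X) (e : X ≅ Y) : HasBddRes Y := by
  obtain ⟨K, hK, ⟨e'⟩⟩ := h
  exact ⟨K, hK, ⟨e.symm ≪≫ e'⟩⟩

lemma shift {X : DerivedCategory C} (h : HasBddRes X) (n : ℤ) : HasBddRes (X⟦n⟧) := by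
  obtain ⟨K, hK, ⟨e⟩⟩ := h
  exact ⟨K⟦n⟧, hK.shift n,
    ⟨(shiftFunctor (DerivedCategory C) n).mapIso e ≪≫ (Q.commShiftIso n).symm.app K⟩⟩

open Pretriangulated in
lemma cone {T : Triangle (DerivedCategory C)} (hT : T ∈ distTriang _) (h₁ : HasBddRes T.obj₁)
    (h₂ : HasBddRes T.obj₂) : HasBddRes T.obj₃ := by
  obtain ⟨K, hK, ⟨e⟩⟩ := h₁
  obtain ⟨L, hL, ⟨e'⟩⟩ := h₂
  obtain ⟨f, hf⟩ := hK.exists_map (e.inv ≫ T.mor₁ ≫ e'.hom)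
  refine ⟨_, hK.mappingCone hL f, ⟨Triangle.π₃.mapIso (isoTriangleOfIso₁₂ T _ hT
    (mappingCone_triangle_distinguished f) e e' ?_)⟩⟩
  change T.mor₁ ≫ e'.hom = e.hom ≫ Q.map f
  rw [hf, e.hom_inv_id_assoc]

open Pretriangulated in
lemma extension {T : Triangle (DerivedCategory C)} (hT : T ∈ distTriang _)
    (h₁ : HasBddRes T.obj₁) (h₃ : HasBddRes T.obj₃) : HasBddRes T.obj₂ :=
  cone (inv_rot_of_distTriang T hT) (h₃.shift (-1)) h₁

lemma of_isZero {X : DerivedCategory C} (h : IsZero X) : HasBddRes X := by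
  refine ⟨0, ⟨fun m ↦ ?_, ⟨0, ?_⟩, ⟨0, ?_⟩⟩, ⟨h.iso (Q.map_isZero (isZero_zero _))⟩⟩
  · have : IsZero ((0 : CochainComplex C ℤ).X m) :=
      (HomologicalComplex.eval C _ m).map_isZero (isZero_zero _)
    exact Projective.of_iso (this.iso (isZero_zero C)).symm inferInstance
  all_goals infer_instance

lemma single_of_projective (P : C) [Projective P] (n : ℤ) :
    HasBddRes ((singleFunctor C n).obj P) := by
  refine ⟨(CochainComplex.singleFunctor C n).obj P, ⟨fun m ↦ ?_, ⟨n, inferInstance⟩,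
    ⟨n, inferInstance⟩⟩, ⟨(singleFunctorIsoCompQ C n).app P⟩⟩
  by_cases hm : m = n
  · subst hm
    exact Projective.of_iso (HomologicalComplex.singleObjXSelf (.up ℤ) m P).symm inferInstance
  · exact Projective.of_iso ((HomologicalComplex.isZero_single_obj_X (.up ℤ) n P m hm).iso
      (isZero_zero C)).symm inferInstance

lemma single_of_single_zero {M : C} (h : HasBddRes ((singleFunctor C 0).obj M)) (n : ℤ) :
    HasBddRes ((singleFunctor C n).obj M) :=
  (h.shift (-n)).of_iso (((singleFunctors C).shiftIso (-n) n 0 (by omega)).app M)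

/-- If all objects of `C` have bounded resolutions, then so do all bounded objects of the derived
category. -/
lemma of_bounded (h : ∀ M : C, HasBddRes ((singleFunctor C 0).obj M)) (X : DerivedCategory C)
    (hX : TStructure.t.bounded X) : HasBddRes X := by
  obtain ⟨⟨a, ha⟩, ⟨b, hb⟩⟩ := hX
  -- induction on the length of the interval of degrees in which the cohomology is concentrated
  have key (n : ℕ) : ∀ (a : ℤ) (X : DerivedCategory C), X.IsGE a → X.IsLE (a + n) →
      HasBddRes X := by
    induction n with
    | zero =>
      intro a X _ h₂
      have : X.IsLE a := by simpa using h₂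
      obtain ⟨Y, ⟨e⟩⟩ := exists_iso_singleFunctor_obj_of_isGE_of_isLE X a
      exact (single_of_single_zero (h Y) a).of_iso e.symm
    | succ n ih =>
      intro a X _ _
      have hT := TStructure.t.triangleLTGE_distinguished (a + 1) X
      refine extension hT ?_ ?_
      · have h₁ : ((TStructure.t.truncLT (a + 1)).obj X).IsGE a := inferInstance
        have h₂ : ((TStructure.t.truncLT (a + 1)).obj X).IsLE a := inferInstance
        obtain ⟨Y, ⟨e⟩⟩ := exists_iso_singleFunctor_obj_of_isGE_of_isLE
          ((TStructure.t.truncLT (a + 1)).obj X) a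
        exact (single_of_single_zero (h Y) a).of_iso e.symm
      · refine ih (a + 1) _ (inferInstanceAs (((TStructure.t.truncGE (a + 1)).obj X).IsGE (a + 1)))
          ?_
        have : X.IsLE (a + 1 + n) := by
          convert! (inferInstance : X.IsLE (a + (n + 1 : ℕ))) using 1
          push_cast
          ring
        exact inferInstanceAs (((TStructure.t.truncGE (a + 1)).obj X).IsLE (a + 1 + n))
  exact key (b - a).toNat a X ha (TStructure.t.isLE_of_le X b _ (by omega))

end HasBddRes

/-- A null-homotopic idempotent can be split off without changing the object of the derived
category. -/
lemma exists_retract_of_nullHomotopic {K : CochainComplex C ℤ} (e : K ⟶ K) (he : e ≫ e = e)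
    (h : Homotopy e 0) : ∃ (L : CochainComplex C ℤ) (i : L ⟶ K) (p : K ⟶ L),
      i ≫ p = 𝟙 L ∧ p ≫ i = 𝟙 K - e ∧ IsIso (Q.map p) := by
  obtain ⟨L, i, p, hi, hp⟩ := IsIdempotentComplete.idempotents_split K (𝟙 K - e)
    (by simp [Preadditive.comp_sub, Preadditive.sub_comp, he])
  refine ⟨L, i, p, hi, hp, ⟨Q.map i, ?_, ?_⟩⟩
  · rw [← Q.map_comp, hp, Q.map_sub, Q_map_eq_of_homotopy C h, Q.map_zero, sub_zero, Q.map_id]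
  · rw [← Q.map_comp, hi, Q.map_id]

omit [HasDerivedCategory C] in
lemma IsBddProj.of_retract {K L : CochainComplex C ℤ} (hK : IsBddProj K) (i : L ⟶ K) (p : K ⟶ L)
    (hi : i ≫ p = 𝟙 L) : IsBddProj L := by
  have hi' (m : ℤ) : i.f m ≫ p.f m = 𝟙 _ := by
    rw [← HomologicalComplex.comp_f, hi, HomologicalComplex.id_f]
  obtain ⟨a, ha⟩ := hK.isStrictlyGE
  obtain ⟨b, hb⟩ := hK.isStrictlyLE
  refine ⟨fun m ↦ ?_, ⟨a, ?_⟩, ⟨b, ?_⟩⟩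
  · have := hK.projective m
    exact Retract.projective (⟨i.f m, p.f m, hi' m⟩ : Retract (L.X m) (K.X m))
  · rw [CochainComplex.isStrictlyGE_iff]
    intro m hm
    exact isZero_of_retract _ _ (hi' m) (K.isZero_of_isStrictlyGE a _ hm)
  · rw [CochainComplex.isStrictlyLE_iff]
    intro m hm
    exact isZero_of_retract _ _ (hi' m) (K.isZero_of_isStrictlyLE b _ hm)

lemma IsBddProj.bounded {K : CochainComplex C ℤ} (hK : IsBddProj K) :
    TStructure.t.bounded (Q.obj K) := by
  obtain ⟨a, ha⟩ := hK.isStrictlyGE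
  obtain ⟨b, hb⟩ := hK.isStrictlyLE
  exact ⟨⟨a, (isGE_Q_obj_iff _ _).2 inferInstance⟩, ⟨b, (isLE_Q_obj_iff _ _).2 inferInstance⟩⟩

/-- A retract of an indecomposable object of the bounded derived category that is given by
complexes is zero or the whole object. -/
lemma isZero_or_isIso_of_retract {X : DerivedCategory.Bounded C} (hX : Indecomposable X)
    {K L : CochainComplex C ℤ} (hK : IsBddProj K) (i : L ⟶ K) (p : K ⟶ L)
    (hi : i ≫ p = 𝟙 L) (e : X.obj ≅ Q.obj K) : IsZero (Q.obj L) ∨ IsIso (Q.map i) := by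
  obtain ⟨L', i', p', hi', hp'⟩ := IsIdempotentComplete.idempotents_split K (𝟙 K - p ≫ i)
    (by simp [Preadditive.comp_sub, Preadditive.sub_comp, reassoc_of% hi])
  let Y : DerivedCategory.Bounded C := ⟨Q.obj L, (hK.of_retract i p hi).bounded⟩
  let Y' : DerivedCategory.Bounded C := ⟨Q.obj L', (hK.of_retract i' p' hi').bounded⟩
  have e' : X ≅ Y ⊞ Y' := biprodIsoOfRetracts
    (ObjectProperty.homMk (Q.map i ≫ e.inv)) (ObjectProperty.homMk (e.hom ≫ Q.map p))
    (ObjectProperty.homMk (Q.map i' ≫ e.inv)) (ObjectProperty.homMk (e.hom ≫ Q.map p'))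
    (by
      apply ObjectProperty.hom_ext
      change (Q.map i ≫ e.inv) ≫ e.hom ≫ Q.map p = 𝟙 _
      rw [Category.assoc, e.inv_hom_id_assoc, ← Q.map_comp, hi, Q.map_id])
    (by
      apply ObjectProperty.hom_ext
      change (Q.map i' ≫ e.inv) ≫ e.hom ≫ Q.map p' = 𝟙 _
      rw [Category.assoc, e.inv_hom_id_assoc, ← Q.map_comp, hi', Q.map_id])
    (by
      apply ObjectProperty.hom_ext
      change (e.hom ≫ Q.map p) ≫ Q.map i ≫ e.inv + (e.hom ≫ Q.map p') ≫ Q.map i' ≫ e.inv = 𝟙 _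
      have : Q.map p ≫ Q.map i + Q.map p' ≫ Q.map i' = 𝟙 _ := by
        rw [← Q.map_comp, ← Q.map_comp, ← Q.map_add, hp', add_sub_cancel, Q.map_id]
      have := e.hom ≫= this =≫ e.inv
      simpa [Preadditive.comp_add, Preadditive.add_comp] using this)
  rcases hX.2 _ _ e' with h | h
  · exact .inl (Bounded.ι.map_isZero h)
  · right
    have h0 : IsZero (Q.obj L') := Bounded.ι.map_isZero h
    refine ⟨Q.map p, ?_, ?_⟩
    · rw [← Q.map_comp, hi, Q.map_id]
    · have h1 : Q.map (𝟙 K - p ≫ i) = 0 := by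
        rw [← hp', Q.map_comp, h0.eq_of_tgt (Q.map p') 0, zero_comp]
      rw [Q.map_sub, Q.map_id, sub_eq_zero] at h1
      rw [← Q.map_comp, h1]

end Derived

/-! ### Finite projective resolutions of modules -/

section Resolutions

variable {Q : Type w} [Quiver.{t} Q]

/-- All oriented paths that start at the vertex have fewer than `n` arrows; `ShortPaths 0` holds
for no vertex. -/
def ShortPaths : ℕ → Q → Prop
  | 0, _ => False
  | n + 1, x => ∀ y, Nonempty (x ⟶ y) → ShortPaths n y

lemma ShortPaths.succ : ∀ {n : ℕ} {x : Q}, ShortPaths n x → ShortPaths (n + 1) x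
  | 0, _, h => h.elim
  | _ + 1, _, h => fun y hy ↦ (h y hy).succ

lemma ShortPaths.mono {n m : ℕ} (hnm : n ≤ m) {x : Q} (h : ShortPaths n x) : ShortPaths m x := by
  induction hnm with
  | refl => exact h
  | step _ ih => exact ih.succ

lemma exists_shortPaths_of_finite {S : Set Q} (hS : S.Finite)
    (h : ∀ x ∈ S, ∃ n, ShortPaths n x) : ∃ n, ∀ x ∈ S, ShortPaths n x := by
  induction S, hS using Set.Finite.induction_on with
  | empty => exact ⟨0, by simp⟩
  | @insert a S _ _ ih =>
    obtain ⟨n, hn⟩ := ih fun x hx ↦ h x (Set.mem_insert_of_mem _ hx)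
    obtain ⟨m, hm⟩ := h a (Set.mem_insert _ _)
    refine ⟨max n m, ?_⟩
    rintro x (rfl | hx)
    · exact hm.mono (le_max_right _ _)
    · exact (hn x hx).mono (le_max_left _ _)

/-- König's lemma: in a quiver with finite out-degrees and without infinite paths, the lengths of
the paths that start at a given vertex are bounded. -/
lemma exists_shortPaths (hfin : ∀ x : Q, {y : Q | Nonempty (x ⟶ y)}.Finite)
    (hpath : ¬ ∃ x : ℕ → Q, ∀ n, Nonempty (x n ⟶ x (n + 1))) (x : Q) : ∃ n, ShortPaths n x := by
  by_contra hx
  have step (x : {x : Q // ¬ ∃ n, ShortPaths n x}) :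
      ∃ y : {x : Q // ¬ ∃ n, ShortPaths n x}, Nonempty (x.1 ⟶ y.1) := by
    by_contra! hy
    refine x.2 ?_
    obtain ⟨n, hn⟩ := exists_shortPaths_of_finite (hfin x.1) fun y hxy ↦ by
      by_contra h
      exact (hy ⟨y, h⟩).false hxy.some
    exact ⟨n + 1, hn⟩
  choose f hf using step
  refine hpath ⟨fun n ↦ (f^[n] ⟨x, hx⟩).1, fun n ↦ ?_⟩
  change Nonempty ((f^[n] ⟨x, hx⟩).1 ⟶ (f^[n + 1] ⟨x, hx⟩).1)
  rw [Function.iterate_succ_apply']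
  exact hf _

variable {k : Type v} [Field k] [IsAlgClosed k] {A : Type u} [Category.{v} A] [Preadditive A]
  [Linear k A] [IsLofd A k] [HasDerivedCategory.{s} (FDMod k A)]

open DerivedCategory

/-- The kernel of a projective cover is contained in the radical, so that it is supported at proper
successors of the vertices that support the module. Hence the lengths of paths bound the projective
dimension. -/
lemma hasBddRes_of_shortPaths (hrad : RadicalSquareZero A) (q : QuiverOf k A Q) (n : ℕ) :
    ∀ M : FDMod k A, (∀ x, Nontrivial (ev q M x) → ShortPaths n x) →
      HasBddRes ((singleFunctor (FDMod k A) 0).obj M) := by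
  induction n with
  | zero =>
    intro M hM
    refine HasBddRes.of_isZero (Functor.map_isZero _ (isZero_of_evMap (q := q) fun x ↦ ?_))
    exact not_nontrivial_iff_subsingleton.1 fun h ↦ hM x h
  | succ n ih =>
    intro M hM
    obtain ⟨P, s, c, hP, hc, hsurj, hker⟩ := exists_cover hrad q M
    have : Epi c := epi_of_evMap c hsurj
    have : Projective P := hP.projective hrad
    have hS : (ShortComplex.mk (kernel.ι c) c (kernel.condition c)).ShortExact :=
      { exact := ShortComplex.exact_of_f_is_kernel _ (kernelIsKernel c) }
    refine HasBddRes.cone hS.singleTriangle_distinguished (ih (kernel c) fun x hx ↦ ?_)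
      (HasBddRes.single_of_projective P 0)
    -- the support of the kernel consists of direct successors of vertices in the support of `M`
    obtain ⟨a, ha⟩ := exists_ne (0 : ev q (kernel c) x)
    have h1 : evMap q (kernel.ι c) x a ∈ modRad q P x := by
      refine hker x _ ?_
      rw [← LinearMap.comp_apply, ← evMap_comp, kernel.condition]
      rfl
    have h2 : evMap q (kernel.ι c) x a ≠ 0 := fun h ↦
      ha (evMap_injective q (kernel.ι c) x (by rw [h, map_zero]))
    obtain ⟨u, hu⟩ := hP.exists_asm hrad h1
    obtain ⟨⟨y, β⟩, hp⟩ : ∃ p, u p ≠ 0 := by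
      by_contra! h
      refine h2 ?_
      rw [hu]
      simp only [h, map_zero]
      exact map_zero (asm q P x)
    have : Nontrivial (top q M y) := ⟨_, _, hp⟩
    exact hM y (topMk_surjective q M y).nontrivial x ⟨β⟩

lemma hasBddRes_single (hrad : RadicalSquareZero A) (q : QuiverOf k A Q)
    (hpath : ¬ ∃ x : ℕ → Q, ∀ n, Nonempty (x n ⟶ x (n + 1))) (M : FDMod k A) :
    HasBddRes ((singleFunctor (FDMod k A) 0).obj M) := by
  obtain ⟨n, hn⟩ := exists_shortPaths_of_finite (finite_support q M)
    fun x _ ↦ exists_shortPaths (finite_out_of q) hpath x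
  exact hasBddRes_of_shortPaths hrad q n M hn

end Resolutions

/-! ### Radical complexes -/

section Radical

variable {Q : Type w} [Quiver.{t} Q] {k : Type v} [Field k] {A : Type u} [Category.{v} A]
  [Preadditive A] [Linear k A] [IsLofd A k] {q : QuiverOf k A Q}

lemma FreeOn.exists_hom_at {P : FDMod k A} {V : Q → ModuleCat.{v} k}
    {s : ∀ x, V x →ₗ[k] ev q P x} (h : FreeOn q P V s) {N : FDMod k A} (x : Q)
    (ψ : V x →ₗ[k] ev q N x) : ∃ f : P ⟶ N, ∀ v, evMap q f x (s x v) = ψ v := by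
  classical
  obtain ⟨f, hf⟩ := h.exists_hom N fun y ↦ if hy : x = y then hy ▸ ψ else 0
  refine ⟨f, fun v ↦ ?_⟩
  rw [hf, dif_pos rfl]

/-- An endomorphism of a free module that is the identity modulo the radical is invertible. -/
lemma FreeOn.isIso_of_sub_mem (hrad : RadicalSquareZero A) {P : FDMod k A}
    {V : Q → ModuleCat.{v} k} {s : ∀ x, V x →ₗ[k] ev q P x} (h : FreeOn q P V s) (b : P ⟶ P)
    (hb : ∀ x v, evMap q b x (s x v) - s x v ∈ modRad q P x) : IsIso b := by
  have hs : ∀ x, Function.Surjective (evMap q b x) := by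
    refine surjective_of_modRad hrad b fun x p ↦ ⟨p, ?_⟩
    obtain ⟨v, hv⟩ := h.exists_sub_mem x p
    have := sub_mem (sub_mem hv (evMap_mem_modRad b hv)) (hb x v)
    rw [map_sub] at this
    convert this using 1
    abel
  exact isIso_of_evMap b fun x ↦ ⟨LinearMap.injective_iff_surjective.2 (hs x), hs x⟩

/-- The properties of `A^x` and of its generator that are used to split off copies of `A^x`. -/
lemma exists_point [IsAlgClosed k] (hrad : RadicalSquareZero A) (q : QuiverOf k A Q) (x : Q) :
    ∃ (F : FDMod k A) (g : ev q F x),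
      (∀ (N : FDMod k A) (n : ev q N x), ∃ f : F ⟶ N, evMap q f x g = n) ∧
      ∀ b : F ⟶ F, evMap q b x g - g ∈ modRad q F x → IsIso b := by
  let V (y : Q) : ModuleCat.{v} k := ModuleCat.of k (PLift (y = x) → k)
  have hV (y : Q) : FiniteDimensional k (V y) :=
    inferInstanceAs (FiniteDimensional k (PLift (y = x) → k))
  have hy (y : Q) (h : y ≠ x) (w : V y) : w = 0 := funext fun ⟨e⟩ ↦ (h e).elim
  have hfin : Finite {y // Nontrivial (V y)} := by
    refine Set.Finite.to_subtype (s := {y | Nontrivial (V y)}) ((Set.finite_singleton x).subset ?_)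
    intro y h
    by_contra hne
    exact not_subsingleton_iff_nontrivial.2 h ⟨fun a b ↦ (hy y hne a).trans (hy y hne b).symm⟩
  have hF := freeOn_free q (V := V) (hV := hV) hrad
  let w : V x := fun _ ↦ 1
  have hw (v : V x) : v = v ⟨rfl⟩ • w := funext fun ⟨_⟩ ↦ (mul_one _).symm
  refine ⟨free q V hV, freeGen q V hV x w, fun N n ↦ ?_, fun b hb ↦ hF.isIso_of_sub_mem hrad b
    fun y v ↦ ?_⟩
  · obtain ⟨f, hf⟩ := hF.exists_hom_at (N := N) x
      ((LinearMap.toSpanSingleton k _ n) ∘ₗ LinearMap.proj (⟨rfl⟩ : PLift (x = x)))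
    refine ⟨f, ?_⟩
    rw [hf]
    exact one_smul k n
  · by_cases h : y = x
    · subst h
      rw [hw v, map_smul, map_smul, ← smul_sub]
      exact Submodule.smul_mem _ _ hb
    · rw [hy y h v, map_zero, map_zero, sub_zero]
      exact zero_mem _

end Radical

section Contract

variable {C : Type*} [Category* C] [Preadditive C]

/-- A contraction `h` of part of a complex (`h d h = h` and `h h = 0`) gives a null-homotopic
idempotent `d h + h d`. -/
lemma exists_nullHomotopic_idempotent {K : CochainComplex C ℤ} (h : ∀ i j, K.X i ⟶ K.X j)
    (h₁ : ∀ i j, i = j + 1 → h i j ≫ K.d j i ≫ h i j = h i j)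
    (h₂ : ∀ i j l, i = j + 1 → j = l + 1 → h i j ≫ h j l = 0) :
    ∃ e : K ⟶ K, e ≫ e = e ∧ Nonempty (Homotopy e 0) ∧
      ∀ m, e.f m = K.d m (m + 1) ≫ h (m + 1) m + h m (m - 1) ≫ K.d (m - 1) m := by
  let H : ∀ i j, (ComplexShape.up ℤ).Rel j i → (K.X i ⟶ K.X j) := fun i j _ ↦ h i j
  have hf (m : ℤ) : (Homotopy.nullHomotopicMap' H).f m =
      K.d m (m + 1) ≫ h (m + 1) m + h m (m - 1) ≫ K.d (m - 1) m :=
    Homotopy.nullHomotopicMap'_f (k₂ := m - 1) (k₁ := m) (k₀ := m + 1) (by simp) (by simp) H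
  refine ⟨Homotopy.nullHomotopicMap' H, ?_, ⟨Homotopy.nullHomotopy' H⟩, hf⟩
  ext m
  rw [HomologicalComplex.comp_f, hf]
  have e₁ := h₁ (m + 1) m rfl
  have e₂ := h₁ m (m - 1) (by omega)
  have e₃ := h₂ (m + 1) m (m - 1) rfl (by omega)
  simp only [Preadditive.add_comp, Preadditive.comp_add, Category.assoc, e₁, reassoc_of% e₂,
    reassoc_of% e₃, zero_comp, comp_zero, HomologicalComplex.d_comp_d_assoc, add_zero, zero_add]

end Contract

section Minimal

variable {Q : Type w} [Quiver.{t} Q] {k : Type v} [Field k] [IsAlgClosed k] {A : Type u}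
  [Category.{v} A] [Preadditive A] [Linear k A] [IsLofd A k] {q : QuiverOf k A Q}
  [HasDerivedCategory.{s} (FDMod k A)]

open DerivedCategory

/-- If a differential of a complex of projectives does not map to the radical, then a contractible
direct summand `A^x ⟶ A^x` can be split off. -/
lemma exists_smaller (hrad : RadicalSquareZero A) {K : CochainComplex (FDMod k A) ℤ}
    (hK : ∀ m, Projective (K.X m)) {m m' : ℤ} {x : Q} (v : ev q (K.X m) x)
    (hv : evMap q (K.d m m') x v ∉ modRad q (K.X m') x) :
    ∃ (L : CochainComplex (FDMod k A) ℤ) (i : L ⟶ K) (p : K ⟶ L), i ≫ p = 𝟙 L ∧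
      IsIso (DerivedCategory.Q.map p) ∧ v ≠ 0 ∧ evMap q (p.f m) x v = 0 := by
  have hm : m + 1 = m' := by
    by_contra h
    rw [K.shape m m' h] at hv
    exact hv (zero_mem _)
  subst hm
  have hv0 : v ≠ 0 := by
    rintro rfl
    rw [map_zero] at hv
    exact hv (zero_mem _)
  obtain ⟨F, g, hg, hiso⟩ := exists_point hrad q x
  obtain ⟨a, ha⟩ := hg _ v
  -- a morphism to `A^x` that takes `d v` to the generator, modulo the radical; then `a d r'` is
  -- invertible
  obtain ⟨r', hr'⟩ : ∃ r' : K.X (m + 1) ⟶ F,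
      evMap q r' x (evMap q (K.d m (m + 1)) x v) - g ∈ modRad q F x := by
    have := hK (m + 1)
    have hfree := freeOn_top hrad q (K.X (m + 1))
    set w := evMap q (K.d m (m + 1)) x v
    have hw : topMk q _ x w ≠ 0 := fun h ↦ hv ((topMk_eq_zero q).1 h)
    obtain ⟨φ, hφ⟩ := Module.Projective.exists_dual_ne_zero k hw
    obtain ⟨r', hr'⟩ := hfree.exists_hom_at x
      (LinearMap.toSpanSingleton k _ ((φ (topMk q _ x w))⁻¹ • g) ∘ₗ φ)
    refine ⟨r', ?_⟩
    have h1 : w - topSec q _ x (topMk q _ x w) ∈ modRad q _ x := by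
      rw [← topMk_eq_zero, map_sub, topMk_topSec, sub_self]
    have h2 := evMap_mem_modRad r' h1
    rw [map_sub, hr', LinearMap.comp_apply, LinearMap.toSpanSingleton_apply,
      smul_inv_smul₀ hφ] at h2
    exact h2
  have hb := hiso (a ≫ K.d m (m + 1) ≫ r') (by
    rw [evMap_comp, evMap_comp, LinearMap.comp_apply, LinearMap.comp_apply, ha]
    exact hr')
  let r : K.X (m + 1) ⟶ F := r' ≫ inv (a ≫ K.d m (m + 1) ≫ r')
  have har : a ≫ K.d m (m + 1) ≫ r = 𝟙 F := by
    have := IsIso.hom_inv_id (a ≫ K.d m (m + 1) ≫ r')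
    simpa only [Category.assoc] using this
  classical
  -- the contraction of the summand `A^x ⟶ A^x`, concentrated in degree `m + 1`
  let h (i j : ℤ) : K.X i ⟶ K.X j :=
    if hij : i = m + 1 ∧ j = m then
      eqToHom (by rw [hij.1]) ≫ r ≫ a ≫ eqToHom (by rw [hij.2]) else 0
  have hself : h (m + 1) m = r ≫ a := by
    simp only [h, and_self, dif_pos, eqToHom_refl, Category.comp_id, Category.id_comp]
  have hzero (i j : ℤ) (hij : ¬ (i = m + 1 ∧ j = m)) : h i j = 0 := dif_neg hij
  obtain ⟨e, he, ⟨hom⟩, hf⟩ := exists_nullHomotopic_idempotent h (fun i j _ ↦ by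
    by_cases hij : i = m + 1 ∧ j = m
    · obtain ⟨rfl, rfl⟩ := hij
      rw [hself]
      simp only [Category.assoc]
      rw [reassoc_of% har]
    · rw [hzero i j hij, zero_comp]) (fun i j l _ _ ↦ by
    by_cases hij : i = m + 1 ∧ j = m
    · rw [hzero j l (by omega), comp_zero]
    · rw [hzero i j hij, zero_comp])
  obtain ⟨L, i, p, hip, hpi, hp⟩ := exists_retract_of_nullHomotopic e he hom
  refine ⟨L, i, p, hip, hp, hv0, ?_⟩
  have h1 : evMap q (e.f m) x v = v := by
    rw [hf, hzero m (m - 1) (by omega), zero_comp, add_zero, hself, ← ha, ← LinearMap.comp_apply,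
      ← evMap_comp]
    have : a ≫ K.d m (m + 1) ≫ r ≫ a = a := by
      have := har =≫ a
      simpa only [Category.assoc, Category.id_comp] using this
    rw [this]
  have h2 : p.f m ≫ i.f m ≫ p.f m = p.f m := by
    rw [← HomologicalComplex.comp_f, hip, HomologicalComplex.id_f, Category.comp_id]
  have h3 : evMap q (p.f m ≫ i.f m) x v = 0 := by
    rw [← HomologicalComplex.comp_f, hpi, HomologicalComplex.sub_f_apply, HomologicalComplex.id_f,
      evMap_sub, LinearMap.sub_apply, h1, evMap_id, LinearMap.id_apply, sub_self]
  rw [← h2, ← Category.assoc, evMap_comp, LinearMap.comp_apply, h3, map_zero]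

/-- Each bounded complex of projectives is isomorphic, in the derived category, to one with
radical differentials. -/
lemma exists_radical (hrad : RadicalSquareZero A) (q : QuiverOf k A Q)
    {K : CochainComplex (FDMod k A) ℤ} (hK : IsBddProj K) :
    ∃ L : CochainComplex (FDMod k A) ℤ, IsBddProj L ∧
      Nonempty (DerivedCategory.Q.obj K ≅ DerivedCategory.Q.obj L) ∧
      ∀ m m' x p, evMap q (L.d m m') x p ∈ modRad q (L.X m') x := by
  obtain ⟨a, ha⟩ := hK.isStrictlyGE
  obtain ⟨b, hb⟩ := hK.isStrictlyLE
  obtain ⟨T, hT⟩ : ∃ T : Finset (Σ _ : ℤ, Q),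
      ∀ m x, Nontrivial (ev q (K.X m) x) → ⟨m, x⟩ ∈ T := by
    classical
    refine ⟨(Finset.Icc a b).sigma fun m ↦ (finite_support q (K.X m)).toFinset,
      fun m x h ↦ ?_⟩
    have hz : ¬ IsZero (K.X m) := fun hz ↦ by
      have h0 := (IsZero.iff_id_eq_zero _).1 hz
      refine not_subsingleton_iff_nontrivial.2 h ⟨fun p p' ↦ ?_⟩
      have h1 (p : ev q (K.X m) x) : p = 0 := by
        have := congrArg (fun f ↦ evMap q f x p) h0
        exact this
      rw [h1 p, h1 p']
    simp only [Finset.mem_sigma, Finset.mem_Icc, Set.Finite.mem_toFinset]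
    refine ⟨⟨?_, ?_⟩, h⟩
    · by_contra hm
      exact hz (K.isZero_of_isStrictlyGE a m (by omega))
    · by_contra hm
      exact hz (K.isZero_of_isStrictlyLE b m (by omega))
  clear ha hb
  -- splitting off a contractible summand lowers the total dimension at the vertices
  induction hn : ∑ j ∈ T, Module.finrank k (ev q (K.X j.1) j.2) using Nat.strong_induction_on
    generalizing K with
  | _ n ih =>
    by_cases hd : ∀ m m' x p, evMap q (K.d m m') x p ∈ modRad q (K.X m') x
    · exact ⟨K, hK, ⟨Iso.refl _⟩, hd⟩
    push Not at hd
    obtain ⟨m, m', x, v, hv⟩ := hd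
    obtain ⟨L, i, p, hip, hp, hv0, hpv⟩ := exists_smaller hrad hK.projective v hv
    have hip' (l : ℤ) (y : Q) (c) : evMap q (p.f l) y (evMap q (i.f l) y c) = c := by
      rw [← LinearMap.comp_apply, ← evMap_comp, ← HomologicalComplex.comp_f, hip,
        HomologicalComplex.id_f]
      rfl
    have hL := hK.of_retract i p hip
    obtain ⟨L', hL', ⟨e⟩, hd'⟩ := ih _ (by
      rw [← hn]
      refine Finset.sum_lt_sum (fun j _ ↦ ?_) ⟨⟨m, x⟩, hT m x ⟨_, _, hv0⟩, ?_⟩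
      · exact LinearMap.finrank_le_finrank_of_injective
          (Function.LeftInverse.injective (hip' j.1 j.2))
      · rw [← LinearMap.finrank_range_of_inj (Function.LeftInverse.injective (hip' m x))]
        refine Submodule.finrank_lt fun htop ↦ hv0 ?_
        obtain ⟨c, hc⟩ : v ∈ LinearMap.range (evMap q (i.f m) x) := htop ▸ Submodule.mem_top
        rw [← hc, ← hip' m x c, hc, hpv, map_zero]) hL
      (fun m x h ↦ hT m x (Function.LeftInverse.injective (hip' m x)).nontrivial) rfl
    exact ⟨L', hL', ⟨asIso (DerivedCategory.Q.map p) ≪≫ e⟩, hd'⟩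

end Minimal

/-! ### Morphisms of complexes and of graded representations -/

section Lifts

variable {k : Type v} [Field k] {Q : Type w} [Quiver.{t} Q]

instance : Category (GrRep k Q) where
  Hom := GrRep.Hom
  id W := ⟨fun _ _ ↦ LinearMap.id, fun _ _ _ _ _ ↦ rfl⟩
  comp φ ψ := ⟨fun x m ↦ ψ.app x m ∘ₗ φ.app x m, fun α m m' h v ↦ by
    rw [LinearMap.comp_apply, φ.comm, ψ.comm, LinearMap.comp_apply]⟩

namespace GrRep

@[ext]
lemma hom_ext {W W' : GrRep k Q} {φ ψ : W ⟶ W'} (h : ∀ x m v, φ.app x m v = ψ.app x m v) :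
    φ = ψ :=
  Hom.ext (funext fun x ↦ funext fun m ↦ LinearMap.ext fun v ↦ h x m v)

@[simp] lemma id_app (W : GrRep k Q) (x : Q) (m : ℤ) (v : W.obj x m) :
    Hom.app (𝟙 W) x m v = v := rfl

@[simp] lemma comp_app {W W' W'' : GrRep k Q} (φ : W ⟶ W') (ψ : W' ⟶ W'') (x : Q) (m : ℤ)
    (v : W.obj x m) : (φ ≫ ψ).app x m v = ψ.app x m (φ.app x m v) := rfl

lemma injective_of_iso {W W' : GrRep k Q} (e : W ≅ W') (x : Q) (m : ℤ) :
    Function.Injective (e.hom.app x m) :=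
  Function.LeftInverse.injective (g := e.inv.app x m) fun v ↦ by
    rw [← comp_app, e.hom_inv_id, id_app]

end GrRep

variable {A : Type u} [Category.{v} A] [Preadditive A] [Linear k A] [IsLofd A k]
  {q : QuiverOf k A Q}

namespace Model

variable {K K' K'' : CochainComplex (FDMod k A) ℤ} {W W' W'' : GrRep k Q}

/-- The morphism `f` of complexes induces `φ` on the generators, modulo the radicals. -/
def Lifts (S : Model q K W) (S' : Model q K' W') (f : K ⟶ K') (φ : W ⟶ W') : Prop :=
  ∀ x m v, evMap q (f.f m) x (S.s x m v) - S'.s x m (φ.app x m v) ∈ modRad q (K'.X m) x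

variable {S : Model q K W} {S' : Model q K' W'} {S'' : Model q K'' W''}

lemma Lifts.comp {f : K ⟶ K'} {φ : W ⟶ W'} {g : K' ⟶ K''} {ψ : W' ⟶ W''}
    (hf : Lifts S S' f φ) (hg : Lifts S' S'' g ψ) : Lifts S S'' (f ≫ g) (φ ≫ ψ) := by
  intro x m v
  have h := add_mem (evMap_mem_modRad (g.f m) (hf x m v)) (hg x m (φ.app x m v))
  rw [map_sub, sub_add_sub_cancel] at h
  rwa [HomologicalComplex.comp_f, evMap_comp, LinearMap.comp_apply, GrRep.comp_app]

lemma Lifts.id (S : Model q K W) : Lifts S S (𝟙 K) (𝟙 W) := by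
  intro x m v
  rw [HomologicalComplex.id_f, evMap_id, LinearMap.id_apply, GrRep.id_app, sub_self]
  exact zero_mem _

lemma Lifts.eq_of_homotopy (hrad : RadicalSquareZero A) {f g : K ⟶ K'} {φ ψ : W ⟶ W'}
    (hf : Lifts S S' f φ) (hg : Lifts S S' g ψ) (h : Homotopy f g) : φ = ψ := by
  ext x m v
  refine (S'.free m).eq_of_sub_mem ?_
  have := add_mem (sub_mem (sub_mem_of_homotopy hrad S S' h x m (S.s x m v)) (hf x m v)) (hg x m v)
  convert this using 1
  abel

lemma lifts_of_eq {f : K ⟶ K'} {φ : W ⟶ W'}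
    (h : ∀ x m v, evMap q (f.f m) x (S.s x m v) = S'.s x m (φ.app x m v)) : Lifts S S' f φ := by
  intro x m v
  rw [h, sub_self]
  exact zero_mem _

lemma exists_lifts (hrad : RadicalSquareZero A) (S : Model q K W) (S' : Model q K' W')
    (f : K ⟶ K') : ∃ φ : W ⟶ W', Lifts S S' f φ :=
  exists_grHom hrad S S' f

lemma evMap_mem_of_generators {f : K ⟶ K} (S : Model q K W)
    (h : ∀ x m v, evMap q (f.f m) x (S.s x m v) ∈ modRad q (K.X m) x) (x : Q) (m : ℤ)
    (p : ev q (K.X m) x) : evMap q (f.f m) x p ∈ modRad q (K.X m) x := by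
  obtain ⟨v, hv⟩ := (S.free m).exists_sub_mem x p
  have := add_mem (evMap_mem_modRad (f.f m) hv) (h x m v)
  rwa [map_sub, sub_add_cancel] at this

/-- The square of an endomorphism that is zero modulo the radical vanishes. -/
lemma comp_self_eq_zero (hrad : RadicalSquareZero A) (S : Model q K W) {f : K ⟶ K}
    (h : ∀ x m v, evMap q (f.f m) x (S.s x m v) ∈ modRad q (K.X m) x) : f ≫ f = 0 := by
  refine S.hom_ext hrad fun x m v ↦ ?_
  obtain ⟨u, hu⟩ := h x m v
  rw [HomologicalComplex.comp_f, evMap_comp, LinearMap.comp_apply, ← hu, evMap_asm]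
  refine (asm_eq_zero hrad fun p ↦ S.evMap_mem_of_generators h p.1 m _).trans ?_
  rw [HomologicalComplex.zero_f, evMap_zero, LinearMap.zero_apply]

/-- Isomorphic graded representations have isomorphic complexes. -/
lemma nonempty_iso (hrad : RadicalSquareZero A) (S : Model q K W) (S' : Model q K' W')
    (e : W ≅ W') : Nonempty (K ≅ K') := by
  obtain ⟨f, hf⟩ := exists_hom hrad S S' e.hom
  obtain ⟨g, hg⟩ := exists_hom hrad S' S e.inv
  refine ⟨⟨f, g, S.hom_ext hrad fun x m v ↦ ?_, S'.hom_ext hrad fun x m v ↦ ?_⟩⟩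
  · rw [HomologicalComplex.comp_f, evMap_comp, LinearMap.comp_apply, hf, hg, ← GrRep.comp_app,
      e.hom_inv_id, GrRep.id_app, HomologicalComplex.id_f, evMap_id, LinearMap.id_apply]
  · rw [HomologicalComplex.comp_f, evMap_comp, LinearMap.comp_apply, hg, hf, ← GrRep.comp_app,
      e.inv_hom_id, GrRep.id_app, HomologicalComplex.id_f, evMap_id, LinearMap.id_apply]

variable [HasDerivedCategory.{s} (FDMod k A)]

/-- Complexes that are isomorphic in the derived category have isomorphic graded
representations. -/
lemma nonempty_grIso (hrad : RadicalSquareZero A) (S : Model q K W) (S' : Model q K' W')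
    (hK : IsBddProj K) (hK' : IsBddProj K')
    (e : DerivedCategory.Q.obj K ≅ DerivedCategory.Q.obj K') : Nonempty (W ≅ W') := by
  obtain ⟨f, hf⟩ := hK.exists_map e.hom
  obtain ⟨g, hg⟩ := hK'.exists_map e.inv
  obtain ⟨φ, hφ⟩ := exists_lifts hrad S S' f
  obtain ⟨ψ, hψ⟩ := exists_lifts hrad S' S g
  obtain ⟨h₁⟩ := hK.homotopy (f := f ≫ g) (g := 𝟙 K) (by simp [hf, hg])
  obtain ⟨h₂⟩ := hK'.homotopy (f := g ≫ f) (g := 𝟙 K') (by simp [hf, hg])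
  exact ⟨⟨φ, ψ, (hφ.comp hψ).eq_of_homotopy hrad (.id S) h₁,
    (hψ.comp hφ).eq_of_homotopy hrad (.id S') h₂⟩⟩

/-- A complex with a model that is zero in the derived category is zero. -/
lemma subsingleton_of_isZero (hrad : RadicalSquareZero A) (S : Model q K W) (hK : IsBddProj K)
    (h : IsZero (DerivedCategory.Q.obj K)) (x : Q) (m : ℤ) : Subsingleton (W.obj x m) := by
  obtain ⟨H⟩ := hK.homotopy (f := 𝟙 K) (g := 0) (h.eq_of_src _ _)
  refine subsingleton_of_forall_eq 0 fun v ↦ (S.free m).eq_zero_of_mem x v ?_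
  have := sub_mem_of_homotopy hrad S S H x m (S.s x m v)
  rwa [HomologicalComplex.id_f, evMap_id, LinearMap.id_apply, HomologicalComplex.zero_f,
    evMap_zero, LinearMap.zero_apply, sub_zero] at this

lemma isZero_of_subsingleton (hrad : RadicalSquareZero A) (S : Model q K W)
    (h : ∀ x m, Subsingleton (W.obj x m)) : IsZero (DerivedCategory.Q.obj K) := by
  refine DerivedCategory.Q.map_isZero ((IsZero.iff_id_eq_zero _).2 (S.hom_ext hrad fun x m v ↦ ?_))
  have := h x m
  rw [Subsingleton.elim v 0, map_zero, map_zero, map_zero]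

/-- If the graded representation has no nontrivial idempotent endomorphisms, then neither has its
complex, as an object of the derived category: if an idempotent `e` is zero on the graded
representation, then it is represented by a morphism with square zero, so that `e = e ≫ e = 0`, and
if it is the identity there, then the same holds for `1 - e`. -/
lemma eq_zero_or_id (hrad : RadicalSquareZero A) (S : Model q K W) (hK : IsBddProj K)
    (hW : ∀ φ : W ⟶ W, φ ≫ φ = φ → (∀ x m v, φ.app x m v = 0) ∨ φ = 𝟙 W)
    (e : DerivedCategory.Q.obj K ⟶ DerivedCategory.Q.obj K) (he : e ≫ e = e) :
    e = 0 ∨ e = 𝟙 _ := by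
  obtain ⟨f, rfl⟩ := hK.exists_map e
  obtain ⟨φ, hφ⟩ := exists_lifts hrad S S f
  obtain ⟨h⟩ := hK.homotopy (f := f ≫ f) (g := f) (by rw [Functor.map_comp, he])
  rcases hW φ ((hφ.comp hφ).eq_of_homotopy hrad hφ h) with h0 | h1
  · left
    have : f ≫ f = 0 := S.comp_self_eq_zero hrad fun x m v ↦ by
      have := hφ x m v
      rwa [h0, map_zero, sub_zero] at this
    rw [← he, ← Functor.map_comp, this, Functor.map_zero]
  · right
    have : (𝟙 K - f) ≫ (𝟙 K - f) = 0 := S.comp_self_eq_zero hrad fun x m v ↦ by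
      have := neg_mem (hφ x m v)
      rwa [h1, GrRep.id_app, neg_sub] at this
    have h2 := congrArg DerivedCategory.Q.map this
    simp only [Functor.map_comp, Functor.map_sub, CategoryTheory.Functor.map_id, Functor.map_zero,
      Preadditive.comp_sub, Preadditive.sub_comp, Category.id_comp, Category.comp_id, he,
      sub_self, sub_zero] at h2
    exact (sub_eq_zero.1 h2).symm

/-- If a complex with a graded representation `W` is indecomposable in the derived category, then
`W` has no nontrivial idempotent endomorphisms. -/
lemma eq_id_of_indecomposable (hrad : RadicalSquareZero A) (S : Model q K W) (hK : IsBddProj K)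
    {X : DerivedCategory.Bounded (FDMod k A)} (hX : Indecomposable X)
    (e : X.obj ≅ DerivedCategory.Q.obj K) (φ : W ⟶ W) (hφ : φ ≫ φ = φ) :
    (∀ x m v, φ.app x m v = 0) ∨ φ = 𝟙 W := by
  obtain ⟨f, hf⟩ := exists_hom hrad S S φ
  have hff : f ≫ f = f := S.hom_ext hrad fun x m v ↦ by
    rw [HomologicalComplex.comp_f, evMap_comp, LinearMap.comp_apply, hf, hf, ← GrRep.comp_app, hφ]
  obtain ⟨L, i, p, hi, hp⟩ := IsIdempotentComplete.idempotents_split K f hff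
  rcases isZero_or_isIso_of_retract hX hK i p hi e with h | h
  · left
    obtain ⟨H⟩ := hK.homotopy (f := f) (g := 0) (by
      rw [← hp, Functor.map_comp, h.eq_of_src (DerivedCategory.Q.map i) 0, comp_zero,
        Functor.map_zero])
    intro x m v
    refine (S.free m).eq_zero_of_mem x _ ?_
    have := sub_mem_of_homotopy hrad S S H x m (S.s x m v)
    rwa [hf, HomologicalComplex.zero_f, evMap_zero, LinearMap.zero_apply, sub_zero] at this
  · right
    obtain ⟨H⟩ := hK.homotopy (f := f) (g := 𝟙 K) (by
      rw [← cancel_epi (DerivedCategory.Q.map i), ← hp, ← Functor.map_comp, reassoc_of% hi,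
        CategoryTheory.Functor.map_id, Category.comp_id])
    exact (lifts_of_eq hf).eq_of_homotopy hrad (.id S) H

end Model

end Lifts

/-! ### The height of a vertex -/

section Height

variable {Q : Type w} [Quiver.{t} Q] {base : Quiver.WeaklyConnectedComponent Q → Q}

lemma mem_zeroPart_iff_of_hom {v w : Box Q} (f : v ⟶ w) :
    v ∈ zeroPart base ↔ w ∈ zeroPart base := by
  refine ⟨fun ⟨c, hc⟩ ↦ ⟨c, (mk_eq_of_hom f).symm.trans hc⟩, mem_zeroPart_of_hom f⟩

lemma exists_mem_zeroPart (hbase : ∀ c, Quiver.WeaklyConnectedComponent.mk (base c) = c) (x : Q) :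
    ∃ n : ℤ, (⟨x, n⟩ : Box Q) ∈ zeroPart base := by
  have key {a : Quiver.Symmetrify Q} (ha : ∃ n : ℤ, (⟨a, n⟩ : Box Q) ∈ zeroPart base) :
      ∀ {b : Quiver.Symmetrify Q}, Quiver.Path a b →
        ∃ n : ℤ, (⟨b, n⟩ : Box Q) ∈ zeroPart base := by
    intro b p
    induction p with
    | nil => exact ha
    | @cons b c p α ih =>
      obtain ⟨n, hn⟩ := ih
      rcases α with α | α
      · let f : (⟨c, n + 1⟩ : Box Q) ⟶ ⟨b, n⟩ := ⟨α, by simp⟩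
        exact ⟨n + 1, (mem_zeroPart_iff_of_hom f).2 hn⟩
      · let f : (⟨b, n⟩ : Box Q) ⟶ ⟨c, n - 1⟩ := ⟨α, rfl⟩
        exact ⟨n - 1, (mem_zeroPart_iff_of_hom f).1 hn⟩
  obtain ⟨p⟩ := (Quiver.WeaklyConnectedComponent.eq _ _).1
    (hbase (Quiver.WeaklyConnectedComponent.mk x))
  exact key ⟨0, _, rfl⟩ p

/-- The height of a vertex `x`: the number `m` with `(x, -m) ∈ Q[0]`, that is, the cohomological
degree in which `F(ı M)` contains `A^x ⊗ M x`. -/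
def height (hbase : ∀ c, Quiver.WeaklyConnectedComponent.mk (base c) = c) (x : Q) : ℤ :=
  -(exists_mem_zeroPart hbase x).choose

variable (hwalk : WalkCondition Q) (hbase : ∀ c, Quiver.WeaklyConnectedComponent.mk (base c) = c)

include hwalk in
lemma mem_zeroPart_iff {x : Q} {m : ℤ} :
    (⟨x, -m⟩ : Box Q) ∈ zeroPart base ↔ m = height hbase x := by
  have h0 := (exists_mem_zeroPart hbase x).choose_spec
  constructor
  · intro h
    have h1 : -m = (exists_mem_zeroPart hbase x).choose :=
      deg_eq_of_mem_zeroPart hwalk hbase h h0 rfl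
    rw [height, ← h1, neg_neg]
  · rintro rfl
    rwa [height, neg_neg]

include hwalk in
/-- The height increases by one along each arrow of `Q^op`. -/
lemma height_eq {x y : Q} (α : x ⟶ y) : height hbase y + 1 = height hbase x := by
  let f : (⟨y, -height hbase y⟩ : Box Q) ⟶ ⟨x, -(height hbase y + 1)⟩ := ⟨α, by
    change -(height hbase y + 1) = -height hbase y - 1
    ring⟩
  rw [← mem_zeroPart_iff hwalk hbase, ← mem_zeroPart_iff_of_hom f, mem_zeroPart_iff hwalk hbase]

end Height

/-! ### Representations of `Q^op` as graded representations -/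

section Rep

variable {k : Type v} [Field k] {Q : Type w} [Quiver.{t} Q]

/-- The value of a representation of `Q^op` at a vertex. -/
abbrev opObj (M : FinRep k Qᵒᵖ) (x : Q) : ModuleCat.{v} k :=
  M.obj.obj ((Paths.of Qᵒᵖ).obj (.op x))

/-- The action of the opposite of an arrow. -/
abbrev opMap (M : FinRep k Qᵒᵖ) {x y : Q} (α : x ⟶ y) : opObj M y →ₗ[k] opObj M x :=
  (M.obj.map ((Paths.of Qᵒᵖ).map α.op)).hom

/-- The component of a morphism at a vertex. -/
abbrev opApp {M N : FinRep k Qᵒᵖ} (f : M ⟶ N) (x : Q) : opObj M x →ₗ[k] opObj N x :=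
  (f.hom.app ((Paths.of Qᵒᵖ).obj (.op x))).hom

lemma opApp_opMap {M N : FinRep k Qᵒᵖ} (f : M ⟶ N) {x y : Q} (α : x ⟶ y) (v : opObj M y) :
    opApp f x (opMap M α v) = opMap N α (opApp f y v) :=
  ConcreteCategory.congr_hom (f.hom.naturality ((Paths.of Qᵒᵖ).map α.op)) v

lemma finRep_hom_ext {M N : FinRep k Qᵒᵖ} {f g : M ⟶ N} (h : ∀ x v, opApp f x v = opApp g x v) :
    f = g := by
  apply ObjectProperty.hom_ext
  ext x v
  exact h x.unop v

/-- Linear maps that commute with the arrows form a morphism of representations. -/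
lemma exists_finRep_hom {M N : FinRep k Qᵒᵖ} (φ : ∀ x, opObj M x →ₗ[k] opObj N x)
    (hφ : ∀ {x y : Q} (α : x ⟶ y) v, φ x (opMap M α v) = opMap N α (φ y v)) :
    ∃ f : M ⟶ N, ∀ x v, opApp f x v = φ x v :=
  ⟨ObjectProperty.homMk (Paths.liftNatTrans (fun x ↦ ModuleCat.ofHom (φ x.unop)) fun {x y} α ↦ by
    ext v
    exact hφ α.unop v), fun _ _ ↦ rfl⟩

lemma isZero_finRep {M : FinRep k Qᵒᵖ} (h : ∀ x, Subsingleton (opObj M x)) : IsZero M := by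
  rw [IsZero.iff_id_eq_zero]
  refine finRep_hom_ext fun x v ↦ ?_
  have := h x
  exact Subsingleton.elim _ _

instance : IsIdempotentComplete (FinRep k Qᵒᵖ) where
  idempotents_split M e he := by
    obtain ⟨Y, i, p, hi, hp⟩ := IsIdempotentComplete.idempotents_split M.obj e.hom
      (congrArg (fun f ↦ f.hom) he)
    have hY : finRep k Qᵒᵖ Y :=
      IsFinRep.of_sum i (0 : Y ⟶ M.obj) p 0 (by rw [hi, comp_zero, add_zero]) M.property M.property
    exact ⟨⟨Y, hY⟩, ObjectProperty.homMk i, ObjectProperty.homMk p,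
      ObjectProperty.hom_ext _ hi, ObjectProperty.hom_ext _ hp⟩

variable (hwalk : WalkCondition Q) {base : Quiver.WeaklyConnectedComponent Q → Q}
  (hbase : ∀ c, Quiver.WeaklyConnectedComponent.mk (base c) = c)

/-- The graded representation of the complex `F(ı M)[i]`. -/
abbrev grRep (i : ℤ) (M : FinRep k Qᵒᵖ) : GrRep k Q :=
  (GrRep.ofBox (extend hwalk base hbase M)).shift i

lemma subsingleton_grRep {i : ℤ} (M : FinRep k Qᵒᵖ) {x : Q} {m : ℤ} (h : m + i ≠ height hbase x) :
    Subsingleton ((grRep hwalk hbase i M).obj x m) :=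
  ⟨fun _ _ ↦ funext fun hx ↦ (h ((mem_zeroPart_iff hwalk hbase).1 hx.down)).elim⟩

/-- The graded representation takes the value `M x` at `x` in degree `height x - i`. -/
def grRepEquiv {i : ℤ} (M : FinRep k Qᵒᵖ) {x : Q} {m : ℤ} (h : m + i = height hbase x) :
    (grRep hwalk hbase i M).obj x m ≃ₗ[k] opObj M x :=
  have : Unique (PLift ((⟨x, -(m + i)⟩ : Box Q) ∈ zeroPart base)) :=
    { default := ⟨(mem_zeroPart_iff hwalk hbase).2 h⟩, uniq _ := rfl }
  LinearEquiv.funUnique (PLift ((⟨x, -(m + i)⟩ : Box Q) ∈ zeroPart base)) k (opObj M x)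

lemma grRepEquiv_map {i : ℤ} (M : FinRep k Qᵒᵖ) {x y : Q} (α : x ⟶ y) {m m' : ℤ} (h : m + 1 = m')
    (v : (grRep hwalk hbase i M).obj y m) (hx : m' + i = height hbase x)
    (hy : m + i = height hbase y) :
    grRepEquiv hwalk hbase M hx ((grRep hwalk hbase i M).map α m m' h v) =
      opMap M α (grRepEquiv hwalk hbase M hy v) := by
  let f : (⟨y, -(m + i)⟩ : Box Q) ⟶ ⟨x, -(m' + i)⟩ := ⟨α, by
    change -(m' + i) = -(m + i) - 1
    omega⟩
  have h1 : (extendFunctor base M.obj).map ((Paths.of (Box Q)).map f) = _ := Paths.lift_toPath _ f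
  exact congrFun (ConcreteCategory.congr_hom h1 v) ⟨(mem_zeroPart_iff hwalk hbase).2 hx⟩

lemma grRep_ext {i : ℤ} {M : FinRep k Qᵒᵖ} {x : Q} {m : ℤ}
    {v v' : (grRep hwalk hbase i M).obj x m}
    (h : ∀ hx, grRepEquiv hwalk hbase M hx v = grRepEquiv hwalk hbase M hx v') : v = v' := by
  by_cases hx : m + i = height hbase x
  · exact (grRepEquiv hwalk hbase M hx).injective (h hx)
  · have := subsingleton_grRep hwalk hbase M hx
    exact Subsingleton.elim _ _

open Classical in
/-- The linear maps from the value of the graded representation that are given by a linear map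
from the value of `M`. -/
def grRepDesc {i : ℤ} (M : FinRep k Qᵒᵖ) (x : Q) (m : ℤ) {V : Type*} [AddCommGroup V] [Module k V]
    (f : m + i = height hbase x → opObj M x →ₗ[k] V) : (grRep hwalk hbase i M).obj x m →ₗ[k] V :=
  if h : m + i = height hbase x then f h ∘ₗ (grRepEquiv hwalk hbase M h).toLinearMap else 0

open Classical in
/-- The linear maps to the value of the graded representation that are given by a linear map to the
value of `M`. -/
def grRepLift {i : ℤ} (M : FinRep k Qᵒᵖ) (x : Q) (m : ℤ) {V : Type*} [AddCommGroup V] [Module k V]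
    (f : m + i = height hbase x → V →ₗ[k] opObj M x) : V →ₗ[k] (grRep hwalk hbase i M).obj x m :=
  if h : m + i = height hbase x then (grRepEquiv hwalk hbase M h).symm.toLinearMap ∘ₗ f h else 0

section

variable {i : ℤ} {M : FinRep k Qᵒᵖ} {x : Q} {m : ℤ} {V : Type*} [AddCommGroup V] [Module k V]

lemma grRepDesc_apply {f : m + i = height hbase x → opObj M x →ₗ[k] V}
    (h : m + i = height hbase x) (v : (grRep hwalk hbase i M).obj x m) :
    grRepDesc hwalk hbase M x m f v = f h (grRepEquiv hwalk hbase M h v) := by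
  rw [grRepDesc, dif_pos h]
  rfl

lemma grRepEquiv_lift {f : m + i = height hbase x → V →ₗ[k] opObj M x}
    (h : m + i = height hbase x) (v : V) :
    grRepEquiv hwalk hbase M h (grRepLift hwalk hbase M x m f v) = f h v := by
  rw [grRepLift, dif_pos h]
  exact (grRepEquiv hwalk hbase M h).apply_symm_apply _

end

/-- The morphism of graded representations that is induced by a morphism of representations. -/
def grRepMap (i : ℤ) {M N : FinRep k Qᵒᵖ} (f : M ⟶ N) :
    grRep hwalk hbase i M ⟶ grRep hwalk hbase i N where
  app x m := grRepLift hwalk hbase N x m fun _ ↦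
    grRepDesc hwalk hbase M x m fun _ ↦ opApp f x
  comm {x y} α m m' h v := by
    refine grRep_ext hwalk hbase fun hx ↦ ?_
    have hy : m + i = height hbase y := by
      have := height_eq hwalk hbase α
      omega
    rw [grRepEquiv_map hwalk hbase N α h _ hx hy, grRepEquiv_lift, grRepEquiv_lift,
      grRepDesc_apply hwalk hbase hx, grRepDesc_apply hwalk hbase hy,
      grRepEquiv_map hwalk hbase M α h _ hx hy, opApp_opMap]

lemma grRepEquiv_grRepMap {i : ℤ} {M N : FinRep k Qᵒᵖ} (f : M ⟶ N) {x : Q} {m : ℤ}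
    (h : m + i = height hbase x) (v : (grRep hwalk hbase i M).obj x m) :
    grRepEquiv hwalk hbase N h ((grRepMap hwalk hbase i f).app x m v) =
      opApp f x (grRepEquiv hwalk hbase M h v) :=
  (grRepEquiv_lift hwalk hbase h v).trans (grRepDesc_apply hwalk hbase h v)

lemma grRepMap_injective (i : ℤ) (M N : FinRep k Qᵒᵖ) :
    Function.Injective (grRepMap hwalk hbase i : (M ⟶ N) → _) := by
  intro f g hfg
  refine finRep_hom_ext fun x v ↦ ?_
  have hx : height hbase x - i + i = height hbase x := sub_add_cancel _ _
  rw [← (grRepEquiv hwalk hbase M hx).apply_symm_apply v, ← grRepEquiv_grRepMap, hfg,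
    grRepEquiv_grRepMap]

lemma grRepMap_surjective (i : ℤ) (M N : FinRep k Qᵒᵖ) :
    Function.Surjective (grRepMap hwalk hbase i : (M ⟶ N) → _) := by
  intro φ
  have hx (x : Q) : height hbase x - i + i = height hbase x := sub_add_cancel _ _
  obtain ⟨f, hf⟩ := exists_finRep_hom (M := M) (N := N)
    (fun x ↦ (grRepEquiv hwalk hbase N (hx x)).toLinearMap ∘ₗ φ.app x _ ∘ₗ
      (grRepEquiv hwalk hbase M (hx x)).symm.toLinearMap) fun {x y} α v ↦ by
    have h : height hbase y - i + 1 = height hbase x - i := by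
      have := height_eq hwalk hbase α
      omega
    obtain ⟨v, rfl⟩ := (grRepEquiv hwalk hbase M (hx y)).surjective v
    simp only [LinearMap.comp_apply, LinearEquiv.coe_coe]
    rw [← grRepEquiv_map hwalk hbase M α h v (hx x) (hx y), LinearEquiv.symm_apply_apply,
      LinearEquiv.symm_apply_apply, φ.comm, grRepEquiv_map hwalk hbase N α h _ (hx x) (hx y)]
  refine ⟨f, ?_⟩
  ext x m v
  refine grRep_ext hwalk hbase fun h ↦ ?_
  obtain rfl : m = height hbase x - i := by omega
  rw [grRepEquiv_grRepMap, hf]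
  simp

/-- The functor that takes `M` to the graded representation of the complex `F(ı M)[i]`. -/
def grRepFunctor (i : ℤ) : FinRep k Qᵒᵖ ⥤ GrRep k Q where
  obj := grRep hwalk hbase i
  map := grRepMap hwalk hbase i
  map_id M := by
    ext x m v
    exact grRep_ext hwalk hbase fun hx ↦ grRepEquiv_grRepMap hwalk hbase (𝟙 M) hx v
  map_comp f g := by
    ext x m v
    refine grRep_ext hwalk hbase fun hx ↦ ?_
    rw [GrRep.comp_app, grRepEquiv_grRepMap, grRepEquiv_grRepMap, grRepEquiv_grRepMap]
    rfl

instance (i : ℤ) : (grRepFunctor (k := k) hwalk hbase i).Faithful where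
  map_injective {M N} _ _ h := grRepMap_injective hwalk hbase i M N h

instance (i : ℤ) : (grRepFunctor (k := k) hwalk hbase i).Full where
  map_surjective {M N} := grRepMap_surjective hwalk hbase i M N

/-- Idempotents of the graded representation are idempotents of the representation, because the
functor is full and faithful. -/
lemma grRep_eq_zero_or_id (i : ℤ) {M : FinRep k Qᵒᵖ} (hM : Indecomposable M)
    (φ : grRep hwalk hbase i M ⟶ grRep hwalk hbase i M) (hφ : φ ≫ φ = φ) :
    (∀ x m v, φ.app x m v = 0) ∨ φ = 𝟙 _ := by
  obtain ⟨f, rfl⟩ := grRepMap_surjective hwalk hbase i M M φ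
  have hf : f ≫ f = f := (grRepFunctor hwalk hbase i).map_injective
    (((grRepFunctor hwalk hbase i).map_comp f f).trans hφ)
  rcases eq_zero_or_id_of_indecomposable hM f hf with rfl | rfl
  · left
    intro x m v
    refine grRep_ext hwalk hbase fun h ↦ ?_
    rw [grRepEquiv_grRepMap, map_zero]
    rfl
  · exact .inr ((grRepFunctor hwalk hbase i).map_id M)

lemma indecomposable_of_grRep (i : ℤ) {M : FinRep k Qᵒᵖ} (h0 : ¬ IsZero M)
    (h : ∀ φ : grRep hwalk hbase i M ⟶ grRep hwalk hbase i M, φ ≫ φ = φ →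
      (∀ x m v, φ.app x m v = 0) ∨ φ = 𝟙 _) : Indecomposable M := by
  refine indecomposable_of_idempotents h0 fun e he ↦ ?_
  rcases h (grRepMap hwalk hbase i e) (((grRepFunctor hwalk hbase i).map_comp e e).symm.trans
    (congrArg _ he)) with h | h
  · left
    refine finRep_hom_ext fun x v ↦ ?_
    have hx : height hbase x - i + i = height hbase x := sub_add_cancel _ _
    rw [← (grRepEquiv hwalk hbase M hx).apply_symm_apply v, ← grRepEquiv_grRepMap, h, map_zero]
    rfl
  · exact .inr ((grRepFunctor hwalk hbase i).map_injective
      (h.trans ((grRepFunctor hwalk hbase i).map_id M).symm))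

lemma exists_nontrivial_of_not_isZero {M : FinRep k Qᵒᵖ} (h : ¬ IsZero M) :
    ∃ x, Nontrivial (opObj M x) := by
  by_contra! h'
  exact h (isZero_finRep h')

/-- The shift is determined by the graded representation, which is concentrated at the places
`(x, height x - i)`. -/
lemma eq_of_grRep_iso {i j : ℤ} {M N : FinRep k Qᵒᵖ} (hM : ¬ IsZero M)
    (e : grRep hwalk hbase i M ≅ grRep hwalk hbase j N) : i = j := by
  obtain ⟨x, hx⟩ := exists_nontrivial_of_not_isZero hM
  have h : height hbase x - i + i = height hbase x := sub_add_cancel _ _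
  have h1 := (grRepEquiv hwalk hbase M h).symm.injective.nontrivial
  have h2 := (GrRep.injective_of_iso e x (height hbase x - i)).nontrivial
  by_contra hij
  have := subsingleton_grRep hwalk hbase N (x := x) (m := height hbase x - i) (i := j) (by omega)
  exact not_nontrivial _ h2

end Rep

/-! ### Components of graded representations -/

section Component

variable {k : Type v} [Field k] {Q : Type w} [Quiver.{t} Q]

namespace GrRep

/-- The identity, for two equal degrees. -/
def cast (W : GrRep k Q) (x : Q) {m m' : ℤ} (h : m = m') : W.obj x m →ₗ[k] W.obj x m' :=
  h ▸ LinearMap.id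

@[simp] lemma cast_cast (W : GrRep k Q) (x : Q) {m m' : ℤ} (h : m = m') (h' : m' = m)
    (v : W.obj x m) : W.cast x h' (W.cast x h v) = v := by
  subst h
  rfl

lemma cast_map (W : GrRep k Q) {x y : Q} (α : x ⟶ y) {m m' n n' : ℤ} (h : m + 1 = m')
    (hn : n + 1 = n') (e : m = n) (e' : m' = n') (v : W.obj y m) :
    W.cast x e' (W.map α m m' h v) = W.map α n n' hn (W.cast y e v) := by
  subst e e'
  rfl

end GrRep

variable (hwalk : WalkCondition Q) {base : Quiver.WeaklyConnectedComponent Q → Q}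
  (hbase : ∀ c, Quiver.WeaklyConnectedComponent.mk (base c) = c)

/-- The component of a graded representation in the degrees `height x - i`, as a representation of
`Q^op`. -/
lemma exists_component (W : GrRep k Q) (i : ℤ) (hfin : ∀ x m, FiniteDimensional k (W.obj x m))
    (hsupp : {x | ∃ m, Nontrivial (W.obj x m)}.Finite)
    (hα : ∀ {x y : Q}, (x ⟶ y) → height hbase y - i + 1 = height hbase x - i) :
    ∃ (M : FinRep k Qᵒᵖ) (b : ∀ x, opObj M x ≃ₗ[k] W.obj x (height hbase x - i)),
      ∀ {x y : Q} (α : x ⟶ y) (v : opObj M y), b x (opMap M α v) = W.map α _ _ (hα α) (b y v) := by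
  let F : Paths Qᵒᵖ ⥤ ModuleCat.{v} k := Paths.lift
    { obj x := W.obj x.unop (height hbase x.unop - i)
      map f := ModuleCat.ofHom (W.map f.unop _ _ (hα f.unop)) }
  have hF : IsFinRep k Qᵒᵖ F := by
    refine ⟨fun x ↦ hfin _ _, ?_⟩
    refine (hsupp.preimage (f := Opposite.unop) Opposite.unop_injective.injOn).subset ?_
    exact fun x hx ↦ ⟨_, hx⟩
  refine ⟨⟨F, hF⟩, fun x ↦ LinearEquiv.refl _ _, fun α v ↦ ?_⟩
  have h1 : F.map ((Paths.of Qᵒᵖ).map α.op) = _ := Paths.lift_toPath _ α.op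
  exact ConcreteCategory.congr_hom h1 v

include hwalk in
lemma sub_add_one_eq (i : ℤ) {x y : Q} (α : x ⟶ y) :
    height hbase y - i + 1 = height hbase x - i := by
  have := height_eq hwalk hbase α
  omega

/-- The component of a graded representation in the degrees `height x - i` is a direct summand,
which comes from a representation of `Q^op`. -/
lemma exists_retract (W : GrRep k Q) (i : ℤ)
    (hfin : ∀ x m, FiniteDimensional k (W.obj x m))
    (hsupp : {x | ∃ m, Nontrivial (W.obj x m)}.Finite) :
    ∃ (M : FinRep k Qᵒᵖ) (ι : grRep hwalk hbase i M ⟶ W) (π : W ⟶ grRep hwalk hbase i M),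
      ι ≫ π = 𝟙 _ ∧ ∀ x, Nonempty (opObj M x ≃ₗ[k] W.obj x (height hbase x - i)) := by
  have hα {x y : Q} (α : x ⟶ y) := sub_add_one_eq hwalk hbase i α
  obtain ⟨M, b, hb⟩ := exists_component hbase W i hfin hsupp hα
  let ι : grRep hwalk hbase i M ⟶ W :=
    { app x m := grRepDesc hwalk hbase M x m fun h ↦
        W.cast x (m := height hbase x - i) (m' := m) (by omega) ∘ₗ (b x).toLinearMap
      comm {x y} α m m' h v := by
        by_cases hy : m + i = height hbase y
        · have hx : m' + i = height hbase x := by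
            have := hα α
            omega
          rw [grRepDesc_apply hwalk hbase hx, grRepDesc_apply hwalk hbase hy,
            grRepEquiv_map hwalk hbase M α h v hx hy]
          simp only [LinearMap.comp_apply, LinearEquiv.coe_coe]
          rw [hb, GrRep.cast_map W α _ h (by omega) (by omega)]
        · have := subsingleton_grRep hwalk hbase M hy
          rw [Subsingleton.elim v 0, map_zero, map_zero, map_zero, map_zero] }
  let π : W ⟶ grRep hwalk hbase i M :=
    { app x m := grRepLift hwalk hbase M x m fun h ↦ (b x).symm.toLinearMap ∘ₗ
        W.cast x (m := m) (m' := height hbase x - i) (by omega)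
      comm {x y} α m m' h v := by
        refine grRep_ext hwalk hbase fun hx ↦ ?_
        have hy : m + i = height hbase y := by
          have := hα α
          omega
        rw [grRepEquiv_map hwalk hbase M α h _ hx hy, grRepEquiv_lift, grRepEquiv_lift]
        simp only [LinearMap.comp_apply, LinearEquiv.coe_coe]
        rw [LinearEquiv.symm_apply_eq, hb, LinearEquiv.apply_symm_apply,
          GrRep.cast_map W α h (hα α) (by omega) (by omega)] }
  refine ⟨M, ι, π, ?_, fun x ↦ ⟨b x⟩⟩
  ext x m v
  refine grRep_ext hwalk hbase fun hx ↦ ?_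
  change grRepEquiv hwalk hbase M hx (grRepLift hwalk hbase M x m _
    (grRepDesc hwalk hbase M x m _ v)) = _
  rw [grRepEquiv_lift, grRepDesc_apply hwalk hbase hx]
  simp only [LinearMap.comp_apply, LinearEquiv.coe_coe, GrRep.cast_cast,
    LinearEquiv.symm_apply_apply, GrRep.id_app]

end Component

/-! ### Indecomposable objects of the bounded derived category -/

section Classification

variable {k : Type v} [Field k] [IsAlgClosed k] {A : Type u} [Category.{v} A] [Preadditive A]
  [Linear k A] [IsLofd A k] (hrad : RadicalSquareZero A) {Q : Type w} [Quiver.{t} Q]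
  (q : QuiverOf k A Q)

omit [IsAlgClosed k] in
lemma finite_support_of_model {K : CochainComplex (FDMod k A) ℤ} {W : GrRep k Q}
    (S : Model q K W) (hK : IsBddProj K) : {x | ∃ m, Nontrivial (W.obj x m)}.Finite := by
  obtain ⟨a, ha⟩ := hK.isStrictlyGE
  obtain ⟨b, hb⟩ := hK.isStrictlyLE
  refine ((Set.finite_Icc a b).biUnion fun m _ ↦ finite_support q (K.X m)).subset ?_
  rintro x ⟨m, hm⟩
  have h : Nontrivial (ev q (K.X m) x) := ((S.free m).injective x).nontrivial
  have hz : ¬ IsZero (K.X m) := fun hz ↦ not_subsingleton_iff_nontrivial.2 h <|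
    subsingleton_of_forall_eq 0 fun p ↦
      congrArg (fun f ↦ evMap q f x p) ((IsZero.iff_id_eq_zero _).1 hz)
  refine Set.mem_biUnion (x := m) ⟨?_, ?_⟩ h
  · by_contra hm
    exact hz (K.isZero_of_isStrictlyGE a m (by omega))
  · by_contra hm
    exact hz (K.isZero_of_isStrictlyLE b m (by omega))

lemma isBddProj_complexF (M : FinRep k (Box Q)) : IsBddProj (complexF hrad q M) := by
  obtain ⟨N, hN⟩ := exists_bound M
  have hz (m : ℤ) (hm : N < |m|) : IsZero ((complexF hrad q M).X m) := by
    refine isZero_term q M (-m) ((hN (-m)).resolve_right ?_)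
    rw [abs_neg]
    exact not_le.2 hm
  exact ⟨(modelF q hrad M).projective hrad,
    ⟨-N, (CochainComplex.isStrictlyGE_iff _ _).2 fun m hm ↦ hz m (lt_abs.2 (.inr (by omega)))⟩,
    ⟨N, (CochainComplex.isStrictlyLE_iff _ _).2 fun m hm ↦ hz m (lt_abs.2 (.inl hm))⟩⟩

variable (hwalk : WalkCondition Q) {base : Quiver.WeaklyConnectedComponent Q → Q}
  (hbase : ∀ c, Quiver.WeaklyConnectedComponent.mk (base c) = c)

/-- The complex `F(ı M)[i]`. -/
abbrev complexG (i : ℤ) (M : FinRep k Qᵒᵖ) : CochainComplex (FDMod k A) ℤ :=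
  (complexF hrad q (extend hwalk base hbase M))⟦i⟧

lemma isBddProj_complexG (i : ℤ) (M : FinRep k Qᵒᵖ) :
    IsBddProj (complexG hrad q hwalk hbase i M) :=
  (isBddProj_complexF hrad q _).shift i

/-- The complex `F(ı M)[i]` has the graded representation of `M` as a model. -/
def modelG (i : ℤ) (M : FinRep k Qᵒᵖ) :
    Model q (complexG hrad q hwalk hbase i M) (grRep hwalk hbase i M) :=
  (modelF q hrad _).shift i

variable [HasDerivedCategory.{s} (FDMod k A)]

/-- The object `F(ı M)[i]` of the bounded derived category is given by the complex `F(ı M)[i]`. -/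
def objIso (i : ℤ) (M : FinRep k Qᵒᵖ) :
    ((objF hrad q (extend hwalk base hbase M))⟦i⟧).obj ≅
      DerivedCategory.Q.obj (complexG hrad q hwalk hbase i M) :=
  (DerivedCategory.Bounded.ι.commShiftIso i).app (objF hrad q (extend hwalk base hbase M)) ≪≫
    (DerivedCategory.Q.commShiftIso i).symm.app _

lemma not_isZero_complexG (i : ℤ) {M : FinRep k Qᵒᵖ} (hM : ¬ IsZero M) :
    ¬ IsZero (DerivedCategory.Q.obj (complexG hrad q hwalk hbase i M)) := by
  intro h
  obtain ⟨x, hx⟩ := exists_nontrivial_of_not_isZero hM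
  have h1 := (modelG hrad q hwalk hbase i M).subsingleton_of_isZero hrad
    (isBddProj_complexG hrad q hwalk hbase i M) h x (height hbase x - i)
  have h2 := (grRepEquiv hwalk hbase M (sub_add_cancel (height hbase x) i)).symm.injective.nontrivial
  exact not_nontrivial _ h2

/-- The idempotents of `F(ı M)[i]` are those of `M`. -/
lemma indecomposable_objF (i : ℤ) {M : FinRep k Qᵒᵖ} (hM : Indecomposable M) :
    Indecomposable ((objF hrad q (extend hwalk base hbase M))⟦i⟧) := by
  let ψ := objIso hrad q hwalk hbase i M
  refine indecomposable_of_idempotents (fun h ↦ not_isZero_complexG hrad q hwalk hbase i hM.1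
    ((DerivedCategory.Bounded.ι.map_isZero h).of_iso ψ.symm)) fun e he ↦ ?_
  have he' : e.hom ≫ e.hom = e.hom := congrArg (fun f ↦ f.hom) he
  rcases (modelG hrad q hwalk hbase i M).eq_zero_or_id hrad
    (isBddProj_complexG hrad q hwalk hbase i M) (grRep_eq_zero_or_id hwalk hbase i hM)
    (ψ.inv ≫ e.hom ≫ ψ.hom) (by simp [reassoc_of% he']) with h | h
  · left
    apply ObjectProperty.hom_ext
    have := ψ.hom ≫= h =≫ ψ.inv
    simpa using this
  · right
    apply ObjectProperty.hom_ext
    have := ψ.hom ≫= h =≫ ψ.inv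
    simpa using this

/-- The graded representation can be recovered from the complex, and it determines `i` and `M`. -/
lemma nonempty_iso_iff {M N : FinRep k Qᵒᵖ} (hM : Indecomposable M) (i j : ℤ) :
    Nonempty ((objF hrad q (extend hwalk base hbase M))⟦i⟧ ≅
      (objF hrad q (extend hwalk base hbase N))⟦j⟧) ↔ i = j ∧ Nonempty (M ≅ N) := by
  constructor
  · rintro ⟨e⟩
    obtain ⟨e'⟩ := (modelG hrad q hwalk hbase i M).nonempty_grIso hrad
      (modelG hrad q hwalk hbase j N) (isBddProj_complexG hrad q hwalk hbase i M)
      (isBddProj_complexG hrad q hwalk hbase j N)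
      ((objIso hrad q hwalk hbase i M).symm ≪≫ DerivedCategory.Bounded.ι.mapIso e ≪≫
        objIso hrad q hwalk hbase j N)
    obtain rfl := eq_of_grRep_iso hwalk hbase hM.1 e'
    exact ⟨rfl, ⟨(grRepFunctor hwalk hbase i).preimageIso e'⟩⟩
  · rintro ⟨rfl, ⟨e⟩⟩
    obtain ⟨e'⟩ := (modelG hrad q hwalk hbase i M).nonempty_iso hrad
      (modelG hrad q hwalk hbase i N) ((grRepFunctor hwalk hbase i).mapIso e)
    exact ⟨DerivedCategory.Bounded.ι.preimageIso (objIso hrad q hwalk hbase i M ≪≫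
      DerivedCategory.Q.mapIso e' ≪≫ (objIso hrad q hwalk hbase i N).symm)⟩

/-- An indecomposable object is given by a radical complex of projectives, hence by a graded
representation; a nonzero component of the latter comes from a representation `M` of `Q^op`, and it
gives a direct summand `F(ı M)[i]`. -/
lemma exists_iso_objF (hpath : ¬ ∃ x : ℕ → Q, ∀ n, Nonempty (x n ⟶ x (n + 1)))
    {X : DerivedCategory.Bounded (FDMod k A)} (hX : Indecomposable X) :
    ∃ (M : FinRep k Qᵒᵖ) (i : ℤ), Indecomposable M ∧
      Nonempty (X ≅ (objF hrad q (extend hwalk base hbase M))⟦i⟧) := by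
  obtain ⟨K, hK, ⟨e⟩⟩ := HasBddRes.of_bounded (hasBddRes_single hrad q hpath) X.obj X.property
  obtain ⟨P, hP, ⟨e'⟩, hd⟩ := exists_radical hrad q hK
  obtain ⟨W, ⟨S⟩⟩ := Model.exists_of_radical hrad P hP.projective hd
  have hX0 : ¬ IsZero X.obj := fun h ↦ hX.1 ((IsZero.iff_id_eq_zero X).2
    (ObjectProperty.hom_ext _ (h.eq_of_src _ _)))
  obtain ⟨x, m, hxm⟩ : ∃ x m, Nontrivial (W.obj x m) := by
    by_contra! h
    exact hX0 ((S.isZero_of_subsingleton hrad h).of_iso (e ≪≫ e'))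
  obtain ⟨i, hi⟩ : ∃ i, height hbase x - i = m := ⟨height hbase x - m, sub_sub_cancel _ _⟩
  obtain ⟨M, ι, π, hιπ, hM⟩ := exists_retract hwalk hbase W i
    (fun x m ↦ Module.Finite.of_injective _ ((S.free m).injective x))
    (finite_support_of_model q S hP)
  have hM0 : ¬ IsZero M := fun h ↦ by
    obtain ⟨b⟩ := hM x
    rw [hi] at b
    have h1 := b.symm.injective.nontrivial
    obtain ⟨v, hv⟩ := exists_ne (0 : opObj M x)
    exact hv (congrArg (fun f ↦ opApp f x v) ((IsZero.iff_id_eq_zero _).1 h))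
  let T := modelG hrad q hwalk hbase i M
  have hT := isBddProj_complexG hrad q hwalk hbase i M
  obtain ⟨f, hf⟩ := T.exists_hom hrad S ι
  obtain ⟨g, hg⟩ := S.exists_hom hrad T π
  have hfg : f ≫ g = 𝟙 _ := T.hom_ext hrad fun x m v ↦ by
    rw [HomologicalComplex.comp_f, evMap_comp, LinearMap.comp_apply, hf, hg, ← GrRep.comp_app,
      hιπ, GrRep.id_app, HomologicalComplex.id_f, evMap_id, LinearMap.id_apply]
  have := (isZero_or_isIso_of_retract hX hP f g hfg (e ≪≫ e')).resolve_left
    (not_isZero_complexG hrad q hwalk hbase i hM0)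
  let e₁ : X.obj ≅ DerivedCategory.Q.obj (complexG hrad q hwalk hbase i M) :=
    e ≪≫ e' ≪≫ (asIso (DerivedCategory.Q.map f)).symm
  exact ⟨M, i, indecomposable_of_grRep hwalk hbase i hM0
    (T.eq_id_of_indecomposable hrad hT hX e₁), ⟨DerivedCategory.Bounded.ι.preimageIso
      (e₁ ≪≫ (objIso hrad q hwalk hbase i M).symm)⟩⟩

end Classification

end RadSqZero

end

theorem corollary4p2 {k : Type v} [Field k] [IsAlgClosed k]
    {A : Type u} [Category.{v} A] [Preadditive A] [Linear k A] [RadSqZero.IsLofd A k]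
    (hrad : RadSqZero.RadicalSquareZero A)
    {Q : Type w} [Quiver.{t} Q] (q : RadSqZero.QuiverOf k A Q)
    (hwalk : RadSqZero.WalkCondition Q)
    (hpath : ¬ ∃ x : ℕ → Q, ∀ n, Nonempty (x n ⟶ x (n + 1)))
    (base : Quiver.WeaklyConnectedComponent Q → Q)
    (hbase : ∀ c, Quiver.WeaklyConnectedComponent.mk (base c) = c)
    [HasDerivedCategory.{s} (RadSqZero.FDMod k A)] :
    (∀ (M : RadSqZero.FinRep k Qᵒᵖ) (i : ℤ), Indecomposable M →
      Indecomposable ((RadSqZero.objF hrad q (RadSqZero.extend hwalk base hbase M))⟦i⟧)) ∧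
    (∀ X : DerivedCategory.Bounded (RadSqZero.FDMod k A), Indecomposable X →
      ∃ (M : RadSqZero.FinRep k Qᵒᵖ) (i : ℤ), Indecomposable M ∧
        Nonempty (X ≅ (RadSqZero.objF hrad q (RadSqZero.extend hwalk base hbase M))⟦i⟧)) ∧
    (∀ (M N : RadSqZero.FinRep k Qᵒᵖ) (i j : ℤ), Indecomposable M → Indecomposable N →
      (Nonempty ((RadSqZero.objF hrad q (RadSqZero.extend hwalk base hbase M))⟦i⟧ ≅
          (RadSqZero.objF hrad q (RadSqZero.extend hwalk base hbase N))⟦j⟧) ↔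
        i = j ∧ Nonempty (M ≅ N))) := by
  exact ⟨fun _ i hM ↦ RadSqZero.indecomposable_objF hrad q hwalk hbase i hM,
    fun _ hX ↦ RadSqZero.exists_iso_objF hrad q hwalk hbase hpath hX,
    fun _ _ i j hM _ ↦ RadSqZero.nonempty_iso_iff hrad q hwalk hbase hM i j⟩
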